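/- **Conventions.** For a set $X$ and a cardinal $\kappa$, $[X]^\kappa$ is the set of subsets of $X$ of cardinality $\kappa$; a cardinal is identified with its initial ordinal. For a set $a$ of ordinals, $\mathrm{otp}(a)$ is its order type; for $i<\mathrm{otp}(a)$, $a(i)$ is the element $\alpha\in a$ with $\mathrm{otp}(a\cap\alpha)=i$; and $a[I]=\{a(i)\mid i\in I\}$. For an infinite regular cardinal $\lambda$ put $\sigma(\lambda,1)=\lambda$ and $\sigma(\lambda,n+1)=\left(2^{<\sigma(\lambda,n)}\right)^+$ for $1\le n<\omega$. For cardinals $\kappa<\lambda$, $\lambda$ is ${<}\kappa$-inaccessible if $\theta^{<\kappa}<\lambda$ for all cardinals $\theta<\lambda$. For cardinals $\mu,\lambda,\nu$ and $n<\omega$, $\mu\to(\lambda)^n_\nu$ says that for every $c:[\mu]^n\to\nu$ there is $H\in[\mu]^\lambda$ such that $c$ is constant on $[H]^n$; for an ordinal $\rho$ that is given as an ordinal sum, such as $\lambda+(n-1)$, $\mu\to(\rho)^n_\nu$ is defined in the same way with $H\subseteq\mu$ of order type $\rho$. A cardinal $\kappa$ is weakly compact if it is uncountable and $\kappa\to(\kappa)^2_2$.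 Sets of ordinals $a,b$ are *aligned* if $\mathrm{otp}(a)=\mathrm{otp}(b)$ and $\mathrm{otp}(a\cap\gamma)=\mathrm{otp}(b\cap\gamma)$ for all $\gamma\in a\cap b$; and $\mathbf r(a,b)=\{i<\mathrm{otp}(a)\mid a(i)\in b\}$. If $\mathrm{otp}(a)=\mathrm{otp}(b)=\rho$ and $i<\rho$, then $a,b$ are *aligned above $i$* if $a[\rho\setminus i]$ and $b[\rho\setminus i]$ are aligned. Put $\mathrm{tp}_{\mathrm{int}}(a,b)=\{(i,j)\in\mathrm{otp}(a)\times\mathrm{otp}(b)\mid a(i)=b(j)\}$. For $i<\mathrm{otp}(a)$ with $i<\omega$, an ordinal $\alpha$ is *$i$-possible* for $a$ if $\alpha>a(i-1)$ when $i>0$, and $\alpha<a(i+1)$ when $i+1<\mathrm{otp}(a)$; then $a_{i\mapsto\alpha}=(a\setminus\{a(i)\})\cup\{\alpha\}$. Let $H$ be a set of ordinals and $1\le n<\omega$. A family of sets $\langle u_b\mid b\in[H]^n\rangle$ is an *$n$-dimensional $\Delta$-system* if there are sets $R^{\mathbf m}_a$ ($\mathbf m\subseteq n$, $a\in[H]^{|\mathbf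 m|}$) such that $u_b\cap u_{b'}=R^{\mathbf m}_{b\cap b'}$ whenever $b,b'\in[H]^n$ are aligned and $\mathbf r(b,b')=\mathbf m$. If every $u_b$ is a set of ordinals, the family is a *uniform $n$-dimensional $\Delta$-system* if there are an ordinal $\rho$ and sets $\mathbf r_{\mathbf m}\subseteq\rho$ ($\mathbf m\subseteq n$) such that: $\mathrm{otp}(u_b)=\rho$ for all $b\in[H]^n$; whenever $a,b\in[H]^n$ are aligned with $\mathbf r(a,b)=\mathbf m$, then $u_a,u_b$ are aligned with $\mathbf r(u_a,u_b)=\mathbf r_{\mathbf m}$; and $\mathbf r_{\mathbf m_0\cap\mathbf m_1}=\mathbf r_{\mathbf m_0}\cap\mathbf r_{\mathbf m_1}$ for all $\mathbf m_0,\mathbf m_1\subseteq n$. **Corollary 3.10.** Suppose that $1\le n<\omega$ and that $\lambda$ and $\mu$ are infinite regular cardinals such that $\lambda$ is uncountable but not weakly compact. Then the following are equivalent: 1. $\mu\ge\sigma(\lambda,n)$; 2. $\mu\to(\lambda)^n_2$; 3. $\mu\to(\lambda+(n-1))^n_\nu$ for every cardinal $\nu<\lambda$; 4. for every family $\langle u_b\mid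 b\in[\mu]^n\rangle$ of finite sets there is $H\in[\mu]^\lambda$ such that $\langle u_b\mid b\in[H]^n\rangle$ is an $n$-dimensional $\Delta$-system; 5. for all infinite cardinals $\kappa,\nu<\lambda$ such that $\lambda$ is ${<}\kappa$-inaccessible, every $g:[\mu]^n\to\nu$, and every family $\langle u_b\mid b\in[\mu]^n\rangle$ of sets of ordinals with $|u_b|<\kappa$ for all $b$, there are $H\in[\mu]^\lambda$ and $k<\nu$ such that (i) $g(b)=k$ for all $b\in[H]^n$; (ii) $\langle u_b\mid b\in[H]^n\rangle$ is a uniform $n$-dimensional $\Delta$-system; and (iii) for all $a,b\in[H]^n$ and all $m<n$, if $a$ and $b$ are aligned above $m$ and $a(m)=b(m)$, then for every $\alpha\in H$ that is $m$-possible for both $a$ and $b$ we have $\mathrm{tp}_{\mathrm{int}}(u_a,u_b)=\mathrm{tp}_{\mathrm{int}}(u_{a_{m\mapsto\alpha}},u_{b_{m\mapsto\alpha}})$. -/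

import Mathlib

universe u v

namespace HDelta

noncomputable section

/-! ### Sets of ordinals

`[μ]^n` for a cardinal `μ` is formed over the set `Set.Iio μ.ord` of ordinals below `μ`. A sequence
`⟨u_b | b ∈ [μ]^n⟩` is given by a total function on sets of ordinals, whose values outside `[μ]^n`
are never used. -/

/-- `[X]^κ`, the set of all subsets of `X` of cardinality `κ`. -/
def subsetsOfCard (X : Set Ordinal.{u}) (κ : Cardinal.{u}) : Set (Set Ordinal.{u}) :=
  {Y | Y ⊆ X ∧ Cardinal.mk Y = Cardinal.lift.{u + 1} κ}

/-- The order type of a set of ordinals. (A set of ordinals of `Ordinal.{u}` is a type in the next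
universe, hence so is its order type.) -/
def otp (a : Set Ordinal.{u}) : Ordinal.{u + 1} :=
  Ordinal.type (fun x y : a => x < y)

/-- `IsNth a i α` says that `a(i) = α`: the ordinal `α` is the element of `a` such that
`otp (a ∩ α) = i`. -/
def IsNth (a : Set Ordinal.{u}) (i : Ordinal.{u + 1}) (α : Ordinal.{u}) : Prop :=
  α ∈ a ∧ otp (a ∩ Set.Iio α) = i

/-- `a[I] = {a(i) | i ∈ I}`. -/
def subAt (a : Set Ordinal.{u}) (I : Set Ordinal.{u + 1}) : Set Ordinal.{u} :=
  {α | ∃ i ∈ I, IsNth a i α}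

/-- Two sets of ordinals are aligned if they have the same order type and every common element
occupies the same relative position in both. -/
def Aligned (a b : Set Ordinal.{u}) : Prop :=
  otp a = otp b ∧ ∀ γ ∈ a ∩ b, otp (a ∩ Set.Iio γ) = otp (b ∩ Set.Iio γ)

/-- `r(a, b) = {i < otp a | a(i) ∈ b}`. -/
def commonPos (a b : Set Ordinal.{u}) : Set Ordinal.{u + 1} :=
  {i | i < otp a ∧ ∃ α, IsNth a i α ∧ α ∈ b}

/-- `a` and `b` (of the same order type `ρ > i`) are aligned above `i` if `a[ρ \ i]` and `b[ρ \ i]`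
are aligned. -/
def AlignedAbove (i : Ordinal.{u + 1}) (a b : Set Ordinal.{u}) : Prop :=
  Aligned (subAt a (Set.Iio (otp a) \ Set.Iio i)) (subAt b (Set.Iio (otp b) \ Set.Iio i))

/-- The intersection type of `a` and `b`: the set of all `(i, j) ∈ otp a × otp b` such that
`a(i) = b(j)`. -/
def tpInt (a b : Set Ordinal.{u}) : Set (Ordinal.{u + 1} × Ordinal.{u + 1}) :=
  {p | p.1 < otp a ∧ p.2 < otp b ∧ ∃ α, IsNth a p.1 α ∧ IsNth b p.2 α}

/-- `α` is `i`-possible for `a`: if `i > 0` then `a(i - 1) < α`, and if `i + 1 < otp a` then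
`α < a(i + 1)`. -/
def Possible (i : ℕ) (a : Set Ordinal.{u}) (α : Ordinal.{u}) : Prop :=
  (0 < i → ∀ β, IsNth a ((i - 1 : ℕ) : Ordinal.{u + 1}) β → β < α) ∧
  (((i + 1 : ℕ) : Ordinal.{u + 1}) < otp a →
    ∀ β, IsNth a ((i + 1 : ℕ) : Ordinal.{u + 1}) β → α < β)

/-- The set obtained from `a` by replacing its `i`-th element `a(i)` by `α`. -/
def replaceAt (i : ℕ) (a : Set Ordinal.{u}) (α : Ordinal.{u}) : Set Ordinal.{u} :=
  (a \ {β | IsNth a (i : Ordinal.{u + 1}) β}) ∪ {α}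

/-! ### Higher-dimensional `Δ`-systems -/

/-- `⟨u_b | b ∈ [H]^n⟩` is an `n`-dimensional `Δ`-system: there are roots `R^m_a`, for `m ⊆ n` and
`a ∈ [H]^|m|`, such that `u_b ∩ u_b' = R^m_(b ∩ b')` whenever `b` and `b'` are aligned members of
`[H]^n` with `r(b, b') = m`. -/
def IsDeltaSystem {X : Type v} (n : ℕ) (H : Set Ordinal.{u}) (U : Set Ordinal.{u} → Set X) :
    Prop :=
  ∃ R : Set Ordinal.{u + 1} → Set Ordinal.{u} → Set X,
    ∀ b ∈ subsetsOfCard H n, ∀ b' ∈ subsetsOfCard H n,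
      ∀ m ⊆ Set.Iio (n : Ordinal.{u + 1}),
        Aligned b b' → commonPos b b' = m → U b ∩ U b' = R m (b ∩ b')

/-- `⟨u_b | b ∈ [H]^n⟩`, a family of sets of ordinals, is a uniform `n`-dimensional `Δ`-system, as
witnessed by an ordinal `ρ` and sets `r m ⊆ ρ` for `m ⊆ n`. -/
def IsUniformDeltaSystem (n : ℕ) (H : Set Ordinal.{u})
    (U : Set Ordinal.{u} → Set Ordinal.{u}) : Prop :=
  ∃ (ρ : Ordinal.{u + 1}) (r : Set Ordinal.{u + 1} → Set Ordinal.{u + 1}),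
    (∀ m ⊆ Set.Iio (n : Ordinal.{u + 1}), r m ⊆ Set.Iio ρ) ∧
    (∀ b ∈ subsetsOfCard H n, otp (U b) = ρ) ∧
    (∀ a ∈ subsetsOfCard H n, ∀ b ∈ subsetsOfCard H n,
      ∀ m ⊆ Set.Iio (n : Ordinal.{u + 1}), Aligned a b → commonPos a b = m →
        Aligned (U a) (U b) ∧ commonPos (U a) (U b) = r m) ∧
    (∀ m₀ ⊆ Set.Iio (n : Ordinal.{u + 1}), ∀ m₁ ⊆ Set.Iio (n : Ordinal.{u + 1}),
      r (m₀ ∩ m₁) = r m₀ ∩ r m₁)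

/-- For all `a, b ∈ [H]^n` and `m < n`, if `a` and `b` are aligned above `m` and `a(m) = b(m)`,
then replacing `a(m) = b(m)` in both sets by any `α ∈ H` that is `m`-possible for both does not
change the intersection type of `u_a` and `u_b`. -/
def ReplacementInvariant (n : ℕ) (H : Set Ordinal.{u})
    (U : Set Ordinal.{u} → Set Ordinal.{u}) : Prop :=
  ∀ a ∈ subsetsOfCard H n, ∀ b ∈ subsetsOfCard H n, ∀ m : ℕ, m < n →
    AlignedAbove (m : Ordinal.{u + 1}) a b →
    (∃ γ, IsNth a (m : Ordinal.{u + 1}) γ ∧ IsNth b (m : Ordinal.{u + 1}) γ) →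
    ∀ α ∈ H, Possible m a α → Possible m b α →
      tpInt (U a) (U b) = tpInt (U (replaceAt m a α)) (U (replaceAt m b α))

/-! ### Cardinals and partition relations -/

/-- `σ(lam, 1) = lam` and `σ(lam, n + 1) = (2 ^ (< σ(lam, n)))⁺` for `n ≥ 1`. The value at `n = 0`
is a dummy. -/
def sigma (lam : Cardinal.{u}) : ℕ → Cardinal.{u}
  | 0 => lam
  | 1 => lam
  | n + 2 => Order.succ (Cardinal.powerlt 2 (sigma lam (n + 1)))

/-- For cardinals `κ < lam`: `lam` is `<κ`-inaccessible if `θ ^ (< κ) < lam` for all cardinals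
`θ < lam`. -/
def LTInaccessible (κ lam : Cardinal.{u}) : Prop :=
  κ < lam ∧ ∀ θ < lam, Cardinal.powerlt θ κ < lam

/-- `c` is a function from `[μ]^n` to `ν`. -/
def IsColoring (μ : Cardinal.{u}) (n : ℕ) (ν : Cardinal.{u})
    (c : Set Ordinal.{u} → Ordinal.{u}) : Prop :=
  ∀ b ∈ subsetsOfCard (Set.Iio μ.ord) n, c b < ν.ord

/-- `c` is constant on `[H]^n`. -/
def Homogeneous (n : ℕ) (H : Set Ordinal.{u}) (c : Set Ordinal.{u} → Ordinal.{u}) : Prop :=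
  ∀ b ∈ subsetsOfCard H n, ∀ b' ∈ subsetsOfCard H n, c b = c b'

/-- The partition relation `μ → (lam)^n_ν` for cardinals `μ`, `lam`, `ν`. -/
def Arrow (μ lam : Cardinal.{u}) (n : ℕ) (ν : Cardinal.{u}) : Prop :=
  ∀ c : Set Ordinal.{u} → Ordinal.{u}, IsColoring μ n ν c →
    ∃ H ∈ subsetsOfCard (Set.Iio μ.ord) lam, Homogeneous n H c

/-- The partition relation `μ → (ρ)^n_ν` for cardinals `μ`, `ν` and an ordinal `ρ`: the homogeneous
set has order type `ρ`. -/
def ArrowOrd (μ : Cardinal.{u}) (ρ : Ordinal.{u}) (n : ℕ) (ν : Cardinal.{u}) : Prop :=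
  ∀ c : Set Ordinal.{u} → Ordinal.{u}, IsColoring μ n ν c →
    ∃ H ⊆ Set.Iio μ.ord, otp H = Ordinal.lift.{u + 1} ρ ∧ Homogeneous n H c

/-- A cardinal `κ` is weakly compact if it is uncountable and `κ → (κ)^2_2`. -/
def IsWeaklyCompact (κ : Cardinal.{u}) : Prop :=
  Cardinal.aleph0 < κ ∧ Arrow κ κ 2 2

end

end HDelta

/-! The equivalence has a positive half (`μ ≥ σ(lam, n)` yields statements 3, 4 and 5) and a
negative half (`μ → (lam)^n_2` forces `μ ≥ σ(lam, n)`). The way back from 3, 4 and 5 to 2 is soft: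
`lam + (n - 1)` has cardinality `lam`; a `Δ`-system of singletons of colours has constant colour;
and 5 already contains a colouring clause.

Positive half. If `#A > 2 ^< σ`, counting branches of the Erdős–Rado tree gives a top point `δ ∈ A`
and `σ` many points `B` below it such that everything recorded about `a ∪ {γ}`, for `γ ∈ B` above
`a`, also holds of `a ∪ {δ}` (`exists_endHomogeneous`). Applied to colours alone and iterated, this
is the Erdős–Rado theorem; the `n - 1` top points form the extra tail (`erdosRado`). For families of
sets, every `u b` is enumerated by a fixed label set, and the coincidences between the enumerations
are recorded as well. The points of `u (a ∪ {γ})` then split into old ones, shared with `u (a ∪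
{δ})`, and new ones, disjoint for different `γ` (`exists_endFamily`). The induction hypothesis for
the family `w a = u (a ∪ {δ})`, with the set of old labels as part of the colour, makes `w` uniform
and that set a constant `S`. One more thinning removes all accidental coincidences
(`exists_avoiding_subset`). What remains is a description of the intersections of `u` by those of
`w` and by `S` (`TopPattern`), from which uniformity and replacement invariance pass to dimension `n
+ 1`. Dimension one is the `Δ`-system lemma for sets of size `<κ` (`exists_deltaSystem`).

Statement 4 asks in addition that the root depend only on `b ∩ b'` and its positions. Passing to a
subset with gaps gives this (`UniformOn.eq_of_root`).

Negative half. Failure of weak compactness is a bad colouring of the pairs of `lam`. Sierpiński's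
colouring handles the pairs of `2 ^ θ` for `θ < lam`, and gluing the two handles `2 ^< lam`. A
stepping-up lemma turns a bad colouring of `n`-sets of `τ` into one of `(n + 1)`-sets of `2 ^ τ`
(`hasBadColoring_succ`), so all cardinals below `σ(lam, n)` are covered. -/

namespace HDelta
open Cardinal Set

/-! ### Well-ordered sets -/

section Tools

variable {W : Type u} [LinearOrder W] [WellFoundedLT W]

/-- An order embedding of `c.ord` into `A` has an image of order type `c.ord`, and every proper
initial segment of an initial ordinal is smaller than it. -/
theorem exists_subset_small_initialSegments {c : Cardinal.{u}} {A : Set W} (hA : c ≤ #A) :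
    ∃ A' ⊆ A, #A' = c ∧ ∀ x ∈ A', #(A' ∩ Iio x : Set W) < c := by
  have h1 : Ordinal.type (fun x y : c.ord.ToType => x < y) ≤
      Ordinal.type (fun x y : A => x < y) := by
    rw [Ordinal.type_toType, ord_le, Ordinal.card_type]; exact hA
  obtain ⟨f⟩ := Ordinal.type_le_iff'.1 h1
  have hf : Function.Injective (fun k => (f k : W)) := Subtype.val_injective.comp f.injective
  refine ⟨range fun k => (f k : W), ?_, ?_, ?_⟩
  · rintro _ ⟨k, rfl⟩; exact (f k).2
  · rw [mk_range_eq _ hf, mk_ord_toType]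
  · rintro _ ⟨k, rfl⟩
    have : (range (fun k => (f k : W)) ∩ Iio (f k : W)) ⊆ (fun k => (f k : W)) '' Iio k := by
      rintro _ ⟨⟨l, rfl⟩, hl⟩
      exact ⟨l, f.map_rel_iff.1 hl, rfl⟩
    exact (mk_le_mk_of_subset this).trans_lt (mk_image_le.trans_lt ((mk_Iio_lt k (by simp)).trans_eq (mk_ord_toType c)))

/-- Let `γ` enter `H` exactly when it is `ok` over all finite sets of earlier members. If `H` had
fewer than `c` elements, the hypothesis for `B = H` would give a further point that satisfies the
entry condition. The new point need not lie above `B`, so no enumeration of length `c` is required.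
-/
theorem exists_greedy_subset {c : Cardinal.{u}} {A : Set W} (ok : Finset W → W → Prop)
    (h : ∀ B ⊆ A, #B < c → ∃ γ ∈ A, γ ∉ B ∧ ∀ p : Finset W, ↑p ⊆ B → ok p γ) :
    ∃ H ⊆ A, c ≤ #H ∧
      ∀ γ ∈ H, ∀ p : Finset W, ↑p ⊆ H → (∀ x ∈ p, x < γ) → ok p γ := by
  let P : W → Prop := wellFounded_lt.fix (C := fun _ => Prop) fun γ rec =>
    γ ∈ A ∧ ∀ p : Finset W, (∀ x ∈ p, ∃ hx : x < γ, rec x hx) → ok p γ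
  have hP : ∀ γ, P γ ↔ (γ ∈ A ∧ ∀ p : Finset W, (∀ x ∈ p, ∃ _ : x < γ, P x) → ok p γ) := by
    intro γ
    exact iff_of_eq (wellFounded_lt.fix_eq _ γ)
  refine ⟨{γ | P γ}, fun γ hγ => ((hP γ).1 hγ).1, ?_, ?_⟩
  · by_contra! hc
    obtain ⟨γ, hγA, hγ, hok⟩ := h {γ | P γ} (fun γ hγ => ((hP γ).1 hγ).1) hc
    exact hγ ((hP γ).2 ⟨hγA, fun p hp => hok p fun x hx => (hp x hx).2⟩)
  · intro γ hγ p hpH hp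
    exact ((hP γ).1 hγ).2 p fun x hx => ⟨hp x hx, hpH hx⟩

end Tools

theorem le_two_powerlt (c : Cardinal.{u}) : c ≤ 2 ^< c := by
  by_contra! h
  exact (le_powerlt 2 h).not_gt (cantor _)

theorem mk_finset_lt_of_lt {α : Type u} {c : Cardinal.{u}} (hc : ℵ₀ ≤ c) (h : #α < c) :
    #(Finset α) < c := by
  rcases finite_or_infinite α with hf | hi
  · exact (lt_aleph0_of_finite _).trans_le hc
  · rwa [mk_finset_of_infinite]

theorem mk_finset_subset_lt {α : Type u} {c : Cardinal.{u}} (hc : ℵ₀ ≤ c) {B : Set α} (h : #B < c) :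
    #{p : Finset α | ↑p ⊆ B} < c := by
  classical
  have hs : {p : Finset α | ↑p ⊆ B} ⊆ range fun q : Finset B => q.map (Function.Embedding.subtype _) := by
    intro p hp
    refine ⟨p.subtype (· ∈ B), ?_⟩
    refine (Finset.subtype_map _).trans ?_
    exact Finset.filter_true_of_mem fun x hx => hp hx
  exact (mk_le_mk_of_subset hs).trans_lt (mk_range_le.trans_lt (mk_finset_lt_of_lt hc h))

/-! ### End-homogeneous sets: the Erdős–Rado tree argument. -/

section EndHomogeneous

variable {W Q : Type u} [LinearOrder W] [WellFoundedLT W]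

/-- The end-homogeneity tree of `F` on `A`: `endTree A F δ α` says that `α` and `δ` have the same
`F`-values over the predecessors of `α` in the tree. -/
def endTree (A : Set W) (F : Finset W → Finset W → W → Set Q) (δ : W) : W → Prop :=
  wellFounded_lt.fix (C := fun _ => Prop) fun α rec =>
    α ∈ A ∧ α < δ ∧ ∀ p p' : Finset W, (∀ x ∈ p, ∃ hx : x < α, rec x hx) →
      (∀ x ∈ p', ∃ hx : x < α, rec x hx) → F p p' α = F p p' δ

variable {A : Set W} {F : Finset W → Finset W → W → Set Q}

theorem endTree_iff {δ α : W} : endTree A F δ α ↔ α ∈ A ∧ α < δ ∧ ∀ p p' : Finset W,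
    (∀ x ∈ p, x < α ∧ endTree A F δ x) → (∀ x ∈ p', x < α ∧ endTree A F δ x) →
      F p p' α = F p p' δ := by
  have := iff_of_eq (wellFounded_lt.fix_eq (C := fun _ => Prop) (fun α rec =>
    α ∈ A ∧ α < δ ∧ ∀ p p' : Finset W, (∀ x ∈ p, ∃ hx : x < α, rec x hx) →
      (∀ x ∈ p', ∃ hx : x < α, rec x hx) → F p p' α = F p p' δ) α)
  simp only [exists_prop] at this
  exact this

theorem endTree_mem {δ α : W} (h : endTree A F δ α) : α ∈ A := (endTree_iff.1 h).1
theorem endTree_lt {δ α : W} (h : endTree A F δ α) : α < δ := (endTree_iff.1 h).2.1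

theorem endTree_eq {δ α : W} (h : endTree A F δ α) {p p' : Finset W}
    (hp : ∀ x ∈ p, x < α ∧ endTree A F δ x) (hp' : ∀ x ∈ p', x < α ∧ endTree A F δ x) :
    F p p' α = F p p' δ :=
  (endTree_iff.1 h).2.2 p p' hp hp'

/-- By induction on `β`: membership of `β` depends on earlier predecessors, which agree by
induction, and on `F`-values at the top, which agree for `α` and `δ` over predecessors below `α`. -/
theorem endTree_restrict {δ α : W} (h : endTree A F δ α) (β : W) :
    β < α → (endTree A F α β ↔ endTree A F δ β) := by
  induction β using WellFoundedLT.induction with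
  | _ β ih =>
    intro hβ
    rw [endTree_iff, endTree_iff (δ := δ)]
    have key : ∀ p : Finset W, (∀ x ∈ p, x < β ∧ endTree A F α x) ↔
        (∀ x ∈ p, x < β ∧ endTree A F δ x) := by
      intro p
      refine forall₂_congr fun x _ => and_congr_right fun hxβ => ih x hxβ (hxβ.trans hβ)
    simp only [key]
    refine and_congr_right fun _ => ?_
    simp only [hβ, hβ.trans (endTree_lt h), true_and]
    refine forall₄_congr fun p p' hp hp' => ?_
    rw [endTree_eq h (fun x hx => ⟨(hp x hx).1.trans hβ, (hp x hx).2⟩)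
      (fun x hx => ⟨(hp' x hx).1.trans hβ, (hp' x hx).2⟩)]

theorem endTree_trans {δ α β : W} (h : endTree A F δ α) (h' : endTree A F α β) :
    endTree A F δ β :=
  (endTree_restrict h β (endTree_lt h')).1 h'

instance endTree_wellFounded : IsWellFounded W (fun α δ => endTree A F δ α) :=
  ⟨Subrelation.wf (fun h => endTree_lt h) (wellFounded_lt (α := W))⟩

/-- The rank in the end-homogeneity tree. -/
noncomputable def endRank (A : Set W) (F : Finset W → Finset W → W → Set Q) (δ : W) : Ordinal.{u} :=
  IsWellFounded.rank (fun α δ => endTree A F δ α) δ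

theorem endRank_lt {δ α : W} (h : endTree A F δ α) : endRank A F α < endRank A F δ :=
  IsWellFounded.rank_lt_of_rel (r := fun α δ => endTree A F δ α) h

theorem exists_endRank_eq (δ : W) : ∀ ξ < endRank A F δ, ∃ α, endTree A F δ α ∧ endRank A F α = ξ := by
  induction δ using WellFoundedLT.induction with
  | _ δ ih =>
    intro ξ hξ
    rw [endRank, IsWellFounded.rank_eq, Ordinal.lt_iSup_iff] at hξ
    obtain ⟨⟨β, hβ⟩, hξβ⟩ := hξ
    rcases (Order.lt_succ_iff.1 hξβ).eq_or_lt with h | h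
    · exact ⟨β, hβ, h.symm⟩
    · obtain ⟨α, hα, rfl⟩ := ih β (endTree_lt hβ) ξ h
      exact ⟨α, endTree_trans hβ hα, rfl⟩

theorem endRank_lt_iff {δ α β : W} (hα : endTree A F δ α) (hβ : endTree A F δ β) :
    endRank A F α < endRank A F β ↔ α < β := by
  have key : ∀ {α β}, endTree A F δ α → endTree A F δ β → α < β → endRank A F α < endRank A F β :=
    fun hα hβ h => endRank_lt ((endTree_restrict hβ _ h).2 hα)
  refine ⟨fun h => ?_, key hα hβ⟩
  by_contra! hn
  rcases hn.eq_or_lt with rfl | hn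
  · exact lt_irrefl _ h
  · exact (key hβ hα hn).not_gt h

theorem endRank_injOn (δ : W) : Set.InjOn (endRank A F) {α | endTree A F δ α} := by
  intro α hα β hβ h
  rcases lt_trichotomy α β with hlt | heq | hlt
  · exact absurd h ((endRank_lt_iff hα hβ).2 hlt).ne
  · exact heq
  · exact absurd h ((endRank_lt_iff hβ hα).2 hlt).ne'

/-- Here `ψ` names points by their rank. A point is determined by its rank together with the
`F`-values over its predecessors, read through these names. By induction the predecessors of `δ` and
`δ'` of equal rank coincide, so both points have the same predecessors and the same `F`-values; if
they differed, the smaller would be a predecessor of the larger, and hence of itself. -/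
theorem endTree_eq_of_code [DecidableEq W] {K : Type u} [LinearOrder K] {ψ : W → K}
    (hψ : ∀ α ∈ A, ∀ β ∈ A, ψ α < ψ β ↔ endRank A F α < endRank A F β) (δ : W) :
    ∀ δ' : W, δ ∈ A → δ' ∈ A → ψ δ = ψ δ' →
    (∀ r r' : Finset K, ∀ q : Q,
      (∃ p p' : Finset W, (∀ x ∈ p, endTree A F δ x) ∧ (∀ x ∈ p', endTree A F δ x) ∧
        p.image ψ = r ∧ p'.image ψ = r' ∧ q ∈ F p p' δ) ↔
      (∃ p p' : Finset W, (∀ x ∈ p, endTree A F δ' x) ∧ (∀ x ∈ p', endTree A F δ' x) ∧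
        p.image ψ = r ∧ p'.image ψ = r' ∧ q ∈ F p p' δ')) → δ = δ' := by
  have hψe : ∀ α ∈ A, ∀ β ∈ A, ψ α = ψ β ↔ endRank A F α = endRank A F β := by
    intro α hα β hβ
    have h1 := hψ α hα β hβ
    have h2 := hψ β hβ α hα
    constructor
    · intro h; simp only [h, lt_irrefl, false_iff, not_lt] at h1 h2; exact le_antisymm h2 h1
    · intro h; simp only [h, lt_irrefl, iff_false, not_lt] at h1 h2; exact le_antisymm h2 h1
  induction δ using WellFoundedLT.induction with
  | _ δ ih =>
  intro δ' hδ hδ' hr hcode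
  have hrk : endRank A F δ = endRank A F δ' := (hψe _ hδ _ hδ').1 hr
  have hsub : ∀ α, endTree A F δ α → endTree A F δ' α := by
    intro α hα
    obtain ⟨α', hα', he⟩ := exists_endRank_eq (A := A) (F := F) δ' (endRank A F α)
      (hrk ▸ endRank_lt hα)
    -- The code of a predecessor `α` is the part of the code of `δ` that mentions only names below
    -- `ψ α`.
    have key : ∀ {δ α : W}, δ ∈ A → endTree A F δ α → ∀ (r r' : Finset K) (q : Q),
        (∃ p p' : Finset W, (∀ x ∈ p, endTree A F α x) ∧ (∀ x ∈ p', endTree A F α x) ∧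
          p.image ψ = r ∧ p'.image ψ = r' ∧ q ∈ F p p' α) ↔
        ((∀ k ∈ r, k < ψ α) ∧ (∀ k ∈ r', k < ψ α) ∧
        ∃ p p' : Finset W, (∀ x ∈ p, endTree A F δ x) ∧ (∀ x ∈ p', endTree A F δ x) ∧
          p.image ψ = r ∧ p'.image ψ = r' ∧ q ∈ F p p' δ) := by
      intro δ α hδ hα r r' q
      constructor
      · rintro ⟨p, p', hp, hp', rfl, rfl, hq⟩
        have aux : ∀ p : Finset W, (∀ x ∈ p, endTree A F α x) → ∀ k ∈ p.image ψ, k < ψ α := by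
          intro p hp k hk
          obtain ⟨x, hx, rfl⟩ := Finset.mem_image.1 hk
          exact (hψ _ (endTree_mem (hp x hx)) _ (endTree_mem hα)).2 (endRank_lt (hp x hx))
        refine ⟨aux p hp, aux p' hp', p, p', fun x hx => endTree_trans hα (hp x hx),
          fun x hx => endTree_trans hα (hp' x hx), rfl, rfl, ?_⟩
        rwa [← endTree_eq hα (fun x hx => ⟨endTree_lt (hp x hx), endTree_trans hα (hp x hx)⟩)
          (fun x hx => ⟨endTree_lt (hp' x hx), endTree_trans hα (hp' x hx)⟩)]
      · rintro ⟨hr, hr', p, p', hp, hp', rfl, rfl, hq⟩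
        have aux : ∀ p : Finset W, (∀ x ∈ p, endTree A F δ x) → (∀ k ∈ p.image ψ, k < ψ α) →
            ∀ x ∈ p, x < α := by
          intro p hp hr x hx
          have := hr _ (Finset.mem_image_of_mem _ hx)
          rw [hψ _ (endTree_mem (hp x hx)) _ (endTree_mem hα), endRank_lt_iff (hp x hx) hα] at this
          exact this
        have h1 := aux p hp hr
        have h2 := aux p' hp' hr'
        refine ⟨p, p', fun x hx => (endTree_restrict hα x (h1 x hx)).2 (hp x hx),
          fun x hx => (endTree_restrict hα x (h2 x hx)).2 (hp' x hx), rfl, rfl, ?_⟩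
        rwa [endTree_eq hα (fun x hx => ⟨h1 x hx, hp x hx⟩) (fun x hx => ⟨h2 x hx, hp' x hx⟩)]
    have heψ : ψ α = ψ α' := (hψe _ (endTree_mem hα) _ (endTree_mem hα')).2 he.symm
    have : α = α' := by
      refine ih α (endTree_lt hα) α' (endTree_mem hα) (endTree_mem hα') heψ fun r r' q => ?_
      rw [key hδ hα, key hδ' hα', hcode, heψ]
    rwa [this]
  have hiff : ∀ α, endTree A F δ α ↔ endTree A F δ' α := by
    refine fun α => ⟨hsub α, fun hα => ?_⟩
    obtain ⟨α', hα', he⟩ := exists_endRank_eq (A := A) (F := F) δ (endRank A F α)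
      (hrk.symm ▸ endRank_lt hα)
    rwa [← endRank_injOn (A := A) (F := F) δ' (hsub _ hα') hα he]
  have hinj : Set.InjOn ψ {α | endTree A F δ' α} := by
    intro α hα β hβ h
    exact endRank_injOn δ' hα hβ ((hψe _ (endTree_mem hα) _ (endTree_mem hβ)).1 h)
  have himg : ∀ p p' : Finset W, (∀ x ∈ p, endTree A F δ' x) → (∀ x ∈ p', endTree A F δ' x) →
      p.image ψ = p'.image ψ → p = p' := by
    intro p p' hp hp' h
    have := congrArg (fun s : Finset K => (s : Set K)) h
    simp only [Finset.coe_image] at this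
    exact Finset.coe_injective ((hinj.image_eq_image_iff (fun x hx => hp x hx)
      (fun x hx => hp' x hx)).1 this)
  have hF : ∀ p p' : Finset W, (∀ x ∈ p, endTree A F δ' x) → (∀ x ∈ p', endTree A F δ' x) →
      F p p' δ = F p p' δ' := by
    intro p p' hp hp'
    ext q
    have := hcode (p.image ψ) (p'.image ψ) q
    constructor
    · intro hq
      obtain ⟨p₁, p₁', h1, h1', h2, h2', h3⟩ := this.1 ⟨p, p', fun x hx => (hiff x).2 (hp x hx),
        fun x hx => (hiff x).2 (hp' x hx), rfl, rfl, hq⟩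
      rwa [← himg _ _ h1 hp h2, ← himg _ _ h1' hp' h2']
    · intro hq
      obtain ⟨p₁, p₁', h1, h1', h2, h2', h3⟩ := this.2 ⟨p, p', hp, hp', rfl, rfl, hq⟩
      rwa [← himg _ _ (fun x hx => (hiff x).1 (h1 x hx)) hp h2,
        ← himg _ _ (fun x hx => (hiff x).1 (h1' x hx)) hp' h2']
  rcases lt_trichotomy δ δ' with hlt | heq | hlt
  · have : endTree A F δ' δ := endTree_iff.2 ⟨hδ, hlt, fun p p' hp hp' =>
      hF p p' (fun x hx => (hp x hx).2) (fun x hx => (hp' x hx).2)⟩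
    exact absurd (endTree_lt ((hiff δ).2 this)) (lt_irrefl _)
  · exact heq
  · have : endTree A F δ δ' := endTree_iff.2 ⟨hδ', hlt, fun p p' hp hp' =>
      (hF p p' (fun x hx => (hiff x).1 (hp x hx).2) (fun x hx => (hiff x).1 (hp' x hx).2)).symm⟩
    exact absurd (endTree_lt ((hiff δ').1 this)) (lt_irrefl _)

/-- If every `δ ∈ A` had fewer than `σ` predecessors, its code would be a rank below `σ` and a
subset of a set of size `<σ`. There are at most `σ · 2 ^< σ = 2 ^< σ` such codes, fewer than the
elements of `A`. So some `δ` has `σ` predecessors, and these form `B`. The two set arguments of `F`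
allow it to compare two sets with the same top. -/
theorem exists_endHomogeneous {σ : Cardinal.{u}} (hσ : ℵ₀ ≤ σ) (hQ : #Q < σ) (A : Set W)
    (hA : 2 ^< σ < #A) (F : Finset W → Finset W → W → Set Q) :
    ∃ δ ∈ A, ∃ B ⊆ A, σ ≤ #B ∧ ∀ γ ∈ B, γ < δ ∧ ∀ p p' : Finset W, ↑p ⊆ B → ↑p' ⊆ B →
      (∀ x ∈ p, x < γ) → (∀ x ∈ p', x < γ) → F p p' γ = F p p' δ := by
  classical
  by_contra! hcon
  have hsmall : ∀ δ ∈ A, #{α | endTree A F δ α} < σ := by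
    intro δ hδ
    by_contra! hle
    obtain ⟨γ, hγ, h⟩ := hcon δ hδ {α | endTree A F δ α} (fun α hα => endTree_mem hα) hle
    obtain ⟨p, p', hp, hp', hpγ, hpγ', hne⟩ := h (endTree_lt hγ)
    exact hne (endTree_eq hγ (fun x hx => ⟨hpγ x hx, hp hx⟩) fun x hx => ⟨hpγ' x hx, hp' hx⟩)
  have hrank : ∀ δ ∈ A, endRank A F δ < σ.ord := by
    intro δ hδ
    rw [lt_ord]
    have h1 : Iio (endRank A F δ) ⊆ endRank A F '' {α | endTree A F δ α} := fun ξ hξ =>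
      exists_endRank_eq δ ξ hξ
    have h2 := (lift_le.2 (mk_le_mk_of_subset h1)).trans (mk_image_le_lift (f := endRank A F))
    rw [mk_Iio_ordinal, lift_lift, lift_le] at h2
    exact h2.trans_lt (hsmall δ hδ)
  have hex : ∀ δ, ∃ k : σ.ord.ToType, δ ∈ A → Ordinal.typein (α := σ.ord.ToType) (· < ·) k = endRank A F δ := by
    intro δ
    by_cases hδ : δ ∈ A
    · obtain ⟨k, hk⟩ := Ordinal.typein_surj (fun x y : σ.ord.ToType => x < y) (o := endRank A F δ)
        (by rw [Ordinal.type_toType]; exact hrank δ hδ)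
      exact ⟨k, fun _ => hk⟩
    · have : Nonempty σ.ord.ToType :=
        nonempty_ord_toType (aleph0_pos.trans_le hσ).ne'
      exact ⟨this.some, fun h => absurd h hδ⟩
  choose ψ hψ using hex
  have hψlt : ∀ α ∈ A, ∀ β ∈ A, ψ α < ψ β ↔ endRank A F α < endRank A F β := by
    intro α hα β hβ
    rw [← hψ α hα, ← hψ β hβ, Ordinal.typein_lt_typein]
  -- The possible entries of a code at rank `k`: two finite sets of smaller ranks and a value.
  let S : σ.ord.ToType → Set (Finset σ.ord.ToType × Finset σ.ord.ToType × Q) := fun k =>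
    {z | (∀ x ∈ z.1, x < k) ∧ (∀ x ∈ z.2.1, x < k)}
  let code : A → Σ k : σ.ord.ToType, Set (S k) := fun δ => ⟨ψ δ, {z | ∃ p p' : Finset W,
    (∀ x ∈ p, endTree A F δ x) ∧ (∀ x ∈ p', endTree A F δ x) ∧
        p.image ψ = z.1.1 ∧ p'.image ψ = z.1.2.1 ∧ z.1.2.2 ∈ F p p' δ}⟩
  have hcode : Function.Injective code := by
    rintro ⟨δ, hδ⟩ ⟨δ', hδ'⟩ h
    have hk : ψ δ = ψ δ' := congrArg Sigma.fst h
    have h' : ∀ z, z ∈ (fun s : Σ k : σ.ord.ToType, Set (S k) => Subtype.val '' s.2) (code ⟨δ, hδ⟩) ↔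
        z ∈ (fun s : Σ k : σ.ord.ToType, Set (S k) => Subtype.val '' s.2) (code ⟨δ', hδ'⟩) := by
      rw [h]; exact fun _ => Iff.rfl
    have hmem : ∀ {δ : W} (hδ : δ ∈ A) (r r' q),
        ((r, r', q) ∈ (fun s : Σ k : σ.ord.ToType, Set (S k) => Subtype.val '' s.2) (code ⟨δ, hδ⟩) ↔
        ∃ p p' : Finset W, (∀ x ∈ p, endTree A F δ x) ∧ (∀ x ∈ p', endTree A F δ x) ∧
          p.image ψ = r ∧ p'.image ψ = r' ∧ q ∈ F p p' δ) := by
      intro δ hδ r r' q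
      constructor
      · rintro ⟨⟨z, hz⟩, hz', rfl⟩; exact hz'
      · rintro ⟨p, p', hp, hp', rfl, rfl, hq⟩
        have aux : ∀ p : Finset W, (∀ x ∈ p, endTree A F δ x) → ∀ k ∈ p.image ψ, k < ψ δ := by
          intro p hp k hk
          obtain ⟨x, hx, rfl⟩ := Finset.mem_image.1 hk
          exact (hψlt _ (endTree_mem (hp x hx)) _ hδ).2 (endRank_lt (hp x hx))
        exact ⟨⟨(_, _, q), aux p hp, aux p' hp'⟩, ⟨p, p', hp, hp', rfl, rfl, hq⟩, rfl⟩
    refine Subtype.ext (endTree_eq_of_code hψlt δ δ' hδ hδ' hk fun r r' q => ?_)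
    rw [← hmem hδ, ← hmem hδ']
    exact h' _
  have hS : ∀ k, #(S k) < σ := by
    intro k
    have h1 : #(Iio k) < σ := (mk_Iio_lt k (by simp)).trans_eq (mk_ord_toType σ)
    have h2 := mk_finset_subset_lt hσ h1
    have h3 : S k ⊆ {p : Finset σ.ord.ToType | ↑p ⊆ Iio k} ×ˢ
        ({p : Finset σ.ord.ToType | ↑p ⊆ Iio k} ×ˢ (univ : Set Q)) := fun z hz =>
      ⟨fun x hx => hz.1 x hx, fun x hx => hz.2 x hx, mem_univ _⟩
    refine (mk_le_mk_of_subset h3).trans_lt ?_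
    simp only [mk_setProd, mk_univ]
    exact mul_lt_of_lt hσ h2 (mul_lt_of_lt hσ h2 hQ)
  have : #A ≤ 2 ^< σ := by
    refine (mk_le_of_injective hcode).trans ?_
    rw [mk_sigma]
    refine (sum_le_sum _ (fun _ => 2 ^< σ) fun k => ?_).trans ?_
    · rw [mk_set]; exact le_powerlt 2 (hS k)
    · rw [sum_const', mk_ord_toType]
      exact mul_le_of_le (hσ.trans (le_two_powerlt σ)) (le_two_powerlt σ) le_rfl
  exact this.not_gt hA

end EndHomogeneous
/-! ### Families of labelled sets -/

section Labelled

variable {I : Type u} {X : Type v}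

/-- `Hit f h i j` says that the `i`-th point of `f` is the `j`-th point of `h`. -/
def Hit (f h : I → Option X) (i j : I) : Prop := ∃ x, f i = some x ∧ h j = some x

theorem Hit.symm {f h : I → Option X} {i j : I} : Hit f h i j → Hit h f j i :=
  fun ⟨x, h1, h2⟩ => ⟨x, h2, h1⟩

theorem Hit.trans {f g h : I → Option X} {i j k : I} : Hit f g i j → Hit g h j k → Hit f h i k := by
  rintro ⟨x, h1, h2⟩ ⟨y, h3, h4⟩
  rw [h2, Option.some_inj] at h3
  exact ⟨x, h1, h3 ▸ h4⟩

theorem Hit.eq {f h : I → Option X} {i j : I} : Hit f h i j → f i = h j :=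
  fun ⟨_, h1, h2⟩ => h1.trans h2.symm

/-- The set of labels that `f` uses. -/
def labels (f : I → Option X) : Set I := {i | Hit f f i i}

theorem Hit.left_mem {f h : I → Option X} {i j : I} : Hit f h i j → i ∈ labels f :=
  fun H => H.trans H.symm

theorem Hit.right_mem {f h : I → Option X} {i j : I} : Hit f h i j → j ∈ labels h :=
  fun H => H.symm.trans H

theorem hit_of_eq {f h : I → Option X} {i j : I} (hi : i ∈ labels f) (e : f i = h j) :
    Hit f h i j := by
  obtain ⟨x, h1, -⟩ := hi
  exact ⟨x, h1, e ▸ h1⟩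

/-- Different labels belong to different points. -/
def LabelInjective (f : I → Option X) : Prop := ∀ i j, Hit f f i j → i = j

end Labelled

/-! ### The `Δ`-system lemma in dimension one. -/

theorem mk_small_subsets_lt {I : Type u} {lam κ : Cardinal.{u}} (hlam : lam.IsRegular)
    (hunc : ℵ₀ < lam) (hκ : LTInaccessible κ lam) (hI : #I < lam) :
    #{S : Set I // #S < κ} < lam := by
  have h1 : {S : Set I | #S < κ} ⊆ ⋃ k : κ.ord.ToType, {S : Set I | #S ≤ #(Iio k)} := by
    intro S hS
    obtain ⟨k, hk⟩ := Ordinal.typein_surj (fun x y : κ.ord.ToType => x < y) (o := (#S).ord)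
      (by rw [Ordinal.type_toType]; exact ord_lt_ord.2 hS)
    refine mem_iUnion.2 ⟨k, ?_⟩
    have := congrArg Ordinal.card hk
    rw [card_ord] at this
    rw [mem_ofPred_eq, ← this]
    exact le_rfl
  refine (mk_le_mk_of_subset h1).trans_lt ?_
  rw [card_iUnion_lt_iff_forall_of_isRegular hlam (by rw [mk_ord_toType]; exact hκ.1)]
  intro k
  have h2 : #(Iio k) < κ := (mk_Iio_lt k (by simp)).trans_eq (mk_ord_toType κ)
  exact (mk_bounded_set_le I _).trans_lt
    ((le_powerlt _ h2).trans_lt (hκ.2 _ (max_lt hI hunc)))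

theorem not_bddAbove_card {W : Type u} {c : Cardinal.{u}} {A B : Set W} (hA : c ≤ #A) (hB : #B < c) :
    ∃ x ∈ A, x ∉ B := by
  by_contra! h
  exact (hA.trans (mk_le_mk_of_subset h)).not_gt hB

variable {W : Type u} {I : Type u} {C : Type u} {X : Type v}

/-- The function `f` will be the root. If no `f` works, each `f` has a small set `β f` such that
every `γ ∈ A` outside it that extends `f` meets it at a label outside the domain of `f`. Close off
under `f ↦ β f` in `κ` steps and take `γ` outside the closure. At each step `γ` extends its own
trace on the set built so far, so the next set is met at a fresh label. This gives `κ` distinct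
labels in `D`, although `#D < κ`; regularity of `κ` plays no role. -/
theorem exists_good_class {lam κ : Cardinal.{u}} (hlam : lam.IsRegular)
    (hκ : LTInaccessible κ lam) (hI : #I < lam) {A : Set W} (hA : lam ≤ #A)
    (u : W → I → Option X) {D : Set I} (hDκ : #D < κ) (hD : ∀ γ ∈ A, labels (u γ) = D) :
    ∃ f : I → Option X, ∀ B ⊆ A, #B < lam → ∃ γ ∈ A, γ ∉ B ∧ (∀ i x, f i = some x → u γ i = some x) ∧
      ∀ i, f i = none → ∀ β ∈ B, ∀ j, ¬ Hit (u γ) (u β) i j := by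
  classical
  by_contra! hbad
  choose β hβA hβc hβ using hbad
  -- `h` names points by a member of `B` and a label; `dec B h` is the partial function on `D` so
  -- described.
  let dec : (B : Set W) → (D → Option (B × I)) → I → Option X := fun B h i =>
    if hi : i ∈ D then (h ⟨i, hi⟩).elim none fun z => u z.1 z.2 else none
  let step : Set W → Set W := fun B => ⋃ h : D → Option (B × I), β (dec B h)
  have hstep : ∀ B : Set W, #B < lam → #(step B) < lam := by
    intro B hB
    have hsm : #(D → Option (B × I)) < lam := by
      rw [← power_def, mk_option, mk_prod, lift_id, lift_id]
      exact (le_powerlt _ hDκ).trans_lt (hκ.2 _ (add_lt_of_lt hlam.aleph0_le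
        (mul_lt_of_lt hlam.aleph0_le hB hI) (one_lt_aleph0.trans_le hlam.aleph0_le)))
    rw [card_iUnion_lt_iff_forall_of_isRegular hlam hsm]
    exact fun h => hβc _
  -- The closure process. Each stage stays below `lam` because inaccessibility leaves fewer than
  -- `lam` choices of `h` over a set of size `<lam`.
  let Bs : κ.ord.ToType → Set W := wellFounded_lt.fix (C := fun _ => Set W) fun ξ rec =>
    ⋃ η : Iio ξ, step (rec η.1 η.2)
  have hBs : ∀ ξ, Bs ξ = ⋃ η : Iio ξ, step (Bs η.1) := fun ξ => wellFounded_lt.fix_eq _ ξ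
  have hBc : ∀ ξ, #(Bs ξ) < lam := by
    intro ξ
    induction ξ using WellFoundedLT.induction with
    | _ ξ ih =>
      rw [hBs, card_iUnion_lt_iff_forall_of_isRegular hlam
        ((mk_set_le _).trans_lt ((mk_ord_toType κ).trans_lt hκ.1))]
      exact fun η => hstep _ (ih η.1 η.2)
  obtain ⟨γ, hγA, hγ⟩ := not_bddAbove_card (B := ⋃ ξ, step (Bs ξ)) hA (by
    rw [card_iUnion_lt_iff_forall_of_isRegular hlam ((mk_ord_toType κ).trans_lt hκ.1)]
    exact fun ξ => hstep _ (hBc ξ))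
  -- The label `i` of `γ` is not yet hit by stage `ξ` but is hit by every later stage, so labels for
  -- different `ξ` differ.
  have key : ∀ ξ, ∃ i ∈ D, (¬ ∃ b ∈ Bs ξ, ∃ j, Hit (u γ) (u b) i j) ∧
      ∀ η, ξ < η → ∃ b ∈ Bs η, ∃ j, Hit (u γ) (u b) i j := by
    intro ξ
    have hex : ∀ i : D, ∃ o : Option (Bs ξ × I),
        (∀ z, o = some z → Hit (u γ) (u z.1) i z.2) ∧
        ((∃ b ∈ Bs ξ, ∃ j, Hit (u γ) (u b) i j) → o ≠ none) := by
      intro i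
      by_cases hi : ∃ b ∈ Bs ξ, ∃ j, Hit (u γ) (u b) i j
      · obtain ⟨b, hb, j, hj⟩ := hi
        refine ⟨some (⟨b, hb⟩, j), ?_, by simp⟩
        rintro z hz
        obtain rfl := Option.some_inj.1 hz
        exact hj
      · exact ⟨none, by simp, fun h => absurd h hi⟩
    choose h h1 h2 using hex
    have hsub : β (dec (Bs ξ) h) ⊆ step (Bs ξ) := subset_iUnion (fun h => β (dec (Bs ξ) h)) h
    have hγβ : γ ∉ β (dec (Bs ξ) h) := fun hm => hγ (mem_iUnion.2 ⟨ξ, hsub hm⟩)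
    have hext : ∀ i x, dec (Bs ξ) h i = some x → u γ i = some x := by
      intro i x hx
      by_cases hi : i ∈ D
      · simp only [dec, hi, dite_true] at hx
        rcases ho : h ⟨i, hi⟩ with _ | z
        · simp [ho] at hx
        · rw [ho] at hx
          rw [(h1 _ z ho).eq]; exact hx
      · simp [dec, hi] at hx
    obtain ⟨i, hi, b, hb, j, hj⟩ := hβ (dec (Bs ξ) h) γ hγA hγβ hext
    have hiD : i ∈ D := by rw [← hD γ hγA]; exact hj.left_mem
    refine ⟨i, hiD, fun hcon => ?_, fun η hη => ⟨b, ?_, j, hj⟩⟩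
    · have := h2 ⟨i, hiD⟩ hcon
      simp only [dec, hiD, dite_true] at hi
      rcases ho : h ⟨i, hiD⟩ with _ | z
      · exact this ho
      · rw [ho] at hi
        obtain ⟨x, -, hx⟩ := h1 _ z ho
        simp [hx] at hi
    · rw [hBs]
      exact mem_iUnion.2 ⟨⟨ξ, hη⟩, hsub hb⟩
  choose i hiD hi1 hi2 using key
  have hinj : Function.Injective fun ξ => (⟨i ξ, hiD ξ⟩ : D) := by
    intro ξ η h
    have h : i ξ = i η := congrArg Subtype.val h
    rcases lt_trichotomy ξ η with hlt | heq | hlt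
    · exact absurd (h ▸ hi2 ξ η hlt) (hi1 η)
    · exact heq
    · exact absurd (h ▸ hi2 η ξ hlt) (hi1 ξ)
  have := mk_le_of_injective hinj
  rw [mk_ord_toType] at this
  exact this.not_gt hDκ

/-- A pigeonhole fixes colour and label set. The root is the `f` of `exists_good_class`, with domain
`S`, and a greedy choice keeps the other points off all earlier sets. -/
theorem exists_deltaSystem [LinearOrder W] [WellFoundedLT W] {lam κ : Cardinal.{u}}
    (hlam : lam.IsRegular) (hunc : ℵ₀ < lam)
    (hκ : LTInaccessible κ lam) (hI : #I < lam) (hC : #C < lam) {A : Set W} (hA : lam ≤ #A)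
    (u : W → I → Option X) (hu : ∀ γ, #(labels (u γ)) < κ) (hinj : ∀ γ, LabelInjective (u γ))
    (g : W → C) :
    ∃ H ⊆ A, lam ≤ #H ∧ ∃ D S : Set I, S ⊆ D ∧ (∃ c, ∀ γ ∈ H, g γ = c) ∧
      (∀ γ ∈ H, labels (u γ) = D) ∧ (∀ γ ∈ H, ∀ γ' ∈ H, ∀ i ∈ S, u γ i = u γ' i) ∧
      ∀ γ ∈ H, ∀ γ' ∈ H, γ ≠ γ' → ∀ i j, Hit (u γ) (u γ') i j → i = j ∧ i ∈ S := by
  obtain ⟨⟨c, ⟨D, hDκ⟩⟩, A', hA'A, hA', hcol⟩ := infinite_pigeonhole_set (s := A)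
    (α := C × {S : Set I // #S < κ}) (fun γ => (g γ, ⟨labels (u γ), hu γ⟩)) lam hA
    hlam.aleph0_le (by
      rw [hlam.cof_ord, mk_prod, lift_id, lift_id]
      exact mul_lt_of_lt hlam.aleph0_le hC (mk_small_subsets_lt hlam hunc hκ hI))
  have hg : ∀ γ ∈ A', g γ = c := fun γ hγ => congrArg Prod.fst (hcol hγ)
  have hD : ∀ γ ∈ A', labels (u γ) = D := fun γ hγ =>
    congrArg (fun z : C × {S : Set I // #S < κ} => z.2.1) (hcol hγ)
  obtain ⟨f, hf⟩ := exists_good_class hlam hκ hI hA' u hDκ hD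
  obtain ⟨H, hHA, hH, hok⟩ := exists_greedy_subset (c := lam)
    (A := {γ ∈ A' | ∀ i x, f i = some x → u γ i = some x})
    (fun p γ => ∀ i, f i = none → ∀ β ∈ p, ∀ j, ¬ Hit (u γ) (u β) i j) (by
      intro B hBA hB
      obtain ⟨γ, h1, h2, h3, h4⟩ := hf B (fun x hx => (hBA hx).1) hB
      exact ⟨γ, ⟨h1, h3⟩, h2, fun p hp i hi β hβ => h4 i hi β (hp hβ)⟩)
  refine ⟨H, fun γ hγ => hA'A (hHA hγ).1, hH, D, {i | ∃ x, f i = some x}, ?_,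
    ⟨c, fun γ hγ => hg γ (hHA hγ).1⟩, fun γ hγ => hD γ (hHA hγ).1, ?_, ?_⟩
  · rintro i ⟨x, hx⟩
    obtain ⟨γ, hγ, -⟩ := not_bddAbove_card (B := ∅) hH (by simpa using hlam.pos)
    rw [← hD γ (hHA hγ).1]
    have := (hHA hγ).2 i x hx
    exact ⟨x, this, this⟩
  · rintro γ hγ γ' hγ' i ⟨x, hx⟩
    rw [(hHA hγ).2 i x hx, (hHA hγ').2 i x hx]
  · have aux : ∀ γ ∈ H, ∀ γ' ∈ H, γ' < γ → ∀ i j, Hit (u γ) (u γ') i j →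
        i = j ∧ ∃ x, f i = some x := by
      intro γ hγ γ' hγ' hlt i j hij
      have hi : ∃ x, f i = some x := by
        rw [← Option.isSome_iff_exists, ← Option.ne_none_iff_isSome]
        intro hn
        exact hok γ hγ {γ'} (by simpa using hγ') (by simpa using hlt) i hn γ' (by simp) j hij
      refine ⟨?_, hi⟩
      obtain ⟨x, hx⟩ := hi
      -- The `i`-th points agree because `i` lies in the root, so `u γ'` has the same point at `i`
      -- and at `j`.
      refine hinj γ' i j (Hit.trans (g := u γ) ⟨x, (hHA hγ').2 i x hx, (hHA hγ).2 i x hx⟩ hij)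
    intro γ hγ γ' hγ' hne i j hij
    rcases lt_or_gt_of_ne hne with hlt | hlt
    · obtain ⟨rfl, h⟩ := aux γ' hγ' γ hγ hlt j i hij.symm
      exact ⟨rfl, h⟩
    · exact aux γ hγ γ' hγ' hlt i j hij

/-! ### Positions in finite sets -/

section Positions

variable {W : Type u} [LinearOrder W]

/-- The position of `x` in the finite set `b`. -/
def pos (b : Finset W) (x : W) : ℕ := (b.filter (· < x)).card

/-- `Aligned` for finite sets. -/
def FAligned (a b : Finset W) : Prop := a.card = b.card ∧ ∀ x ∈ a, x ∈ b → pos a x = pos b x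

/-- `commonPos` for finite sets. -/
def fcommonPos (a b : Finset W) : Finset ℕ := (a ∩ b).image (pos a)

theorem pos_insert_of_le {a : Finset W} {γ x : W} (h : x ≤ γ) : pos (insert γ a) x = pos a x := by
  rw [pos, Finset.filter_insert, if_neg h.not_gt, pos]

theorem pos_eq_card {a : Finset W} {γ : W} (h : ∀ x ∈ a, x < γ) : pos a γ = a.card := by
  rw [pos, Finset.filter_true_of_mem h]

theorem pos_lt_card {a : Finset W} {x : W} (h : x ∈ a) : pos a x < a.card :=
  Finset.card_lt_card (Finset.filter_ssubset.2 ⟨x, h, lt_irrefl x⟩)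

theorem pos_lt_pos {a : Finset W} {x y : W} (hx : x ∈ a) (h : x < y) : pos a x < pos a y := by
  refine Finset.card_lt_card (Finset.ssubset_iff_of_subset ?_ |>.2 ⟨x, ?_, ?_⟩)
  · intro z hz
    rw [Finset.mem_filter] at hz ⊢
    exact ⟨hz.1, hz.2.trans h⟩
  · simp [hx, h]
  · simp

theorem pos_injOn (a : Finset W) : Set.InjOn (pos a) a := by
  intro x hx y hy h
  rcases lt_trichotomy x y with hlt | heq | hlt
  · exact absurd h (pos_lt_pos hx hlt).ne
  · exact heq
  · exact absurd h (pos_lt_pos hy hlt).ne'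

theorem image_pos (a : Finset W) : a.image (pos a) = Finset.range a.card := by
  refine Finset.eq_of_subset_of_card_le ?_ ?_
  · intro k hk
    obtain ⟨x, hx, rfl⟩ := Finset.mem_image.1 hk
    exact Finset.mem_range.2 (pos_lt_card hx)
  · rw [Finset.card_image_of_injOn (pos_injOn a), Finset.card_range]

theorem fcommonPos_self (a : Finset W) : fcommonPos a a = Finset.range a.card := by
  rw [fcommonPos, Finset.inter_self, image_pos]

theorem FAligned.symm {a b : Finset W} (h : FAligned a b) : FAligned b a :=
  ⟨h.1.symm, fun x hb ha => (h.2 x ha hb).symm⟩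

theorem FAligned.refl (a : Finset W) : FAligned a a := ⟨rfl, fun _ _ _ => rfl⟩

theorem FAligned.fcommonPos_comm {a b : Finset W} (h : FAligned a b) :
    fcommonPos a b = fcommonPos b a := by
  rw [fcommonPos, fcommonPos, Finset.inter_comm b a]
  refine Finset.image_congr fun x hx => ?_
  simp only [Finset.coe_inter, mem_inter_iff, Finset.mem_coe] at hx
  exact h.2 x hx.1 hx.2

theorem exists_eq_insert_max {n : ℕ} {b : Finset W} (hb : b.card = n + 1) :
    ∃ γ ∈ b, ∃ a ⊆ b, b = insert γ a ∧ a.card = n ∧ ∀ x ∈ a, x < γ := by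
  have hne : b.Nonempty := Finset.card_pos.1 (by omega)
  refine ⟨b.max' hne, b.max'_mem hne, b.erase (b.max' hne), b.erase_subset _,
    (Finset.insert_erase (b.max'_mem hne)).symm, ?_, fun x hx => b.lt_max'_of_mem_erase_max' hne hx⟩
  rw [Finset.card_erase_of_mem (b.max'_mem hne), hb, Nat.add_sub_cancel]

theorem card_insert_above {a : Finset W} {γ : W} (h : ∀ x ∈ a, x < γ) :
    (insert γ a).card = a.card + 1 :=
  Finset.card_insert_of_notMem fun hm => lt_irrefl _ (h _ hm)

theorem FAligned.of_insert_same {a b : Finset W} {γ : W} (ha : ∀ x ∈ a, x < γ)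
    (hb : ∀ x ∈ b, x < γ) (h : FAligned (insert γ a) (insert γ b)) :
    FAligned a b ∧ fcommonPos (insert γ a) (insert γ b) = insert a.card (fcommonPos a b) := by
  refine ⟨⟨?_, fun x hxa hxb => ?_⟩, ?_⟩
  · have := h.1
    rwa [card_insert_above ha, card_insert_above hb, Nat.add_right_cancel_iff] at this
  · have := h.2 x (Finset.mem_insert_of_mem hxa) (Finset.mem_insert_of_mem hxb)
    rwa [pos_insert_of_le (ha x hxa).le, pos_insert_of_le (ha x hxa).le] at this
  · rw [fcommonPos, ← Finset.insert_inter_distrib, Finset.image_insert, pos_insert_of_le le_rfl,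
      pos_eq_card ha, fcommonPos]
    congr 1
    refine Finset.image_congr fun x hx => ?_
    simp only [Finset.coe_inter, mem_inter_iff, Finset.mem_coe] at hx
    exact pos_insert_of_le (ha x hx.1).le

/-- Were `γ` in `b`, it would be the last element of `insert γ a` but not the last one of `insert γ'
b`. -/
theorem notMem_of_pos_eq {a b : Finset W} {γ γ' : W} (hcard : a.card = b.card)
    (ha : ∀ x ∈ a, x < γ) (hb : ∀ x ∈ b, x < γ')
    (h : γ ∈ b → pos (insert γ a) γ = pos (insert γ' b) γ) : γ ∉ b := by
  intro hγ
  have := h hγ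
  rw [pos_insert_of_le le_rfl, pos_insert_of_le (hb γ hγ).le, pos_eq_card ha, hcard] at this
  exact (pos_lt_card hγ).ne' this

theorem FAligned.of_insert_lt {a b : Finset W} {γ γ' : W} (hγ : γ < γ') (ha : ∀ x ∈ a, x < γ)
    (hb : ∀ x ∈ b, x < γ') (h : FAligned (insert γ a) (insert γ' b)) :
    γ ∉ b ∧ FAligned a b ∧ fcommonPos (insert γ a) (insert γ' b) = fcommonPos a b := by
  have hcard : a.card = b.card := by
    have := h.1
    rwa [card_insert_above ha, card_insert_above hb, Nat.add_right_cancel_iff] at this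
  have hγb : γ ∉ b := notMem_of_pos_eq hcard ha hb fun hγb =>
    h.2 γ (Finset.mem_insert_self _ _) (Finset.mem_insert_of_mem hγb)
  refine ⟨hγb, ⟨hcard, fun x hxa hxb => ?_⟩, ?_⟩
  · have := h.2 x (Finset.mem_insert_of_mem hxa) (Finset.mem_insert_of_mem hxb)
    rwa [pos_insert_of_le (ha x hxa).le, pos_insert_of_le (hb x hxb).le] at this
  · have h1 : insert γ a ∩ insert γ' b = a ∩ b := by
      ext x
      simp only [Finset.mem_inter, Finset.mem_insert]
      constructor
      · rintro ⟨rfl | hx, rfl | hx'⟩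
        · exact absurd hγ (lt_irrefl _)
        · exact absurd hx' hγb
        · exact absurd (ha _ hx) hγ.not_gt
        · exact ⟨hx, hx'⟩
      · exact fun hx => ⟨Or.inr hx.1, Or.inr hx.2⟩
    rw [fcommonPos, h1, fcommonPos]
    refine Finset.image_congr fun x hx => ?_
    simp only [Finset.coe_inter, mem_inter_iff, Finset.mem_coe] at hx
    exact pos_insert_of_le (ha x hx.1).le

/-- `e` is an initial segment of `b`. -/
def IsInit (e b : Finset W) : Prop := e ⊆ b ∧ ∀ x ∈ b, x ∉ e → ∀ y ∈ e, y < x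

theorem IsInit.pos_eq {e b : Finset W} (h : IsInit e b) {x : W} (hx : x ∈ e) : pos b x = pos e x := by
  rw [pos, pos]
  congr 1
  ext y
  simp only [Finset.mem_filter]
  refine ⟨fun hy => ⟨?_, hy.2⟩, fun hy => ⟨h.1 hy.1, hy.2⟩⟩
  by_contra hn
  exact (h.2 y hy.1 hn x hx).not_gt hy.2

theorem IsInit.aligned {e b b' : Finset W} (h : IsInit e b) (h' : IsInit e b')
    (hcard : b.card = b'.card) (hbb' : b ∩ b' ⊆ e) :
    FAligned b b' ∧ fcommonPos b b' = Finset.range e.card := by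
  refine ⟨⟨hcard, fun x hx hx' => ?_⟩, ?_⟩
  · have hxe := hbb' (Finset.mem_inter.2 ⟨hx, hx'⟩)
    rw [h.pos_eq hxe, h'.pos_eq hxe]
  · rw [fcommonPos, Finset.Subset.antisymm hbb' (Finset.subset_inter h.1 h'.1), ← image_pos e]
    exact Finset.image_congr fun x hx => h.pos_eq hx

theorem isInit_union {e t : Finset W} (h : ∀ x ∈ e, ∀ y ∈ t, x < y) : IsInit e (e ∪ t) := by
  refine ⟨Finset.subset_union_left, fun x hx hxe y hy => h y hy x ?_⟩
  exact (Finset.mem_union.1 hx).resolve_left hxe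

theorem isInit_filter (b : Finset W) (γ : W) : IsInit (b.filter (· < γ)) b := by
  refine ⟨Finset.filter_subset _ _, fun x hx hxe y hy => ?_⟩
  rw [Finset.mem_filter] at hy
  exact hy.2.trans_le (not_lt.1 fun h => hxe (Finset.mem_filter.2 ⟨hx, h⟩))

theorem exists_finset_above {H : Set W} (hne : H.Nonempty) (hH : ∀ x ∈ H, ∃ y ∈ H, x < y)
    (F : Finset W) (hF : ↑F ⊆ H) (k : ℕ) :
    ∃ t : Finset W, ↑t ⊆ H ∧ t.card = k ∧ ∀ x ∈ F, ∀ y ∈ t, x < y := by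
  have key : ∀ F : Finset W, ↑F ⊆ H → ∃ y ∈ H, ∀ x ∈ F, x < y := by
    intro F hF
    rcases F.eq_empty_or_nonempty with rfl | hFne
    · exact ⟨hne.some, hne.some_mem, by simp⟩
    · obtain ⟨y, hy, hlt⟩ := hH _ (hF (F.max'_mem hFne))
      exact ⟨y, hy, fun x hx => (F.le_max' x hx).trans_lt hlt⟩
  induction k with
  | zero => exact ⟨∅, by simp, rfl, by simp⟩
  | succ k ih =>
    obtain ⟨t, ht, hk, hlt⟩ := ih
    obtain ⟨y, hy, hy'⟩ := key (F ∪ t) (by rw [Finset.coe_union]; exact union_subset hF ht)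
    refine ⟨insert y t, ?_, ?_, ?_⟩
    · rw [Finset.coe_insert]; exact insert_subset hy ht
    · rw [card_insert_above fun x hx => hy' x (Finset.mem_union_right _ hx), hk]
    · intro x hx z hz
      rcases Finset.mem_insert.1 hz with rfl | hz
      · exact hy' x (Finset.mem_union_left _ hx)
      · exact hlt x hx z hz

end Positions

/-! ### Properties of `sigma` -/

theorem sigma_isRegular {lam : Cardinal.{u}} (hlam : lam.IsRegular) (n : ℕ) :
    (sigma lam n).IsRegular ∧ lam ≤ sigma lam n := by
  induction n with
  | zero => exact ⟨hlam, le_rfl⟩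
  | succ n ih =>
    cases n with
    | zero => exact ⟨hlam, le_rfl⟩
    | succ n =>
      have h := le_two_powerlt (sigma lam (n + 1))
      exact ⟨isRegular_succ (ih.1.aleph0_le.trans h), (ih.2.trans h).trans (Order.le_succ _)⟩

theorem powerlt_sigma_lt {lam c : Cardinal.{u}} {n : ℕ} (hn : 1 ≤ n) (h : sigma lam (n + 1) ≤ c) :
    2 ^< sigma lam n < c := by
  obtain ⟨k, rfl⟩ : ∃ k, n = k + 1 := ⟨n - 1, by omega⟩
  exact (Order.lt_succ _).trans_le h

/-! ### End-homogeneous families -/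

section EndFamily

variable {W I C : Type u} {X : Type v} [LinearOrder W] [WellFoundedLT W]

/-- `u` and `g` are end-homogeneous on `B`, as witnessed by the top point `δ`; the points labelled by
`s a` in `u (a ∪ {δ})` are the old ones. -/
structure EndFamily (B : Set W) (δ : W) (u : Finset W → I → Option X) (g : Finset W → C)
    (s : Finset W → Set I) : Prop where
  lt : ∀ γ ∈ B, γ < δ
  color : ∀ γ ∈ B, ∀ a : Finset W, ↑a ⊆ B → (∀ x ∈ a, x < γ) → g (insert γ a) = g (insert δ a)
  hit : ∀ γ ∈ B, ∀ a b : Finset W, ↑a ⊆ B → ↑b ⊆ B → (∀ x ∈ a, x < γ) → (∀ x ∈ b, x < γ) →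
    ∀ i j, Hit (u (insert γ a)) (u (insert γ b)) i j ↔ Hit (u (insert δ a)) (u (insert δ b)) i j
  old : ∀ γ ∈ B, ∀ a : Finset W, ↑a ⊆ B → (∀ x ∈ a, x < γ) → ∀ i ∈ s a,
    Hit (u (insert γ a)) (u (insert δ a)) i i
  new : ∀ γ ∈ B, ∀ γ' ∈ B, γ ≠ γ' → ∀ a : Finset W, ↑a ⊆ B → (∀ x ∈ a, x < γ) →
    (∀ x ∈ a, x < γ') → ∀ i ∉ s a, ∀ j, ¬ Hit (u (insert γ a)) (u (insert γ' a)) i j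
  sub : ∀ a, s a ⊆ labels (u (insert δ a))

/-- A label is old for `a` when its point in `u (a ∪ {δ})` already occurs in some `u (a ∪ {γ})`.
End-homogeneity transfers such a coincidence to all later `γ`, so old points are eventually
constant, and a thinning makes them constant. The same transfer shows that a point shared by two `u
(a ∪ {γ})` is old. -/
theorem exists_endFamily {σ : Cardinal.{u}} (hσ : σ.IsRegular) (hI : #I < σ) (hC : #C < σ)
    {A : Set W} (hA : 2 ^< σ < #A) (u : Finset W → I → Option X)
    (hinj : ∀ b, LabelInjective (u b)) (g : Finset W → C) :
    ∃ δ ∈ A, ∃ B ⊆ A, σ ≤ #B ∧ ∃ s, EndFamily B δ u g s := by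
  classical
  -- Three kinds of record: coincidences between two sets with the same top, coincidences with a set
  -- not containing the top, and colours.
  let Q := ((I × I) ⊕ (I × I)) ⊕ C
  have hQ : #Q < σ := by
    have h := mul_lt_of_lt hσ.aleph0_le hI hI
    simp only [Q, mk_sum, mk_prod, lift_id]
    exact add_lt_of_lt hσ.aleph0_le (add_lt_of_lt hσ.aleph0_le h h) hC
  let F : Finset W → Finset W → W → Set Q := fun p p' γ => {q | match q with
    | Sum.inl (Sum.inl z) => Hit (u (insert γ p)) (u (insert γ p')) z.1 z.2
    | Sum.inl (Sum.inr z) => Hit (u (insert γ p)) (u p') z.1 z.2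
    | Sum.inr c => g (insert γ p) = c}
  obtain ⟨δ, hδ, B₀, hB₀A, hB₀, hF₀⟩ := exists_endHomogeneous hσ.aleph0_le hQ A hA F
  obtain ⟨B, hBB₀, hBc, hBi⟩ := exists_subset_small_initialSegments hB₀
  have hlt : ∀ γ ∈ B, γ < δ := fun γ hγ => (hF₀ γ (hBB₀ hγ)).1
  have hF : ∀ γ ∈ B, ∀ p p' : Finset W, ↑p ⊆ B → ↑p' ⊆ B →
      (∀ x ∈ p, x < γ) → (∀ x ∈ p', x < γ) → F p p' γ = F p p' δ := fun γ hγ p p' hp hp' =>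
    (hF₀ γ (hBB₀ hγ)).2 p p' (hp.trans hBB₀) (hp'.trans hBB₀)
  have hit : ∀ γ ∈ B, ∀ a b : Finset W, ↑a ⊆ B → ↑b ⊆ B → (∀ x ∈ a, x < γ) → (∀ x ∈ b, x < γ) →
      ∀ i j, Hit (u (insert γ a)) (u (insert γ b)) i j ↔
        Hit (u (insert δ a)) (u (insert δ b)) i j := by
    intro γ hγ a b ha hb haγ hbγ i j
    exact Set.ext_iff.1 (hF γ hγ a b ha hb haγ hbγ) (Sum.inl (Sum.inl (i, j)))
  have hit' : ∀ γ ∈ B, ∀ a b : Finset W, ↑a ⊆ B → ↑b ⊆ B → (∀ x ∈ a, x < γ) → (∀ x ∈ b, x < γ) →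
      ∀ i j, Hit (u (insert γ a)) (u b) i j ↔ Hit (u (insert δ a)) (u b) i j := by
    intro γ hγ a b ha hb haγ hbγ i j
    exact Set.ext_iff.1 (hF γ hγ a b ha hb haγ hbγ) (Sum.inl (Sum.inr (i, j)))
  have hcol : ∀ γ ∈ B, ∀ a : Finset W, ↑a ⊆ B → (∀ x ∈ a, x < γ) →
      g (insert γ a) = g (insert δ a) := by
    intro γ hγ a ha haγ
    exact (Set.ext_iff.1 (hF γ hγ a a ha ha haγ haγ) (Sum.inr (g (insert δ a)))).2 rfl
  let s : Finset W → Set I := fun a => {i | ∃ γ ∈ B, (∀ x ∈ a, x < γ) ∧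
    ∃ j, Hit (u (insert γ a)) (u (insert δ a)) j i}
  have hev : ∀ (a : Finset W) (i : I), ∃ γ₀, ↑a ⊆ B → i ∈ s a → γ₀ ∈ B ∧ ∀ γ ∈ B, γ₀ < γ →
      Hit (u (insert γ a)) (u (insert δ a)) i i := by
    intro a i
    by_cases h : ↑a ⊆ B ∧ i ∈ s a
    · obtain ⟨ha, γ₀, hγ₀, haγ₀, j, hj⟩ := h
      refine ⟨γ₀, fun _ _ => ⟨hγ₀, fun γ hγ hlt => ?_⟩⟩
      -- `insert γ₀ a` lies below `γ`, so the second kind of record moves the coincidence with it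
      -- from `δ` down to `γ`.
      refine Hit.trans (g := u (insert γ₀ a)) ((hit' γ hγ a (insert γ₀ a) ha ?_ ?_ ?_ i j).2 hj.symm) hj
      · rw [Finset.coe_insert]; exact insert_subset hγ₀ ha
      · exact fun x hx => (haγ₀ x hx).trans hlt
      · intro x hx
        rcases Finset.mem_insert.1 hx with rfl | hx
        · exact hlt
        · exact (haγ₀ x hx).trans hlt
    · exact ⟨δ, fun h1 h2 => absurd ⟨h1, h2⟩ h⟩
  choose γ₀ hγ₀ using hev
  obtain ⟨B', hB'B, hB', hok⟩ := exists_greedy_subset (c := σ) (A := B)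
    (fun p γ => ∀ i ∈ s p, Hit (u (insert γ p)) (u (insert δ p)) i i) (by
      intro D hDB hD
      obtain ⟨γ, hγ, hγn⟩ := not_bddAbove_card hBc.ge (B := D ∪
          ⋃ p : {p : Finset W | ↑p ⊆ D}, ⋃ i : s p, insert (γ₀ p i) (B ∩ Iio (γ₀ p i))) (by
        refine (mk_union_le _ _).trans_lt (add_lt_of_lt hσ.aleph0_le hD ?_)
        rw [card_iUnion_lt_iff_forall_of_isRegular hσ (mk_finset_subset_lt hσ.aleph0_le hD)]
        intro p
        rw [card_iUnion_lt_iff_forall_of_isRegular hσ ((mk_set_le _).trans_lt hI)]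
        intro i
        refine (mk_insert_le).trans_lt (add_lt_of_lt hσ.aleph0_le ?_
          (one_lt_aleph0.trans_le hσ.aleph0_le))
        exact hBi _ (hγ₀ p i (p.2.trans hDB) i.2).1)
      rw [mem_union, not_or] at hγn
      refine ⟨γ, hγ, hγn.1, fun p hp i hi => ?_⟩
      obtain ⟨h1, h2⟩ := hγ₀ p i (hp.trans hDB) hi
      refine h2 γ hγ (not_le.1 fun hle => hγn.2 ?_)
      refine mem_iUnion.2 ⟨⟨p, hp⟩, mem_iUnion.2 ⟨⟨i, hi⟩, ?_⟩⟩
      rcases hle.eq_or_lt with h | h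
      · exact Or.inl h
      · exact Or.inr ⟨hγ, h⟩)
  have hold : ∀ γ ∈ B', ∀ a : Finset W, ↑a ⊆ B' → (∀ x ∈ a, x < γ) → ∀ i ∈ s a,
      Hit (u (insert γ a)) (u (insert δ a)) i i := fun γ hγ a ha haγ => hok γ hγ a ha haγ
  have hnew : ∀ γ ∈ B', ∀ γ' ∈ B', γ' < γ → ∀ a : Finset W, ↑a ⊆ B' →
      (∀ x ∈ a, x < γ') → ∀ i ∉ s a, ∀ j, ¬ Hit (u (insert γ a)) (u (insert γ' a)) i j := by
    intro γ hγ γ' hγ' hlt a ha haγ' i hi j hij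
    refine hi ⟨γ', hB'B hγ', haγ', j, Hit.symm ?_⟩
    refine (hit' γ (hB'B hγ) a (insert γ' a) (ha.trans hB'B) ?_ (fun x hx => (haγ' x hx).trans hlt)
      ?_ i j).1 hij
    · rw [Finset.coe_insert]; exact (insert_subset hγ' ha).trans hB'B
    · intro x hx
      rcases Finset.mem_insert.1 hx with rfl | hx
      · exact hlt
      · exact (haγ' x hx).trans hlt
  refine ⟨δ, hδ, B', (hB'B.trans hBB₀).trans hB₀A, hB', s, fun γ hγ => hlt γ (hB'B hγ), ?_, ?_, hold,
    ?_, ?_⟩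
  · exact fun γ hγ a ha => hcol γ (hB'B hγ) a (ha.trans hB'B)
  · exact fun γ hγ a b ha hb => hit γ (hB'B hγ) a b (ha.trans hB'B) (hb.trans hB'B)
  · intro γ hγ γ' hγ' hne a ha haγ haγ' i hi j hij
    rcases lt_or_gt_of_ne hne with hlt | hlt
    -- The transfer concerns the label at the larger top, here `j`. If `j` were old, its point would
    -- be the `j`-th point of `u (insert γ a)` too, forcing `i = j`.
    · by_cases hj : j ∈ s a
      · have h1 := hold γ hγ a ha haγ j hj
        have h2 := hold γ' hγ' a ha haγ' j hj
        have := hinj _ _ _ ((hij.trans h2).trans h1.symm)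
        exact hi (this ▸ hj)
      · exact hnew γ' hγ' γ hγ hlt a ha haγ j hj i hij.symm
    · exact hnew γ hγ γ' hγ' hlt a ha haγ' i hi j hij
  · rintro a i ⟨γ, -, -, j, hj⟩
    exact hj.right_mem

end EndFamily
/-! ### Uniform families over finite sets -/

section Uniform

variable {W I : Type u} {X : Type v} [LinearOrder W]

/-- `r` witnesses that `⟨u b | b ∈ [H]^n⟩` is a uniform `n`-dimensional `Δ`-system. -/
structure UniformOn (n : ℕ) (H : Set W) (u : Finset W → I → Option X) (r : Finset ℕ → Set I) :
    Prop where
  inter : ∀ m m', r (m ∩ m') = r m ∩ r m'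
  hit : ∀ a b : Finset W, ↑a ⊆ H → ↑b ⊆ H → a.card = n → b.card = n → FAligned a b →
    ∀ i j, Hit (u a) (u b) i j ↔ i = j ∧ i ∈ r (fcommonPos a b)

/-- `α` may replace `x` in `a`. -/
def FPossible (a : Finset W) (x α : W) : Prop := ∀ y ∈ a, (y < x → y < α) ∧ (x < y → α < y)

/-- Finite-set version of `ReplacementInvariant`. -/
def FReplacementInvariant (n : ℕ) (H : Set W) (u : Finset W → I → Option X) : Prop :=
  ∀ a b : Finset W, ↑a ⊆ H → ↑b ⊆ H → a.card = n → b.card = n → ∀ x ∈ a, x ∈ b →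
    (∀ y ∈ a, y ∈ b → x ≤ y → pos a y = pos b y) → ∀ α ∈ H, FPossible a x α → FPossible b x α →
    ∀ i j, Hit (u a) (u b) i j ↔
      Hit (u (insert α (a.erase x))) (u (insert α (b.erase x))) i j

theorem UniformOn.mono {n : ℕ} {H H' : Set W} {u : Finset W → I → Option X} {r : Finset ℕ → Set I}
    (h : UniformOn n H u r) (hH : H' ⊆ H) : UniformOn n H' u r :=
  ⟨h.inter, fun a b ha hb => h.hit a b (ha.trans hH) (hb.trans hH)⟩

theorem FReplacementInvariant.mono {n : ℕ} {H H' : Set W} {u : Finset W → I → Option X}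
    (h : FReplacementInvariant n H u) (hH : H' ⊆ H) : FReplacementInvariant n H' u :=
  fun a b ha hb h1 h2 x hx hx' h3 α hα => h a b (ha.trans hH) (hb.trans hH) h1 h2 x hx hx' h3 α (hH hα)

variable {n : ℕ} {H : Set W} {w : Finset W → I → Option X} {r : Finset ℕ → Set I}

/-- With `t` far above `b ∪ b'`, the set `e ∪ t` is aligned with `b` and with `b'` and meets each of
them exactly in `e`. Both `i`-th points therefore equal that of `w (e ∪ t)`. -/
theorem UniformOn.root_hit (h : UniformOn n H w r) (hne : H.Nonempty)
    (hH : ∀ x ∈ H, ∃ y ∈ H, x < y) {e b b' : Finset W} (hb : ↑b ⊆ H) (hb' : ↑b' ⊆ H)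
    (hbn : b.card = n) (hbn' : b'.card = n) (he : IsInit e b) (he' : IsInit e b') {i : I}
    (hi : i ∈ r (Finset.range e.card)) : Hit (w b) (w b') i i := by
  obtain ⟨t, htH, htc, ht⟩ := exists_finset_above hne hH (b ∪ b')
    (by rw [Finset.coe_union]; exact union_subset hb hb') (n - e.card)
  have het : ∀ x ∈ e, ∀ y ∈ t, x < y := fun x hx => ht x (Finset.mem_union_left _ (he.1 hx))
  have hdisj : Disjoint e t := Finset.disjoint_left.2 fun x hx hx' => lt_irrefl _ (het x hx x hx')
  have hcard : (e ∪ t).card = n := by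
    rw [Finset.card_union_of_disjoint hdisj, htc]
    have := Finset.card_le_card he.1
    omega
  have hetH : ↑(e ∪ t) ⊆ H := by
    rw [Finset.coe_union]
    exact union_subset ((Finset.coe_subset.2 he.1).trans hb) htH
  have hsub : ∀ c ⊆ b ∪ b', c ∩ (e ∪ t) ⊆ e := by
    intro c hc x hx
    rw [Finset.mem_inter, Finset.mem_union] at hx
    exact hx.2.resolve_right fun hxt => lt_irrefl _ (ht x (hc hx.1) x hxt)
  have h1 := he.aligned (isInit_union het) (hbn.trans hcard.symm) (hsub b Finset.subset_union_left)
  have h2 := he'.aligned (isInit_union het) (hbn'.trans hcard.symm)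
    (hsub b' Finset.subset_union_right)
  have g1 := (h.hit b _ hb hetH hbn hcard h1.1 i i).2 ⟨rfl, by rwa [h1.2]⟩
  have g2 := (h.hit b' _ hb' hetH hbn' hcard h2.1 i i).2 ⟨rfl, by rwa [h2.2]⟩
  exact g1.trans g2.symm

/-- By `root_hit` the tails of `b` above `β` and of `b'` above `β'` may be replaced by disjoint
tails far above without moving the two points. The new sets are aligned and meet exactly in `e`. -/
theorem UniformOn.root_disjoint (h : UniformOn n H w r) (hne : H.Nonempty)
    (hH : ∀ x ∈ H, ∃ y ∈ H, x < y) {e b b' : Finset W} {β β' : W} (hβ : β ≠ β') (hb : ↑b ⊆ H)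
    (hb' : ↑b' ⊆ H) (hbn : b.card = n) (hbn' : b'.card = n)
    (heβ : ∀ x ∈ e, x < β) (heβ' : ∀ x ∈ e, x < β')
    (he : IsInit (insert β e) b) (he' : IsInit (insert β' e) b') {i j : I}
    (hi : i ∈ r (Finset.range (e.card + 1))) (hj : j ∈ r (Finset.range (e.card + 1)))
    (hij : Hit (w b) (w b') i j) : i = j ∧ i ∈ r (Finset.range e.card) := by
  have hsub : insert β e ⊆ b ∪ b' := he.1.trans Finset.subset_union_left
  have hsub' : insert β' e ⊆ b ∪ b' := he'.1.trans Finset.subset_union_right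
  have hbb : ↑(b ∪ b') ⊆ H := by rw [Finset.coe_union]; exact union_subset hb hb'
  obtain ⟨t, htH, htc, ht⟩ := exists_finset_above hne hH (b ∪ b') hbb (n - (e.card + 1))
  obtain ⟨t', htH', htc', ht'⟩ := exists_finset_above hne hH (b ∪ b' ∪ t)
    (by rw [Finset.coe_union]; exact union_subset hbb htH) (n - (e.card + 1))
  have ext : ∀ (β : W) (b t : Finset W), ↑b ⊆ H → b.card = n → (∀ x ∈ e, x < β) → ↑t ⊆ H →
      IsInit (insert β e) b → (∀ x ∈ insert β e, ∀ y ∈ t, x < y) → t.card = n - (e.card + 1) →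
      ↑(insert β e ∪ t) ⊆ H ∧ (insert β e ∪ t).card = n ∧ IsInit (insert β e) (insert β e ∪ t) ∧
      IsInit e (insert β e ∪ t) := by
    intro β b t hb hbn heβ htH he ht htc
    have hdisj : Disjoint (insert β e) t :=
      Finset.disjoint_left.2 fun x hx hx' => lt_irrefl _ (ht x hx x hx')
    refine ⟨?_, ?_, isInit_union ht, ?_⟩
    · rw [Finset.coe_union]
      exact union_subset ((Finset.coe_subset.2 he.1).trans hb) htH
    · have := Finset.card_le_card he.1
      rw [card_insert_above heβ] at this
      rw [Finset.card_union_of_disjoint hdisj, htc, card_insert_above heβ]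
      omega
    · have : insert β e ∪ t = e ∪ insert β t := by
        ext x; simp only [Finset.mem_union, Finset.mem_insert]; tauto
      rw [this]
      refine isInit_union fun x hx y hy => ?_
      rcases Finset.mem_insert.1 hy with rfl | hy
      · exact heβ x hx
      · exact ht x (Finset.mem_insert_of_mem hx) y hy
  obtain ⟨k1, k2, k3, k4⟩ := ext β b t hb hbn heβ htH he (fun x hx => ht x (hsub hx)) htc
  obtain ⟨l1, l2, l3, l4⟩ := ext β' b' t' hb' hbn' heβ' htH' he'
    (fun x hx => ht' x (Finset.mem_union_left _ (hsub' hx))) htc'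
  have g1 := h.root_hit hne hH hb k1 hbn k2 he k3 (i := i) (by rwa [card_insert_above heβ])
  have g2 := h.root_hit hne hH hb' l1 hbn' l2 he' l3 (i := j) (by rwa [card_insert_above heβ'])
  have hal := k4.aligned l4 (k2.trans l2.symm) (by
    intro x hx
    simp only [Finset.mem_inter, Finset.mem_union, Finset.mem_insert] at hx
    by_contra hxe
    rcases hx with ⟨(rfl | hx1) | hx1, (rfl | hx2) | hx2⟩
    · exact hβ rfl
    · exact hxe hx2
    · exact lt_irrefl _ (ht' x (Finset.mem_union_left _ (hsub (Finset.mem_insert_self _ _))) x hx2)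
    · exact hxe hx1
    · exact hxe hx1
    · exact hxe hx1
    · exact lt_irrefl _ (ht x (hsub' (Finset.mem_insert_self _ _)) x hx1)
    · exact hxe hx2
    · exact lt_irrefl _ (ht' x (Finset.mem_union_right _ hx1) x hx2))
  have := (h.hit _ _ k1 l1 k2 l2 hal.1 i j).1 ((g1.symm.trans hij).trans g2)
  rwa [hal.2] at this

end Uniform

/-! ### Thinning out until only forced coincidences remain. -/

section Step

variable {W I C : Type u} {X : Type v} [LinearOrder W] [WellFoundedLT W]

/-- The points of `H₀` that make some later root meet `u c`. -/
def badRoot (n : ℕ) (H₀ : Set W) (w u : Finset W → I → Option X) (r : Finset ℕ → Set I)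
    (c e : Finset W) : Set W :=
  {β ∈ H₀ | (∀ x ∈ e, x < β) ∧ ∃ b : Finset W, ↑b ⊆ H₀ ∧ b.card = n ∧ IsInit (insert β e) b ∧
    ∃ i j, i ∈ r (Finset.range (e.card + 1)) ∧ i ∉ r (Finset.range e.card) ∧ Hit (w b) (u c) i j}

/-- The points `γ` of `H₀` such that a new point of `u (a ∪ {γ})` lies in `h`. -/
def badTop (H₀ : Set W) (u : Finset W → I → Option X) (S : Set I) (h : I → Option X)
    (a : Finset W) : Set W :=
  {γ ∈ H₀ | (∀ x ∈ a, x < γ) ∧ ∃ i ∉ S, ∃ j, Hit (u (insert γ a)) h i j}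

-- For different `β` the parts of the roots beyond the root of `e` are disjoint, so sending `β` to
-- the label of the point of `u c` that is met is injective.
omit [WellFoundedLT W] in
theorem mk_badRoot_le {n : ℕ} {H₀ : Set W} {w u : Finset W → I → Option X} {r : Finset ℕ → Set I}
    (h : UniformOn n H₀ w r) (hH : ∀ x ∈ H₀, ∃ y ∈ H₀, x < y) (c e : Finset W) :
    #(badRoot n H₀ w u r c e) ≤ #I := by
  choose b hb using fun β : badRoot n H₀ w u r c e => β.2.2.2
  choose hbH hbn hbe i j hi hi' hij using hb
  refine mk_le_of_injective (f := j) fun β β' hj => ?_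
  by_contra hne
  refine hi' β (h.root_disjoint ⟨β, β.2.1⟩ hH (fun h => hne (Subtype.ext h)) (hbH β) (hbH β') (hbn β)
    (hbn β') β.2.2.1 β'.2.2.1 (hbe β) (hbe β') (hi β) (hi β') ?_).2
  exact (hij β).trans (hj ▸ (hij β').symm)

-- New points for different tops over the same `a` are disjoint, so the label met in `h` determines
-- the top.
omit [WellFoundedLT W] in
theorem mk_badTop_le {B H₀ : Set W} {δ : W} {u : Finset W → I → Option X} {g : Finset W → C}
    {s : Finset W → Set I} (hE : EndFamily B δ u g s) (hB : H₀ ⊆ B) {S : Set I} {h : I → Option X}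
    {a : Finset W} (ha : ↑a ⊆ H₀) (hs : s a = S) : #(badTop H₀ u S h a) ≤ #I := by
  choose i hiS j hij using fun β : badTop H₀ u S h a => β.2.2.2
  refine mk_le_of_injective (f := j) fun β β' hj => ?_
  by_contra hne
  refine hE.new β (hB β.2.1) β' (hB β'.2.1) (fun h => hne (Subtype.ext h)) a (ha.trans hB) β.2.2.1
    β'.2.2.1 (i β) (hs ▸ hiS β) (i β') ?_
  exact (hij β).trans (hj ▸ (hij β').symm)

/-- Each bad set has size at most `#I < lam`, so a greedy choice avoids all those given by earlier
points. Let the `i`-th point of `u (insert γ a)` be the `j`-th of `u (insert γ' b)`. Then `j` is old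
because `γ'` is not a bad top, and the point lies in `w b`. No element of `b` above `γ` gives a bad
root, so the point already belongs to the root of `b` below `γ`. That root was available when `γ`
was chosen, so `i` is old too. -/
theorem exists_avoiding_subset {lam : Cardinal.{u}} (hlam : lam.IsRegular) (hI : #I < lam) {n : ℕ}
    {B H₀ : Set W} {δ : W} {u : Finset W → I → Option X} {g : Finset W → C}
    {s : Finset W → Set I} (hE : EndFamily B δ u g s) (hB : H₀ ⊆ B) (hH₀ : lam ≤ #H₀)
    (hH : ∀ x ∈ H₀, ∃ y ∈ H₀, x < y) {S : Set I}
    (hS : ∀ a : Finset W, ↑a ⊆ H₀ → a.card = n → s a = S) {r : Finset ℕ → Set I}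
    (hr : UniformOn n H₀ (fun a => u (insert δ a)) r) :
    ∃ H ⊆ H₀, lam ≤ #H ∧ ∀ a b : Finset W, ↑a ⊆ H → ↑b ⊆ H → a.card = n → b.card = n →
      ∀ γ ∈ H, ∀ γ' ∈ H, γ < γ' → (∀ x ∈ a, x < γ) → (∀ x ∈ b, x < γ') → γ ∉ b → ∀ i j,
        (Hit (u (insert γ a)) (u (insert γ' b)) i j ↔
          i ∈ S ∧ j ∈ S ∧ Hit (u (insert δ a)) (u (insert δ b)) i j) := by
  classical
  have hne : H₀.Nonempty := by
    obtain ⟨x, hx, -⟩ := not_bddAbove_card (B := ∅) hH₀ (by simpa using hlam.pos)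
    exact ⟨x, hx⟩
  -- The representative `ρ e` depends on `e` alone, so the root of `e` can be avoided before the
  -- rest of `b` is known.
  have hrep : ∀ e : Finset W, ∃ b : Finset W, (∃ b : Finset W, ↑b ⊆ H₀ ∧ b.card = n ∧ IsInit e b) →
      ↑b ⊆ H₀ ∧ b.card = n ∧ IsInit e b := by
    intro e
    by_cases h : ∃ b : Finset W, ↑b ⊆ H₀ ∧ b.card = n ∧ IsInit e b
    · exact ⟨h.choose, fun _ => h.choose_spec⟩
    · exact ⟨∅, fun h' => absurd h' h⟩
  choose ρ hρ using hrep
  obtain ⟨H, hHH₀, hHc, hok⟩ := exists_greedy_subset (c := lam) (A := H₀)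
    (fun p γ => ∀ a ⊆ p, ∀ c ⊆ p, γ ∉ badRoot n H₀ (fun a => u (insert δ a)) u r c a ∧
      (a.card = n → γ ∉ badTop H₀ u S (u c) a ∧
        γ ∉ badTop H₀ u S (u (insert δ (ρ c))) a)) (by
      intro D hDH hD
      let P := {p : Finset W | ↑p ⊆ D}
      have hP : #P < lam := mk_finset_subset_lt hlam.aleph0_le hD
      let bad : P → P → Set W := fun a c => badRoot n H₀ (fun a => u (insert δ a)) u r c a ∪
        ({γ | a.1.card = n ∧ γ ∈ badTop H₀ u S (u c) a} ∪
          {γ | a.1.card = n ∧ γ ∈ badTop H₀ u S (u (insert δ (ρ c))) a})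
      have hbad : ∀ a c, #(bad a c) < lam := by
        intro a c
        have aux : ∀ h, #{γ | a.1.card = n ∧ γ ∈ badTop H₀ u S h a} < lam := by
          intro h
          by_cases ha : a.1.card = n
          · refine (mk_le_mk_of_subset fun γ hγ => hγ.2).trans_lt
              ((mk_badTop_le (h := h) hE hB (a.2.trans hDH)
                (hS a (a.2.trans hDH) ha)).trans_lt hI)
          · simp only [ha, false_and]
            simpa using hlam.pos
        refine (mk_union_le _ _).trans_lt (add_lt_of_lt hlam.aleph0_le
          ((mk_badRoot_le hr hH c a).trans_lt hI) ?_)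
        exact (mk_union_le _ _).trans_lt (add_lt_of_lt hlam.aleph0_le (aux _) (aux _))
      obtain ⟨γ, hγ, hγn⟩ := not_bddAbove_card hH₀ (B := D ∪ ⋃ a, ⋃ c, bad a c) (by
        refine (mk_union_le _ _).trans_lt (add_lt_of_lt hlam.aleph0_le hD ?_)
        rw [card_iUnion_lt_iff_forall_of_isRegular hlam hP]
        intro a
        rw [card_iUnion_lt_iff_forall_of_isRegular hlam hP]
        exact hbad a)
      rw [mem_union, not_or] at hγn
      refine ⟨γ, hγ, hγn.1, fun p hp a ha c hc => ?_⟩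
      have hn : γ ∉ bad ⟨a, (Finset.coe_subset.2 ha).trans hp⟩ ⟨c, (Finset.coe_subset.2 hc).trans hp⟩ :=
        fun h => hγn.2 (mem_iUnion.2 ⟨_, mem_iUnion.2 ⟨_, h⟩⟩)
      simp only [bad, mem_union, not_or] at hn
      exact ⟨hn.1, fun hcard => ⟨fun h => hn.2.1 ⟨hcard, h⟩, fun h => hn.2.2 ⟨hcard, h⟩⟩⟩)
  refine ⟨H, hHH₀, hHc, ?_⟩
  intro a b ha hb han hbn γ hγ γ' hγ' hlt haγ hbγ' hγb i j
  have hHB := hHH₀.trans hB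
  have hsa := hS a (ha.trans hHH₀) han
  have hsb := hS b (hb.trans hHH₀) hbn
  have olda : ∀ i ∈ S, Hit (u (insert γ a)) (u (insert δ a)) i i := fun i hi =>
    hE.old γ (hHB hγ) a (ha.trans hHB) haγ i (hsa ▸ hi)
  have oldb : ∀ i ∈ S, Hit (u (insert γ' b)) (u (insert δ b)) i i := fun i hi =>
    hE.old γ' (hHB hγ') b (hb.trans hHB) hbγ' i (hsb ▸ hi)
  constructor
  swap
  · rintro ⟨hi, hj, hij⟩
    exact ((olda i hi).trans hij).trans (oldb j hj).symm
  intro hij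
  have haγH : ↑(insert γ a) ⊆ H := by rw [Finset.coe_insert]; exact insert_subset hγ ha
  have haγγ : ∀ x ∈ insert γ a, x ≤ γ := by
    intro x hx
    rcases Finset.mem_insert.1 hx with rfl | hx
    · exact le_rfl
    · exact (haγ x hx).le
  have hj : j ∈ S := by
    by_contra hj
    refine ((hok γ' hγ' (b ∪ insert γ a) ?_ ?_ b Finset.subset_union_left (insert γ a)
      Finset.subset_union_right).2 hbn).1 ⟨hHH₀ hγ', hbγ', j, hj, i, hij.symm⟩
    · rw [Finset.coe_union]; exact union_subset hb haγH
    · intro x hx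
      rcases Finset.mem_union.1 hx with hx | hx
      · exact hbγ' x hx
      · exact (haγγ x hx).trans_lt hlt
  have hijw : Hit (u (insert γ a)) (u (insert δ b)) i j := hij.trans (oldb j hj)
  -- Peel off the elements of `b` above `γ` from the top: if the point left the root on removing
  -- `β`, then `β` would be a bad root for `insert γ a`, which lies below `β`.
  have hdesc : ∀ e : Finset W, IsInit e b → b.filter (· < γ) ⊆ e → j ∈ r (Finset.range e.card) →
      j ∈ r (Finset.range (b.filter (· < γ)).card) := by
    intro e
    induction e using Finset.strongInduction with
    | H e ih =>
    intro he hsub hje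
    by_cases heq : e = b.filter (· < γ)
    · rwa [← heq]
    have hne' : ∃ x ∈ e, x ∉ b.filter (· < γ) := by
      by_contra! h
      exact heq (Finset.Subset.antisymm h hsub)
    have hene : e.Nonempty := ⟨_, hne'.choose_spec.1⟩
    obtain ⟨β, hβe, e', he'e, rfl, hcard, he'β⟩ := exists_eq_insert_max
      (n := e.card - 1) (b := e) (by have := Finset.card_pos.2 hene; omega)
    have hβγ : γ < β := by
      obtain ⟨x, hx, hxn⟩ := hne'
      have hxb := he.1 hx
      have hxγ : γ ≤ x := not_lt.1 fun h => hxn (Finset.mem_filter.2 ⟨hxb, h⟩)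
      have hxβ : x ≤ β := by
        rcases Finset.mem_insert.1 hx with rfl | hx
        · exact le_rfl
        · exact (he'β x hx).le
      exact lt_of_le_of_ne (hxγ.trans hxβ) fun h => hγb (h ▸ he.1 hβe)
    have hβe' : β ∉ e' := fun h => lt_irrefl _ (he'β β h)
    have hinit : IsInit e' b := by
      refine ⟨he'e.trans he.1, fun x hx hxe y hy => ?_⟩
      by_cases hxβ : x = β
      · exact hxβ ▸ he'β y hy
      · exact he.2 x hx (by simp [hxβ, hxe]) y (Finset.mem_insert_of_mem hy)
    have hsub' : b.filter (· < γ) ⊆ e' := by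
      intro x hx
      have hxγ := (Finset.mem_filter.1 hx).2
      exact (Finset.mem_insert.1 (hsub hx)).resolve_left (hxγ.trans hβγ).ne
    refine ih e' (Finset.ssubset_insert hβe') hinit hsub' ?_
    by_contra hjn
    have hβH : β ∈ H := hb (he.1 hβe)
    refine (hok β hβH (e' ∪ insert γ a) ?_ ?_ e' Finset.subset_union_left (insert γ a)
      Finset.subset_union_right).1 ⟨hHH₀ hβH, he'β, b, hb.trans hHH₀, hbn, he, j, i, ?_, hjn,
        hijw.symm⟩
    · rw [Finset.coe_union]
      exact union_subset ((Finset.coe_subset.2 hinit.1).trans hb) haγH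
    · intro x hx
      rcases Finset.mem_union.1 hx with hx | hx
      · exact he'β x hx
      · exact (haγγ x hx).trans_lt hβγ
    · rwa [card_insert_above he'β] at hje
  have hjr : j ∈ r (Finset.range b.card) := by
    have := (hr.hit b b (hb.trans hHH₀) (hb.trans hHH₀) hbn hbn (FAligned.refl b) j j).1
      hijw.right_mem
    rw [fcommonPos_self] at this
    exact this.2
  have hjk := hdesc b ⟨Finset.Subset.refl b, fun x hx hn => absurd hx hn⟩ (Finset.filter_subset _ _)
    hjr
  -- The point lies in `w (ρ (b ∩ γ))`, so a new `i` would make `γ` a bad top.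
  have hi : i ∈ S := by
    by_contra hi
    have hinit := isInit_filter b γ
    obtain ⟨h1, h2, h3⟩ := hρ (b.filter (· < γ)) ⟨b, hb.trans hHH₀, hbn, hinit⟩
    have hroot := hr.root_hit hne hH (hb.trans hHH₀) h1 hbn h2 hinit h3 hjk
    refine ((hok γ hγ (a ∪ b.filter (· < γ)) ?_ ?_ a Finset.subset_union_left (b.filter (· < γ))
      Finset.subset_union_right).2 han).2 ⟨hHH₀ hγ, haγ, i, hi, j, hijw.trans hroot⟩
    · rw [Finset.coe_union]
      exact union_subset ha ((Finset.coe_subset.2 (Finset.filter_subset _ _)).trans hb)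
    · intro x hx
      rcases Finset.mem_union.1 hx with hx | hx
      · exact haγ x hx
      · exact (Finset.mem_filter.1 hx).2
  exact ⟨hi, hj, (olda i hi).symm.trans hijw⟩

end Step
-- Uniformization in all finite dimensions.
section Main

variable {W I : Type u} {X : Type v} [LinearOrder W] [WellFoundedLT W]

theorem exists_subset_unbounded {lam : Cardinal.{u}} (hlam : lam.IsRegular) {A : Set W}
    (hA : lam ≤ #A) : ∃ H ⊆ A, #H = lam ∧ ∀ x ∈ H, ∃ y ∈ H, x < y := by
  obtain ⟨H, hHA, hH, hi⟩ := exists_subset_small_initialSegments hA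
  refine ⟨H, hHA, hH, fun x hx => ?_⟩
  obtain ⟨y, hy, hyn⟩ := not_bddAbove_card hH.ge (B := insert x (H ∩ Iio x))
    (mk_insert_le.trans_lt (add_lt_of_lt hlam.aleph0_le (hi x hx)
      (one_lt_aleph0.trans_le hlam.aleph0_le)))
  rw [mem_insert_iff, not_or] at hyn
  exact ⟨y, hy, lt_of_le_of_ne (not_lt.1 fun h => hyn.2 ⟨hy, h⟩) (Ne.symm hyn.1)⟩

theorem uniformization_one {lam κ : Cardinal.{u}} (hlam : lam.IsRegular) (hunc : ℵ₀ < lam)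
    (hκ : LTInaccessible κ lam) (hI : #I < lam) {C : Type u} (hC : #C < lam) {A : Set W}
    (hA : lam ≤ #A) (u : Finset W → I → Option X) (hu : ∀ b, #(labels (u b)) < κ)
    (hinj : ∀ b, LabelInjective (u b)) (g : Finset W → C) :
    ∃ H ⊆ A, #H = lam ∧ (∃ c, ∀ b : Finset W, ↑b ⊆ H → b.card = 1 → g b = c) ∧
      (∃ r, UniformOn 1 H u r) ∧ FReplacementInvariant 1 H u := by
  obtain ⟨H₀, hH₀A, hH₀, D, S, hSD, ⟨c, hc⟩, hD, hS, hnew⟩ := exists_deltaSystem hlam hunc hκ hI hC hA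
    (fun γ => u {γ}) (fun γ => hu _) (fun γ => hinj _) (fun γ => g {γ})
  obtain ⟨H, hHH, hH, -⟩ := exists_subset_unbounded hlam hH₀
  have hsing : ∀ {b : Finset W}, ↑b ⊆ H → b.card = 1 → ∃ γ ∈ H₀, b = {γ} := by
    intro b hb h1
    obtain ⟨γ, rfl⟩ := Finset.card_eq_one.1 h1
    exact ⟨γ, hHH (hb (by simp)), rfl⟩
  have hself : ∀ γ ∈ H₀, ∀ i j, Hit (u {γ}) (u {γ}) i j ↔ i = j ∧ i ∈ D := by
    intro γ hγ i j
    refine ⟨fun h => ⟨hinj _ _ _ h, hD γ hγ ▸ h.left_mem⟩, ?_⟩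
    rintro ⟨rfl, hi⟩
    rwa [← hD γ hγ] at hi
  refine ⟨H, hHH.trans hH₀A, hH, ⟨c, fun b hb h1 => ?_⟩,
    -- `0 ∈ m` means that the two singletons are equal and share all of `D`; otherwise only the root
    -- `S` is shared.
    ⟨fun m => {i | i ∈ D ∧ (0 ∉ m → i ∈ S)}, ⟨?_, ?_⟩⟩, ?_⟩
  · obtain ⟨γ, hγ, rfl⟩ := hsing hb h1
    exact hc γ hγ
  · intro m m'
    ext i
    simp only [Finset.mem_inter, mem_ofPred_eq, mem_inter_iff]
    tauto
  · intro a b ha hb ha1 hb1 hal i j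
    obtain ⟨γ, hγ, rfl⟩ := hsing ha ha1
    obtain ⟨γ', hγ', rfl⟩ := hsing hb hb1
    by_cases h : γ = γ'
    · subst h
      rw [hself γ hγ, fcommonPos_self]
      simp
    · have he : fcommonPos {γ} {γ'} = ∅ := by
        simp [fcommonPos, h]
      rw [he]
      constructor
      · intro hij
        obtain ⟨h1, h2⟩ := hnew γ hγ γ' hγ' h i j hij
        exact ⟨h1, hSD h2, fun _ => h2⟩
      · rintro ⟨rfl, h1, h2⟩
        exact hit_of_eq (by rw [hD γ hγ]; exact h1) (hS γ hγ γ' hγ' i (h2 (by simp)))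
  · intro a b ha hb ha1 hb1 x hxa hxb _ α hα _ _ i j
    obtain ⟨γ, hγ, rfl⟩ := hsing ha ha1
    obtain ⟨γ', hγ', rfl⟩ := hsing hb hb1
    rw [Finset.mem_singleton] at hxa hxb
    subst hxa hxb
    simp only [Finset.erase_singleton, insert_empty_eq]
    rw [hself x hγ, hself α (hHH hα)]

/-- The intersection pattern of an `(n+1)`-dimensional family `u` over `H` in terms of the
`n`-dimensional family `w`: new points are labelled by the complement of `S`. -/
structure TopPattern (n : ℕ) (H : Set W) (u w : Finset W → I → Option X) (S : Set I) : Prop where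
  same : ∀ γ ∈ H, ∀ a b : Finset W, ↑a ⊆ H → ↑b ⊆ H → (∀ x ∈ a, x < γ) → (∀ x ∈ b, x < γ) →
    ∀ i j, Hit (u (insert γ a)) (u (insert γ b)) i j ↔ Hit (w a) (w b) i j
  lt : ∀ a b : Finset W, ↑a ⊆ H → ↑b ⊆ H → a.card = n → b.card = n →
    ∀ γ ∈ H, ∀ γ' ∈ H, γ < γ' → (∀ x ∈ a, x < γ) → (∀ x ∈ b, x < γ') → γ ∉ b → ∀ i j,
      (Hit (u (insert γ a)) (u (insert γ' b)) i j ↔ i ∈ S ∧ j ∈ S ∧ Hit (w a) (w b) i j)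

omit [WellFoundedLT W] in
theorem exists_split {n : ℕ} {H : Set W} {b : Finset W} (hb : ↑b ⊆ H) (hbn : b.card = n + 1) :
    ∃ γ ∈ H, ∃ a : Finset W, ↑a ⊆ H ∧ b = insert γ a ∧ a.card = n ∧ ∀ x ∈ a, x < γ := by
  obtain ⟨γ, hγ, a, hab, h1, h2, h3⟩ := exists_eq_insert_max hbn
  exact ⟨γ, hb hγ, a, (Finset.coe_subset.2 hab).trans hb, h1, h2, h3⟩

-- Whether position `n` lies in `m` tells whether the tops agree. If they do, the pattern is that of
-- `w`; if not, alignment keeps the smaller top out of the other set, and the pattern of `w` is cut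
-- down to `S`.
omit [WellFoundedLT W] in
theorem TopPattern.uniformOn {n : ℕ} {H : Set W} {u w : Finset W → I → Option X} {S : Set I}
    (hT : TopPattern n H u w S) {r : Finset ℕ → Set I} (hr : UniformOn n H w r) :
    ∃ r', UniformOn (n + 1) H u r' := by
  classical
  let r' : Finset ℕ → Set I := fun m => {i | i ∈ r (m.erase n) ∧ (n ∉ m → i ∈ S)}
  have hcp : ∀ {a b : Finset W}, a.card = n → n ∉ fcommonPos a b := by
    intro a b han hmem
    obtain ⟨x, hx, hxn⟩ := Finset.mem_image.1 hmem
    have := pos_lt_card (Finset.mem_inter.1 hx).1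
    omega
  have hdelta_lt : ∀ a b : Finset W, ↑a ⊆ H → ↑b ⊆ H → a.card = n → b.card = n →
      ∀ γ ∈ H, ∀ γ' ∈ H, γ < γ' → (∀ x ∈ a, x < γ) → (∀ x ∈ b, x < γ') →
      FAligned (insert γ a) (insert γ' b) → ∀ i j, Hit (u (insert γ a)) (u (insert γ' b)) i j ↔
        i = j ∧ i ∈ r' (fcommonPos (insert γ a) (insert γ' b)) := by
    intro a b ha hb han hbn γ hγ γ' hγ' hγγ' haγ hbγ' hal i j
    obtain ⟨h1, h2, h3⟩ := hal.of_insert_lt hγγ' haγ hbγ'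
    rw [hT.lt a b ha hb han hbn γ hγ γ' hγ' hγγ' haγ hbγ' h1, h3, hr.hit a b ha hb han hbn h2]
    simp only [r', mem_ofPred_eq, hcp han, not_false_eq_true, forall_const,
      Finset.erase_eq_of_notMem (hcp han)]
    constructor
    · rintro ⟨h1, h2, h3, h4⟩; exact ⟨h3, h4, h1⟩
    · rintro ⟨rfl, h4, h1⟩; exact ⟨h1, h1, rfl, h4⟩
  refine ⟨r', ⟨?_, ?_⟩⟩
  · intro m m'
    ext i
    have h1 : (m ∩ m').erase n = m.erase n ∩ m'.erase n := by
      ext k; simp only [Finset.mem_erase, Finset.mem_inter]; tauto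
    simp only [r', h1, hr.inter, mem_inter_iff, mem_ofPred_eq, Finset.mem_inter]
    tauto
  · intro a b ha₀ hb₀ han₀ hbn₀ hal i j
    obtain ⟨γ, hγ, a, ha, rfl, han, haγ⟩ := exists_split ha₀ han₀
    obtain ⟨γ', hγ', b, hb, rfl, hbn, hbγ'⟩ := exists_split hb₀ hbn₀
    rcases lt_trichotomy γ γ' with hγγ' | rfl | hγγ'
    · exact hdelta_lt a b ha hb han hbn γ hγ γ' hγ' hγγ' haγ hbγ' hal i j
    · obtain ⟨h1, h2⟩ := hal.of_insert_same haγ hbγ'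
      rw [hT.same γ hγ a b ha hb haγ hbγ', hr.hit a b ha hb han hbn h1, h2, han]
      simp [r', Finset.erase_insert (hcp han)]
    · rw [hal.fcommonPos_comm]
      constructor
      · intro hij
        obtain ⟨rfl, h⟩ := (hdelta_lt b a hb ha hbn han γ' hγ' γ hγ hγγ' hbγ' haγ hal.symm j i).1
          hij.symm
        exact ⟨rfl, h⟩
      · rintro ⟨rfl, h⟩
        exact ((hdelta_lt b a hb ha hbn han γ' hγ' γ hγ hγγ' hbγ' haγ hal.symm i i).2 ⟨rfl, h⟩).symm

-- At a common top, the intersection type before and after the replacement is that of `w a` and `w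
-- b`. Below the tops, the replacement takes place inside `a` and `b` with unchanged tops, and the
-- invariance of `w` applies. With different tops the common point `x` can be neither of them.
omit [WellFoundedLT W] in
theorem TopPattern.replacementInvariant {n : ℕ} {H : Set W} {u w : Finset W → I → Option X}
    {S : Set I} (hT : TopPattern n H u w S) (hinv : FReplacementInvariant n H w) :
    FReplacementInvariant (n + 1) H u := by
  have hposs : ∀ {a : Finset W} {γ x α : W}, x < γ → FPossible (insert γ a) x α →
      FPossible a x α ∧ α < γ := fun hx h =>
    ⟨fun y hy => h y (Finset.mem_insert_of_mem hy), (h _ (Finset.mem_insert_self _ _)).2 hx⟩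
  have hrepl : ∀ {a : Finset W} {γ x α : W}, ↑a ⊆ H → a.card = n → (∀ y ∈ a, y < γ) → x ∈ a →
      FPossible a x α → α ∈ H → α < γ → (∀ y ∈ insert α (a.erase x), y < γ) ∧
      ↑(insert α (a.erase x)) ⊆ H ∧ (insert α (a.erase x)).card = n ∧
      insert α ((insert γ a).erase x) = insert γ (insert α (a.erase x)) := by
    intro a γ x α ha han haγ hx hp hα hαγ
    refine ⟨?_, ?_, ?_, ?_⟩
    · intro y hy
      rcases Finset.mem_insert.1 hy with rfl | hy
      · exact hαγ
      · exact haγ y (Finset.mem_of_mem_erase hy)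
    · rw [Finset.coe_insert]
      exact insert_subset hα ((Finset.coe_subset.2 (Finset.erase_subset _ _)).trans ha)
    · rw [Finset.card_insert_of_notMem, Finset.card_erase_of_mem hx, han]
      · have := Finset.card_pos.2 ⟨x, hx⟩
        omega
      · intro hm
        have hm' := Finset.mem_erase.1 hm
        rcases lt_or_gt_of_ne hm'.1 with h | h
        · exact lt_irrefl _ ((hp α hm'.2).1 h)
        · exact lt_irrefl _ ((hp α hm'.2).2 h)
    · rw [Finset.erase_insert_of_ne (haγ x hx).ne', Finset.insert_comm]
  have hpos : ∀ {a b : Finset W} {γ γ' x : W}, (∀ y ∈ a, y < γ) → (∀ y ∈ b, y < γ') →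
      (∀ y ∈ insert γ a, y ∈ insert γ' b → x ≤ y → pos (insert γ a) y = pos (insert γ' b) y) →
      ∀ y ∈ a, y ∈ b → x ≤ y → pos a y = pos b y := by
    intro a b γ γ' x ha hb h y hya hyb hxy
    have := h y (Finset.mem_insert_of_mem hya) (Finset.mem_insert_of_mem hyb) hxy
    rwa [pos_insert_of_le (ha y hya).le, pos_insert_of_le (hb y hyb).le] at this
  have hinv_lt : ∀ a b : Finset W, ↑a ⊆ H → ↑b ⊆ H → a.card = n → b.card = n →
      ∀ γ ∈ H, ∀ γ' ∈ H, γ < γ' → (∀ x ∈ a, x < γ) → (∀ x ∈ b, x < γ') →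
      ∀ x ∈ insert γ a, x ∈ insert γ' b →
      (∀ y ∈ insert γ a, y ∈ insert γ' b → x ≤ y → pos (insert γ a) y = pos (insert γ' b) y) →
      ∀ α ∈ H, FPossible (insert γ a) x α → FPossible (insert γ' b) x α →
      ∀ i j, Hit (u (insert γ a)) (u (insert γ' b)) i j ↔
        Hit (u (insert α ((insert γ a).erase x))) (u (insert α ((insert γ' b).erase x))) i j := by
    intro a b ha hb han hbn γ hγ γ' hγ' hγγ' haγ hbγ' x hxa hxb hal α hα hpa hpb i j
    have hγb : γ ∉ b := notMem_of_pos_eq (han.trans hbn.symm) haγ hbγ' fun h => by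
      refine hal γ (Finset.mem_insert_self _ _) (Finset.mem_insert_of_mem h) ?_
      rcases Finset.mem_insert.1 hxa with rfl | hx
      · exact le_rfl
      · exact (haγ x hx).le
    have hxγ : x ≠ γ := by
      rintro rfl
      exact (Finset.mem_insert.1 hxb).elim (fun h => hγγ'.ne h) hγb
    have hxa' : x ∈ a := (Finset.mem_insert.1 hxa).resolve_left hxγ
    have hxb' : x ∈ b := (Finset.mem_insert.1 hxb).resolve_left fun h =>
      (h ▸ haγ x hxa').not_gt hγγ'
    obtain ⟨hpa', hαγ⟩ := hposs (haγ x hxa') hpa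
    obtain ⟨hpb', hαγ'⟩ := hposs (hbγ' x hxb') hpb
    obtain ⟨p1, p2, p3, p4⟩ := hrepl ha han haγ hxa' hpa' hα hαγ
    obtain ⟨q1, q2, q3, q4⟩ := hrepl hb hbn hbγ' hxb' hpb' hα hαγ'
    have hγb' : γ ∉ insert α (b.erase x) := fun h => (Finset.mem_insert.1 h).elim
      (fun h => hαγ.ne' h) fun h => hγb (Finset.mem_of_mem_erase h)
    rw [p4, q4, hT.lt a b ha hb han hbn γ hγ γ' hγ' hγγ' haγ hbγ' hγb,
      hT.lt _ _ p2 q2 p3 q3 γ hγ γ' hγ' hγγ' p1 q1 hγb',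
      hinv a b ha hb han hbn x hxa' hxb' (hpos haγ hbγ' hal) α hα hpa' hpb']
  intro a b ha₀ hb₀ han₀ hbn₀ x hxa hxb hal α hα hpa hpb i j
  obtain ⟨γ, hγ, a, ha, rfl, han, haγ⟩ := exists_split ha₀ han₀
  obtain ⟨γ', hγ', b, hb, rfl, hbn, hbγ'⟩ := exists_split hb₀ hbn₀
  rcases lt_trichotomy γ γ' with hγγ' | rfl | hγγ'
  · exact hinv_lt a b ha hb han hbn γ hγ γ' hγ' hγγ' haγ hbγ' x hxa hxb hal α hα hpa hpb i j
  · by_cases hxγ : x = γ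
    · subst hxγ
      have e : ∀ {a : Finset W}, (∀ y ∈ a, y < x) → (insert x a).erase x = a := fun h =>
        Finset.erase_insert fun hm => lt_irrefl _ (h _ hm)
      rw [e haγ, e hbγ', hT.same x hγ a b ha hb haγ hbγ']
      refine (hT.same α hα a b ha hb (fun y hy => ?_) (fun y hy => ?_) i j).symm
      · exact (hpa y (Finset.mem_insert_of_mem hy)).1 (haγ y hy)
      · exact (hpb y (Finset.mem_insert_of_mem hy)).1 (hbγ' y hy)
    · have hxa' : x ∈ a := (Finset.mem_insert.1 hxa).resolve_left hxγ
      have hxb' : x ∈ b := (Finset.mem_insert.1 hxb).resolve_left hxγ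
      obtain ⟨hpa', hαγ⟩ := hposs (haγ x hxa') hpa
      obtain ⟨hpb', -⟩ := hposs (hbγ' x hxb') hpb
      obtain ⟨p1, p2, p3, p4⟩ := hrepl ha han haγ hxa' hpa' hα hαγ
      obtain ⟨q1, q2, q3, q4⟩ := hrepl hb hbn hbγ' hxb' hpb' hα hαγ
      rw [p4, q4, hT.same γ hγ a b ha hb haγ hbγ', hT.same γ hγ _ _ p2 q2 p1 q1]
      exact hinv a b ha hb han hbn x hxa' hxb' (hpos haγ hbγ' hal) α hα hpa' hpb' i j
  · have := hinv_lt b a hb ha hbn han γ' hγ' γ hγ hγγ' hbγ' haγ x hxb hxa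
      (fun y h1 h2 h3 => (hal y h2 h1 h3).symm) α hα hpb hpa j i
    exact ⟨fun h => (this.1 h.symm).symm, fun h => (this.2 h.symm).symm⟩

theorem uniformization_step {lam κ : Cardinal.{u}} (hlam : lam.IsRegular) (hunc : ℵ₀ < lam)
    (hκ : LTInaccessible κ lam) (hI : #I < lam) {n : ℕ} (hn : 1 ≤ n)
    (ih : ∀ (C : Type u), #C < lam → ∀ A : Set W, sigma lam n ≤ #A →
      ∀ u : Finset W → I → Option X, (∀ b, #(labels (u b)) < κ) →
      (∀ b, LabelInjective (u b)) → ∀ g : Finset W → C,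
      ∃ H ⊆ A, #H = lam ∧ (∃ c, ∀ b : Finset W, ↑b ⊆ H → b.card = n → g b = c) ∧
      (∃ r, UniformOn n H u r) ∧ FReplacementInvariant n H u)
    {C : Type u} (hC : #C < lam) {A : Set W}
    (hA : sigma lam (n + 1) ≤ #A) (u : Finset W → I → Option X) (hu : ∀ b, #(labels (u b)) < κ)
    (hinj : ∀ b, LabelInjective (u b)) (g : Finset W → C) :
    ∃ H ⊆ A, #H = lam ∧ (∃ c, ∀ b : Finset W, ↑b ⊆ H → b.card = n + 1 → g b = c) ∧
      (∃ r, UniformOn (n + 1) H u r) ∧ FReplacementInvariant (n + 1) H u := by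
  classical
  obtain ⟨hσ, hlσ⟩ := sigma_isRegular hlam n
  obtain ⟨δ, hδ, B, hBA, hB, s, hE⟩ := exists_endFamily hσ (hI.trans_le hlσ) (hC.trans_le hlσ)
    (powerlt_sigma_lt hn hA) u hinj g
  have hs : ∀ a, #(s a) < κ := fun a => (mk_le_mk_of_subset (hE.sub a)).trans_lt (hu _)
  -- Taking the set of old labels as part of the colour makes it constant; fewer than `lam` such
  -- sets exist by `mk_small_subsets_lt`.
  obtain ⟨H₁, hH₁B, hH₁, ⟨⟨c, S, hSκ⟩, hcS⟩, ⟨r, hr⟩, hinv⟩ := ih (C × {S : Set I // #S < κ})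
    (by
      rw [mk_prod, lift_id, lift_id]
      exact mul_lt_of_lt hlam.aleph0_le hC (mk_small_subsets_lt hlam hunc hκ hI))
    B hB (fun a => u (insert δ a)) (fun a => hu _) (fun a => hinj _)
    (fun a => (g (insert δ a), ⟨s a, hs a⟩))
  obtain ⟨H₀, hH₀H₁, hH₀, hunb⟩ := exists_subset_unbounded hlam hH₁.ge
  have hH₀B := hH₀H₁.trans hH₁B
  have hS : ∀ a : Finset W, ↑a ⊆ H₀ → a.card = n → s a = S := fun a ha han =>
    congrArg (fun z : C × {S : Set I // #S < κ} => z.2.1) (hcS a (ha.trans hH₀H₁) han)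
  have hc : ∀ a : Finset W, ↑a ⊆ H₀ → a.card = n → g (insert δ a) = c := fun a ha han =>
    congrArg (fun z : C × {S : Set I // #S < κ} => z.1) (hcS a (ha.trans hH₀H₁) han)
  obtain ⟨H₂, hH₂H₀, hH₂, hlt⟩ := exists_avoiding_subset hlam hI hE hH₀B hH₀.ge hunb hS
    (hr.mono hH₀H₁)
  obtain ⟨H, hHH₂, hH, -⟩ := exists_subset_unbounded hlam hH₂
  have hHH₀ := hHH₂.trans hH₂H₀
  have hHB := hHH₀.trans hH₀B
  have hT : TopPattern n H u (fun a => u (insert δ a)) S :=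
    ⟨fun γ hγ a b ha hb => hE.hit γ (hHB hγ) a b (ha.trans hHB) (hb.trans hHB),
      fun a b ha hb han hbn γ hγ γ' hγ' =>
        hlt a b (ha.trans hHH₂) (hb.trans hHH₂) han hbn γ (hHH₂ hγ) γ' (hHH₂ hγ')⟩
  refine ⟨H, hHB.trans hBA, hH, ⟨c, fun b hb hbn => ?_⟩, hT.uniformOn (hr.mono (hHH₀.trans hH₀H₁)),
    hT.replacementInvariant (hinv.mono (hHH₀.trans hH₀H₁))⟩
  obtain ⟨γ, hγ, a, ha, rfl, han, haγ⟩ := exists_split hb hbn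
  rw [hE.color γ (hHB hγ) a (ha.trans hHB) haγ, hc a (ha.trans hHH₀) han]

theorem uniformization {lam κ : Cardinal.{u}} (hlam : lam.IsRegular) (hunc : ℵ₀ < lam)
    (hκ : LTInaccessible κ lam) (hI : #I < lam) {n : ℕ} (hn : 1 ≤ n) :
    ∀ (C : Type u), #C < lam → ∀ A : Set W, sigma lam n ≤ #A →
      ∀ u : Finset W → I → Option X, (∀ b, #(labels (u b)) < κ) →
      (∀ b, LabelInjective (u b)) → ∀ g : Finset W → C,
      ∃ H ⊆ A, #H = lam ∧ (∃ c, ∀ b : Finset W, ↑b ⊆ H → b.card = n → g b = c) ∧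
      (∃ r, UniformOn n H u r) ∧ FReplacementInvariant n H u := by
  induction n, hn using Nat.le_induction with
  | base => exact fun C hC A hA u hu hinj g => uniformization_one hlam hunc hκ hI hC hA u hu hinj g
  | succ n hn ih =>
    exact fun C hC A hA u hu hinj g => uniformization_step hlam hunc hκ hI hn ih hC hA u hu hinj g

/-! ### The Erdős–Rado theorem -/

/-- Each drop in dimension leaves behind a top point `δ` that may replace the last element of any
set; these points make up `t`. Only colours matter, so `exists_endFamily` is used with an empty
label set. -/
theorem erdosRado {lam : Cardinal.{u}} (hlam : lam.IsRegular) {n : ℕ} (hn : 1 ≤ n) :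
    ∀ (C : Type u), #C < lam → ∀ A : Set W, sigma lam n ≤ #A → ∀ g : Finset W → C,
      ∃ H ⊆ A, ∃ t : Finset W, ↑t ⊆ A ∧ #H = lam ∧ (∀ x ∈ H, #(H ∩ Iio x : Set W) < lam) ∧
        t.card = n - 1 ∧ (∀ x ∈ H, ∀ y ∈ t, x < y) ∧
        ∃ c, ∀ b : Finset W, ↑b ⊆ H ∪ ↑t → b.card = n → g b = c := by
  induction n, hn using Nat.le_induction with
  | base =>
    intro C hC A hA g
    obtain ⟨c, A', hA'A, hA', hcol⟩ := infinite_pigeonhole_set (s := A) (fun γ => g {γ.1}) lam hA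
      hlam.aleph0_le (by rwa [hlam.cof_ord])
    obtain ⟨H, hHA, hH, hi⟩ := exists_subset_small_initialSegments hA'
    refine ⟨H, hHA.trans hA'A, ∅, by simp, hH, hi, rfl, by simp, c, fun b hb hb1 => ?_⟩
    obtain ⟨γ, rfl⟩ := Finset.card_eq_one.1 hb1
    refine hcol (hHA ?_)
    simpa using hb
  | succ n hn ih =>
    intro C hC A hA g
    classical
    obtain ⟨hσ, hlσ⟩ := sigma_isRegular hlam n
    obtain ⟨δ, hδ, B, hBA, hB, s, hE⟩ := exists_endFamily (I := PEmpty) (X := PEmpty.{u + 1}) hσ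
      (by simpa using hσ.pos) (hC.trans_le hlσ)
      (powerlt_sigma_lt hn hA) (fun _ _ => none) (fun b i => i.elim) g
    obtain ⟨H, hHB, t, htB, hH, hi, htn, hHt, c, hc⟩ := ih C hC B hB fun a => g (insert δ a)
    have hlt : ∀ x ∈ H ∪ ↑t, x < δ := by
      rintro x (hx | hx)
      · exact hE.lt x (hHB hx)
      · exact hE.lt x (htB hx)
    refine ⟨H, hHB.trans hBA, insert δ t, ?_, hH, hi, ?_, ?_, c, ?_⟩
    · rw [Finset.coe_insert]; exact insert_subset hδ (htB.trans hBA)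
    · rw [card_insert_above fun x hx => hlt x (Or.inr hx), htn]; omega
    · intro x hx y hy
      rcases Finset.mem_insert.1 hy with rfl | hy
      · exact hlt x (Or.inl hx)
      · exact hHt x hx y hy
    · intro b hb hbn
      obtain ⟨γ, hγ, a, hab, rfl, han, haγ⟩ := exists_eq_insert_max hbn
      have hHt' : H ∪ ↑t ⊆ B := union_subset hHB htB
      have hγ' : γ = δ ∨ γ ∈ H ∪ ↑t := by
        have := hb hγ
        rw [Finset.coe_insert, union_insert] at this
        exact this
      have ha : ↑a ⊆ H ∪ ↑t := by
        intro x hx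
        have h1 := hb (Finset.mem_insert_of_mem hx)
        rw [Finset.coe_insert, union_insert] at h1
        refine h1.resolve_left ?_
        rintro rfl
        rcases hγ' with rfl | h
        · exact lt_irrefl _ (haγ _ hx)
        · exact (haγ _ hx).not_gt (hlt _ h)
      rcases hγ' with rfl | h
      · exact hc a ha han
      · rw [hE.color γ (hHt' h) a (ha.trans hHt') haγ]
        exact hc a ha han

end Main
/-! ### Negative partition relations -/

/-- Some 2-colouring of the `n`-subsets of `A` has no homogeneous set of size `lam`. -/
def HasBadColoring {Y : Type u} (lam : Cardinal.{u}) (n : ℕ) (A : Set Y) : Prop :=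
  ∃ c : Finset Y → Prop, ∀ H ⊆ A, lam ≤ #H →
    (∃ b : Finset Y, ↑b ⊆ H ∧ b.card = n ∧ c b) ∧ ∃ b : Finset Y, ↑b ⊆ H ∧ b.card = n ∧ ¬ c b

theorem exists_finset_image_eq {Y Z : Type u} [DecidableEq Z] {f : Y → Z} {H : Set Y}
    (hf : InjOn f H) {b : Finset Z} (hb : ↑b ⊆ f '' H) :
    ∃ a : Finset Y, ↑a ⊆ H ∧ a.image f = b ∧ a.card = b.card := by
  obtain ⟨a, ha, rfl⟩ := Finset.subset_set_image_iff.1 hb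
  refine ⟨a, ha, rfl, (Finset.card_image_of_injOn (hf.mono ha)).symm⟩

theorem HasBadColoring.of_injOn {Y Z : Type u} {lam : Cardinal.{u}} {n : ℕ} {A : Set Y} {A' : Set Z}
    (h : HasBadColoring lam n A') (f : Y → Z) (hf : InjOn f A) (hA : MapsTo f A A') :
    HasBadColoring lam n A := by
  classical
  obtain ⟨c, hc⟩ := h
  refine ⟨fun b => c (b.image f), fun H hHA hH => ?_⟩
  have hfH := hf.mono hHA
  obtain ⟨⟨b, hb, hbn, hcb⟩, b', hb', hbn', hcb'⟩ := hc (f '' H)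
    (hA.image_subset.trans' (image_mono hHA)) (by rwa [mk_image_eq_of_injOn _ _ hfH])
  obtain ⟨a, ha, rfl, hab⟩ := exists_finset_image_eq hfH hb
  obtain ⟨a', ha', rfl, hab'⟩ := exists_finset_image_eq hfH hb'
  exact ⟨⟨a, ha, hab.trans hbn, hcb⟩, a', ha', hab'.trans hbn', hcb'⟩

theorem hasBadColoring_of_lt {Y : Type u} {lam : Cardinal.{u}} {n : ℕ} {A : Set Y} (h : #A < lam) :
    HasBadColoring lam n A :=
  ⟨fun _ => True, fun _ hHA hH => absurd (hH.trans (mk_le_mk_of_subset hHA)) h.not_ge⟩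

theorem HasBadColoring.of_card_le {Y Z : Type u} {lam : Cardinal.{u}} {n : ℕ}
    (hlam : lam.IsRegular) (h : HasBadColoring lam n (univ : Set Z)) {A : Set Y} (hA : #A ≤ #Z) :
    HasBadColoring lam n A := by
  classical
  rcases isEmpty_or_nonempty Z with hZ | hZ
  · exact hasBadColoring_of_lt (hA.trans_lt (by simpa using hlam.pos))
  obtain ⟨f⟩ := hA
  refine h.of_injOn (fun y => if hy : y ∈ A then f ⟨y, hy⟩ else hZ.some) ?_ (mapsTo_univ _ _)
  intro x hx y hy hxy
  simp only [hx, hy, dite_true] at hxy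
  exact congrArg Subtype.val (f.injective hxy)

/-! ### Lexicographic order on power sets, Sierpiński colourings and stepping up. -/

section Lex

variable {K : Type u} [LinearOrder K]

/-- `A` precedes `B` lexicographically, and `k` is their first difference. -/
def LexAt (A B : Set K) (k : K) : Prop := k ∉ A ∧ k ∈ B ∧ ∀ j < k, j ∈ A ↔ j ∈ B

theorem LexAt.compl {A B : Set K} {k : K} : LexAt Aᶜ Bᶜ k ↔ LexAt B A k := by
  simp only [LexAt, mem_compl_iff, not_not]
  constructor
  · rintro ⟨h1, h2, h3⟩; exact ⟨h2, h1, fun j hj => (not_iff_not.1 (h3 j hj)).symm⟩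
  · rintro ⟨h1, h2, h3⟩; exact ⟨h2, h1, fun j hj => not_iff_not.2 (h3 j hj).symm⟩

theorem LexAt.trans {A B C : Set K} {k l : K} (h : LexAt A B k) (h' : LexAt B C l) :
    LexAt A C (min k l) := by
  rcases lt_trichotomy k l with hlt | rfl | hlt
  · rw [min_eq_left hlt.le]
    exact ⟨h.1, (h'.2.2 k hlt).1 h.2.1, fun j hj => (h.2.2 j hj).trans (h'.2.2 j (hj.trans hlt))⟩
  · exact absurd h.2.1 h'.1
  · rw [min_eq_right hlt.le]
    exact ⟨fun hA => h'.1 ((h.2.2 l hlt).1 hA), h'.2.1,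
      fun j hj => (h.2.2 j (hj.trans hlt)).trans (h'.2.2 j hj)⟩

theorem LexAt.asymm {A B : Set K} {k l : K} (h : LexAt A B k) (h' : LexAt B A l) : False := by
  have := h.trans h'
  exact this.1 this.2.1

theorem LexAt.unique {A B : Set K} {k l : K} (h : LexAt A B k) (h' : LexAt A B l) : k = l := by
  rcases lt_trichotomy k l with hlt | heq | hlt
  · exact absurd ((h'.2.2 k hlt).2 h.2.1) h.1
  · exact heq
  · exact absurd ((h.2.2 l hlt).2 h'.2.1) h'.1

theorem exists_lexAt [WellFoundedLT K] {A B : Set K} (h : A ≠ B) :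
    (∃ k, LexAt A B k) ∨ ∃ k, LexAt B A k := by
  have hne : {k | ¬ (k ∈ A ↔ k ∈ B)}.Nonempty := by
    by_contra hn
    rw [not_nonempty_iff_eq_empty] at hn
    refine h (Set.ext fun k => ?_)
    by_contra hk
    exact (hn ▸ hk : k ∈ (∅ : Set K))
  obtain ⟨k, hk, hmin⟩ := wellFounded_lt.has_min _ hne
  have hlt : ∀ j < k, j ∈ A ↔ j ∈ B := fun j hj => by
    by_contra hn
    exact hmin j hn hj
  rw [mem_ofPred_eq] at hk
  by_cases hA : k ∈ A
  · exact Or.inr ⟨k, fun hB => hk ⟨fun _ => hB, fun _ => hA⟩, hA, fun j hj => (hlt j hj).symm⟩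
  · refine Or.inl ⟨k, hA, ?_, hlt⟩
    by_contra hB
    exact hk ⟨fun h => absurd h hA, fun h => absurd h hB⟩

/-- The first difference of `A` and `B`. -/
noncomputable def firstDiff [Nonempty K] (A B : Set K) : K :=
  Classical.epsilon fun k => LexAt A B k ∨ LexAt B A k

theorem LexAt.firstDiff_eq [Nonempty K] {A B : Set K} {k : K} (h : LexAt A B k) :
    firstDiff A B = k ∧ firstDiff B A = k := by
  constructor
  · rcases Classical.epsilon_spec (p := fun k => LexAt A B k ∨ LexAt B A k) ⟨k, Or.inl h⟩ with h' | h'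
    · exact h'.unique h
    · exact (h.asymm h').elim
  · rcases Classical.epsilon_spec (p := fun k => LexAt B A k ∨ LexAt A B k) ⟨k, Or.inr h⟩ with h' | h'
    · exact (h.asymm h').elim
    · exact h'.unique h

variable {W : Type u} [LinearOrder W] [WellFoundedLT W] [WellFoundedLT K]

/-- For fixed `α` the first difference of `x α` and `x β` can only decrease as `β` grows, so it
stabilizes at some `ε α` from a threshold `β₀ α` on. Thinning puts every later point beyond the
earlier thresholds. -/
theorem exists_comb_of_increasing {lam : Cardinal.{u}} (hlam : lam.IsRegular) {H : Set W}
    (hH : lam ≤ #H) (hi : ∀ x ∈ H, #(H ∩ Iio x : Set W) < lam) {x : W → Set K}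
    (hx : ∀ α ∈ H, ∀ β ∈ H, α < β → ∃ k, LexAt (x α) (x β) k) :
    ∃ H' ⊆ H, lam ≤ #H' ∧ ∃ ε : W → K, ∀ α ∈ H', ∀ β ∈ H', α < β →
      LexAt (x α) (x β) (ε α) ∧ ε α < ε β := by
  classical
  have hunb : ∀ α ∈ H, ∃ β ∈ H, α < β := by
    intro α hα
    obtain ⟨y, hy, hyn⟩ := not_bddAbove_card hH (B := insert α (H ∩ Iio α))
      (mk_insert_le.trans_lt (add_lt_of_lt hlam.aleph0_le (hi α hα)
        (one_lt_aleph0.trans_le hlam.aleph0_le)))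
    rw [mem_insert_iff, not_or] at hyn
    exact ⟨y, hy, lt_of_le_of_ne (not_lt.1 fun h => hyn.2 ⟨hy, h⟩) (Ne.symm hyn.1)⟩
  have hlim : ∀ α, ∃ (k : K) (β₀ : W), α ∈ H → β₀ ∈ H ∧ α < β₀ ∧
      ∀ β ∈ H, β₀ ≤ β → LexAt (x α) (x β) k := by
    intro α
    by_cases hα : α ∈ H
    · have hne : {k | ∃ β ∈ H, α < β ∧ LexAt (x α) (x β) k}.Nonempty := by
        obtain ⟨β, hβ, hlt⟩ := hunb α hα
        obtain ⟨k, hk⟩ := hx α hα β hβ hlt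
        exact ⟨k, β, hβ, hlt, hk⟩
      -- By `LexAt.trans`, passing to a later `β` takes a minimum with `k`; as `k` is least, it
      -- stays.
      obtain ⟨k, ⟨β₀, hβ₀, hlt, hk⟩, hmin⟩ := wellFounded_lt.has_min _ hne
      refine ⟨k, β₀, fun _ => ⟨hβ₀, hlt, fun β hβ hle => ?_⟩⟩
      rcases hle.eq_or_lt with rfl | hlt'
      · exact hk
      · obtain ⟨l, hl⟩ := hx β₀ hβ₀ β hβ hlt'
        have := hk.trans hl
        have hkl : min k l = k := le_antisymm (min_le_left _ _)
          (not_lt.1 (hmin _ ⟨β, hβ, hlt.trans hlt', this⟩))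
        rwa [hkl] at this
    · obtain ⟨β, hβ⟩ : H.Nonempty := by
        obtain ⟨y, hy, -⟩ := not_bddAbove_card hH (B := ∅) (by simpa using hlam.pos)
        exact ⟨y, hy⟩
      obtain ⟨γ, hγ, hlt⟩ := hunb β hβ
      exact ⟨(hx β hβ γ hγ hlt).choose, β, fun h => absurd h hα⟩
  choose ε β₀ hε using hlim
  obtain ⟨H', hH'H, hH', hok⟩ := exists_greedy_subset (c := lam) (A := H)
    (fun p γ => ∀ α ∈ p, β₀ α ≤ γ) (by
      intro B hBH hB
      obtain ⟨γ, hγ, hγn⟩ := not_bddAbove_card hH (B := B ∪ ⋃ α : B, H ∩ Iio (β₀ α)) (by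
        refine (mk_union_le _ _).trans_lt (add_lt_of_lt hlam.aleph0_le hB ?_)
        rw [card_iUnion_lt_iff_forall_of_isRegular hlam hB]
        exact fun α => hi _ (hε α (hBH α.2)).1)
      rw [mem_union, not_or] at hγn
      refine ⟨γ, hγ, hγn.1, fun p hp α hα => not_lt.1 fun h => hγn.2 ?_⟩
      exact mem_iUnion.2 ⟨⟨α, hp hα⟩, hγ, h⟩)
  refine ⟨H', hH'H, hH', ε, fun α hα β hβ hlt => ?_⟩
  have h1 : LexAt (x α) (x β) (ε α) := (hε α (hH'H hα)).2.2 β (hH'H hβ)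
    (hok β hβ {α} (by simpa using hα) (by simpa using hlt) α (by simp))
  refine ⟨h1, ?_⟩
  obtain ⟨hα1, hα2, hα3⟩ := hε α (hH'H hα)
  obtain ⟨hβ1, hβ2, hβ3⟩ := hε β (hH'H hβ)
  -- Beyond both thresholds, `ε α = min (ε α) (ε β)`. Equality is excluded, since `ε α ∈ x β` and `ε
  -- β ∉ x β`.
  obtain ⟨γ, hγ, hγα, hγβ⟩ : ∃ γ ∈ H, β₀ α ≤ γ ∧ β₀ β ≤ γ := by
    rcases le_total (β₀ α) (β₀ β) with h | h
    · exact ⟨_, hβ1, h, le_rfl⟩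
    · exact ⟨_, hα1, le_rfl, h⟩
  have h2 := h1.trans (hβ3 γ hγ hγβ)
  have h3 := h2.unique (hα3 γ hγ hγα)
  have h4 : ε α ≤ ε β := min_eq_left_iff.1 h3
  refine lt_of_le_of_ne h4 fun he => (hβ3 γ hγ hγβ).1 (he ▸ h1.2.1)

/-- Complementation reverses the lexicographic order and preserves first differences, which covers
decreasing sequences. -/
theorem exists_comb {lam : Cardinal.{u}} (hlam : lam.IsRegular) {H : Set W}
    (hH : lam ≤ #H) (hi : ∀ x ∈ H, #(H ∩ Iio x : Set W) < lam) {x : W → Set K}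
    (hx : (∀ α ∈ H, ∀ β ∈ H, α < β → ∃ k, LexAt (x α) (x β) k) ∨
      ∀ α ∈ H, ∀ β ∈ H, α < β → ∃ k, LexAt (x β) (x α) k) :
    ∃ H' ⊆ H, lam ≤ #H' ∧ ∃ ε : W → K, ∀ α ∈ H', ∀ β ∈ H', α < β →
      (LexAt (x α) (x β) (ε α) ∨ LexAt (x β) (x α) (ε α)) ∧ ε α < ε β := by
  rcases hx with hx | hx
  · obtain ⟨H', h1, h2, ε, h3⟩ := exists_comb_of_increasing hlam hH hi hx
    exact ⟨H', h1, h2, ε, fun α hα β hβ h => ⟨Or.inl (h3 α hα β hβ h).1, (h3 α hα β hβ h).2⟩⟩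
  · obtain ⟨H', h1, h2, ε, h3⟩ := exists_comb_of_increasing (x := fun α => (x α)ᶜ) hlam hH hi
      fun α hα β hβ h => by simpa only [LexAt.compl] using hx α hα β hβ h
    exact ⟨H', h1, h2, ε, fun α hα β hβ h => ⟨Or.inr (LexAt.compl.1 (h3 α hα β hβ h).1),
      (h3 α hα β hβ h).2⟩⟩

/-- Sierpiński's colouring: compare the well-order of `W` with the lexicographic order. A
homogeneous set is lexicographically monotone, and the `ε` of `exists_comb` would inject `lam`
points into `K`. -/
theorem hasBadColoring_two_of_lt {lam : Cardinal.{u}} (hlam : lam.IsRegular) (hK : #K < lam) {x : W → Set K}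
    (hx : Function.Injective x) : HasBadColoring lam 2 (univ : Set W) := by
  refine ⟨fun b => ∃ p ∈ b, ∃ q ∈ b, p < q ∧ ∃ k, LexAt (x p) (x q) k, fun H _ hH => ?_⟩
  obtain ⟨H₁, hH₁H, hH₁, hi⟩ := exists_subset_small_initialSegments hH
  by_contra hcon
  have hmono : (∀ α ∈ H₁, ∀ β ∈ H₁, α < β → ∃ k, LexAt (x α) (x β) k) ∨
      ∀ α ∈ H₁, ∀ β ∈ H₁, α < β → ∃ k, LexAt (x β) (x α) k := by
    by_contra! h
    obtain ⟨⟨α, hα, β, hβ, hlt, h1⟩, α', hα', β', hβ', hlt', h2⟩ := h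
    refine hcon ⟨⟨{α', β'}, ?_, Finset.card_pair hlt'.ne, α', by simp, β', by simp, hlt', ?_⟩,
      {α, β}, ?_, Finset.card_pair hlt.ne, ?_⟩
    · simp [insert_subset_iff, hH₁H hα', hH₁H hβ']
    · exact (exists_lexAt (hx.ne hlt'.ne)).resolve_right (by simpa using h2)
    · simp [insert_subset_iff, hH₁H hα, hH₁H hβ]
    · rintro ⟨p, hp, q, hq, hpq, k, hk⟩
      simp only [Finset.mem_insert, Finset.mem_singleton] at hp hq
      rcases hp with rfl | rfl <;> rcases hq with rfl | rfl
      · exact lt_irrefl _ hpq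
      · exact h1 k hk
      · exact hpq.not_gt hlt
      · exact lt_irrefl _ hpq
  obtain ⟨H', hH'H, hH', ε, hε⟩ := exists_comb hlam hH₁.ge hi hmono
  refine (hH'.trans ?_).not_gt hK
  refine mk_le_of_injective (f := fun α : H' => ε α) fun α β h => ?_
  rcases lt_trichotomy α β with hlt | heq | hlt
  · exact absurd h (hε α α.2 β β.2 hlt).2.ne
  · exact heq
  · exact absurd h (hε β β.2 α α.2 hlt).2.ne'

/-- The first three elements of `b` satisfy `R`. -/
def FirstThree (R : W → W → W → Prop) (b : Finset W) : Prop :=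
  ∃ p ∈ b, ∃ q ∈ b, ∃ r ∈ b, p < q ∧ q < r ∧ (∀ y ∈ b, y ≤ r → y = p ∨ y = q ∨ y = r) ∧ R p q r

omit [WellFoundedLT W] in
theorem firstThree_triple_union {R : W → W → W → Prop} {p q r : W} {t : Finset W} (hpq : p < q)
    (hqr : q < r) (ht : ∀ y ∈ t, r < y) :
    FirstThree R ({p, q, r} ∪ t) ↔ R p q r := by
  have hmem : ∀ y ∈ ({p, q, r} ∪ t : Finset W), y ≤ r → y = p ∨ y = q ∨ y = r := by
    intro y hy hyr
    simp only [Finset.mem_union, Finset.mem_insert, Finset.mem_singleton] at hy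
    exact hy.resolve_right fun h => (ht y h).not_ge hyr
  constructor
  · rintro ⟨p', hp', q', hq', r', hr', h1, h2, h3, h⟩
    have hp := h3 p (by simp)
    have hq := h3 q (by simp)
    have hr := h3 r (by simp)
    have hr'r : r' ≤ r := by
      by_contra! hlt
      rcases hr hlt.le with e | e | e
      · subst e
        rcases hp ((hpq.trans hqr).le.trans hlt.le) with e | e | e
        · exact (hpq.trans hqr).ne e
        · exact absurd (hpq.trans hqr) (e ▸ h1.not_gt)
        · exact absurd (hpq.trans hqr) (e ▸ hlt.not_gt)
      · subst e
        have hp := hp ((hpq.trans hqr).le.trans hlt.le)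
        have hq := hq (hqr.le.trans hlt.le)
        have hp : p = p' := hp.resolve_right fun e => e.elim (hpq.trans hqr).ne
          ((hpq.trans hqr).trans hlt).ne
        have hq : q = p' := hq.resolve_right fun e => e.elim hqr.ne (hqr.trans hlt).ne
        exact hpq.ne (hp.trans hq.symm)
      · exact hlt.ne e
    have hr := hmem r' hr' hr'r
    have hq := hmem q' hq' (h2.le.trans hr'r)
    have hp := hmem p' hp' ((h1.trans h2).le.trans hr'r)
    have key : p' = p ∧ q' = q ∧ r' = r := by
      rcases hp with rfl | rfl | rfl <;> rcases hq with rfl | rfl | rfl <;>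
        rcases hr with rfl | rfl | rfl <;>
        first
        | exact ⟨rfl, rfl, rfl⟩
        | exact absurd h1 (lt_irrefl _)
        | exact absurd h2 (lt_irrefl _)
        | exact absurd h1 (hpq.not_gt)
        | exact absurd h2 (hqr.not_gt)
        | exact absurd h1 ((hpq.trans hqr).not_gt)
        | exact absurd h2 ((hpq.trans hqr).not_gt)
        | exact absurd h2 (hpq.not_gt)
        | exact absurd h1 (hqr.not_gt)
    obtain ⟨rfl, rfl, rfl⟩ := key
    exact h
  · intro h
    exact ⟨p, by simp, q, by simp, r, by simp, hpq, hqr, hmem, h⟩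

/-- Stepping up. Sets that begin up-down get one colour, sets that begin down-up the other, and the
rest are coloured through their set of first differences. A homogeneous set must avoid one of the
two beginnings, so a tail of it is monotone. Thinned to a comb, it realizes every `n`-subset of `ε
'' H'` as the differences of an `(n + 1)`-set, and `c` takes both values there. -/
theorem hasBadColoring_succ {lam : Cardinal.{u}} (hlam : lam.IsRegular) {n : ℕ} (hn : 2 ≤ n)
    [Nonempty K] (hK : HasBadColoring lam n (univ : Set K)) {x : W → Set K}
    (hx : Function.Injective x) : HasBadColoring lam (n + 1) (univ : Set W) := by
  classical
  obtain ⟨c, hc⟩ := hK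
  let L : Set K → Set K → Prop := fun A B => ∃ k, LexAt A B k
  have hLtot : ∀ {p q}, p ≠ q → ¬ L (x p) (x q) → L (x q) (x p) := fun hne h =>
    (exists_lexAt (hx.ne hne)).resolve_left h
  have hLas : ∀ {A B}, L A B → ¬ L B A := fun ⟨_, h⟩ ⟨_, h'⟩ => h.asymm h'
  let UD : W → W → W → Prop := fun p q r => L (x p) (x q) ∧ L (x r) (x q)
  let DU : W → W → W → Prop := fun p q r => L (x q) (x p) ∧ L (x q) (x r)
  let D : Finset W → Finset K := fun b =>
    ((b ×ˢ b).filter fun z => z.1 < z.2).image fun z => firstDiff (x z.1) (x z.2)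
  refine ⟨fun b => FirstThree UD b ∨ (¬ FirstThree DU b ∧ c (D b)), fun H _ hH => ?_⟩
  obtain ⟨H₁, hH₁H, hH₁, hi⟩ := exists_subset_small_initialSegments hH
  by_contra hcon
  have hunb : ∀ α ∈ H₁, ∃ β ∈ H₁, α < β := by
    intro α hα
    obtain ⟨y, hy, hyn⟩ := not_bddAbove_card hH₁.ge (B := insert α (H₁ ∩ Iio α))
      (mk_insert_le.trans_lt (add_lt_of_lt hlam.aleph0_le (hi α hα)
        (one_lt_aleph0.trans_le hlam.aleph0_le)))
    rw [mem_insert_iff, not_or] at hyn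
    exact ⟨y, hy, lt_of_le_of_ne (not_lt.1 fun h => hyn.2 ⟨hy, h⟩) (Ne.symm hyn.1)⟩
  -- Every triple begins some `(n + 1)`-set; this is where `2 ≤ n` is needed.
  have hext : ∀ p ∈ H₁, ∀ q ∈ H₁, ∀ r ∈ H₁, p < q → q < r → ∃ b : Finset W, ↑b ⊆ H ∧ b.card = n + 1 ∧
      ∀ R : W → W → W → Prop, FirstThree R b ↔ R p q r := by
    intro p hp q hq r hr hpq hqr
    obtain ⟨t, htH, htc, ht⟩ := exists_finset_above ⟨r, hr⟩ hunb {r} (by simpa using hr) (n - 2)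
    have ht : ∀ y ∈ t, r < y := ht r (by simp)
    have h3 : ({p, q, r} : Finset W).card = 3 := by
      rw [Finset.card_insert_of_notMem, Finset.card_pair hqr.ne]
      simp [hpq.ne, (hpq.trans hqr).ne]
    refine ⟨{p, q, r} ∪ t, ?_, ?_, fun R => firstThree_triple_union hpq hqr ht⟩
    · rw [Finset.coe_union]
      refine (union_subset ?_ htH).trans hH₁H
      simp [insert_subset_iff, hp, hq, hr]
    · rw [Finset.card_union_of_disjoint, h3, htc]
      · omega
      · refine Finset.disjoint_left.2 fun y hy hyt => ?_
        have := ht y hyt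
        simp only [Finset.mem_insert, Finset.mem_singleton] at hy
        rcases hy with rfl | rfl | rfl
        · exact this.not_gt (hpq.trans hqr)
        · exact this.not_gt hqr
        · exact lt_irrefl _ this
  have hno : (∀ p ∈ H₁, ∀ q ∈ H₁, ∀ r ∈ H₁, p < q → q < r → ¬ UD p q r) ∨
      ∀ p ∈ H₁, ∀ q ∈ H₁, ∀ r ∈ H₁, p < q → q < r → ¬ DU p q r := by
    by_contra! h
    obtain ⟨⟨p, hp, q, hq, r, hr, hpq, hqr, h1⟩, p', hp', q', hq', r', hr', hpq', hqr', h2⟩ := h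
    obtain ⟨b, hb, hbn, hbR⟩ := hext p hp q hq r hr hpq hqr
    obtain ⟨b', hb', hbn', hbR'⟩ := hext p' hp' q' hq' r' hr' hpq' hqr'
    refine hcon ⟨⟨b, hb, hbn, Or.inl ((hbR _).2 h1)⟩, b', hb', hbn', ?_⟩
    rintro (h | h)
    · exact hLas h2.1 ((hbR' _).1 h).1
    · exact h.1 ((hbR' _).2 h2)
  have hmono : ∃ H₂ ⊆ H₁, lam ≤ #H₂ ∧ ((∀ α ∈ H₂, ∀ β ∈ H₂, α < β → L (x α) (x β)) ∨
      ∀ α ∈ H₂, ∀ β ∈ H₂, α < β → L (x β) (x α)) := by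
    have htail : ∀ q ∈ H₁, lam ≤ #(H₁ ∩ Ici q : Set W) := by
      intro q hq
      by_contra! hlt
      refine (hH₁.ge.trans ?_).not_gt (add_lt_of_lt hlam.aleph0_le (hi q hq) hlt)
      refine (mk_le_mk_of_subset fun y hy => ?_).trans (mk_union_le _ _)
      rcases lt_or_ge y q with h | h
      · exact Or.inl ⟨hy, h⟩
      · exact Or.inr ⟨hy, h⟩
    rcases hno with hno | hno
    -- One ascent `p < q` forces an ascent from `q` to every later point, hence increase on the
    -- whole tail from `q`. Without any ascent the set is decreasing.
    · by_cases hup : ∃ p ∈ H₁, ∃ q ∈ H₁, p < q ∧ L (x p) (x q)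
      · obtain ⟨p, hp, q, hq, hpq, hL⟩ := hup
        have h1 : ∀ r ∈ H₁, q < r → L (x q) (x r) := fun r hr hqr =>
          hLtot hqr.ne' fun h => hno p hp q hq r hr hpq hqr ⟨hL, h⟩
        refine ⟨H₁ ∩ Ici q, inter_subset_left, htail q hq, Or.inl ?_⟩
        rintro α ⟨hα, hqα⟩ β ⟨hβ, -⟩ hlt
        rcases hqα.eq_or_lt with rfl | hqα
        · exact h1 β hβ hlt
        · exact hLtot hlt.ne' fun h => hno q hq α hα β hβ hqα hlt ⟨h1 α hα hqα, h⟩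
      · push Not at hup
        exact ⟨H₁, Subset.rfl, hH₁.ge, Or.inr fun α hα β hβ h => hLtot h.ne (hup α hα β hβ h)⟩
    · by_cases hup : ∃ p ∈ H₁, ∃ q ∈ H₁, p < q ∧ L (x q) (x p)
      · obtain ⟨p, hp, q, hq, hpq, hL⟩ := hup
        have h1 : ∀ r ∈ H₁, q < r → L (x r) (x q) := fun r hr hqr =>
          hLtot hqr.ne fun h => hno p hp q hq r hr hpq hqr ⟨hL, h⟩
        refine ⟨H₁ ∩ Ici q, inter_subset_left, htail q hq, Or.inr ?_⟩
        rintro α ⟨hα, hqα⟩ β ⟨hβ, -⟩ hlt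
        rcases hqα.eq_or_lt with rfl | hqα
        · exact h1 β hβ hlt
        · exact hLtot hlt.ne fun h => hno q hq α hα β hβ hqα hlt ⟨h1 α hα hqα, h⟩
      · push Not at hup
        exact ⟨H₁, Subset.rfl, hH₁.ge, Or.inl fun α hα β hβ h => hLtot h.ne' (hup α hα β hβ h)⟩
  obtain ⟨H₂, hH₂H₁, hH₂, hmono⟩ := hmono
  obtain ⟨H', hH'H₂, hH', ε, hε⟩ := exists_comb hlam hH₂ (fun y hy => (mk_le_mk_of_subset
    (inter_subset_inter_left _ hH₂H₁)).trans_lt (hi y (hH₂H₁ hy))) hmono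
  have hfd : ∀ α ∈ H', ∀ β ∈ H', α < β → firstDiff (x α) (x β) = ε α := by
    intro α hα β hβ hlt
    rcases (hε α hα β hβ hlt).1 with h | h
    · exact h.firstDiff_eq.1
    · exact h.firstDiff_eq.2
  have hinj : InjOn ε H' := by
    intro α hα β hβ h
    rcases lt_trichotomy α β with hlt | heq | hlt
    · exact absurd h (hε α hα β hβ hlt).2.ne
    · exact heq
    · exact absurd h (hε β hβ α hα hlt).2.ne'
  have hH'unb : ∀ a : Finset W, ↑a ⊆ H' → ∃ γ ∈ H', ∀ y ∈ a, y < γ := by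
    intro a ha
    obtain ⟨γ, hγ, hγn⟩ := not_bddAbove_card hH' (B := ⋃ y : a, insert y.1 (H₁ ∩ Iio y.1)) (by
      rw [card_iUnion_lt_iff_forall_of_isRegular hlam
        ((lt_aleph0_of_finite _).trans_le hlam.aleph0_le)]
      intro y
      exact mk_insert_le.trans_lt (add_lt_of_lt hlam.aleph0_le
        (hi y (hH₂H₁ (hH'H₂ (ha y.2)))) (one_lt_aleph0.trans_le hlam.aleph0_le)))
    refine ⟨γ, hγ, fun y hy => not_le.1 fun h => hγn (mem_iUnion.2 ⟨⟨y, hy⟩, ?_⟩)⟩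
    rcases h.eq_or_lt with h | h
    · exact Or.inl h
    · exact Or.inr ⟨hH₂H₁ (hH'H₂ hγ), h⟩
  -- In a comb the difference of two points depends only on the smaller one. With `e = ε '' a`, any
  -- top `γ` above `a` completes `a` to a set whose differences are exactly `e`.
  have hreal : ∀ e : Finset K, ↑e ⊆ ε '' H' → e.card = n → ∃ b : Finset W, ↑b ⊆ H ∧ b.card = n + 1 ∧
      ((FirstThree UD b ∨ (¬ FirstThree DU b ∧ c (D b))) ↔ c e) := by
    intro e he hen
    obtain ⟨a, ha, rfl, hac⟩ := exists_finset_image_eq hinj he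
    obtain ⟨γ, hγ, haγ⟩ := hH'unb a ha
    have hbH' : ↑(insert γ a) ⊆ H' := by rw [Finset.coe_insert]; exact insert_subset hγ ha
    have hD : D (insert γ a) = a.image ε := by
      ext k
      simp only [D, Finset.mem_image, Finset.mem_filter, Finset.mem_product, Prod.exists]
      constructor
      · rintro ⟨p, q, ⟨⟨hp, hq⟩, hlt⟩, rfl⟩
        refine ⟨p, ?_, (hfd p (hbH' hp) q (hbH' hq) hlt).symm⟩
        refine (Finset.mem_insert.1 hp).resolve_left ?_
        rintro rfl
        rcases Finset.mem_insert.1 hq with rfl | hq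
        · exact lt_irrefl _ hlt
        · exact hlt.not_gt (haγ q hq)
      · rintro ⟨p, hp, rfl⟩
        exact ⟨p, γ, ⟨⟨Finset.mem_insert_of_mem hp, Finset.mem_insert_self _ _⟩, haγ p hp⟩,
          hfd p (ha hp) γ hγ (haγ p hp)⟩
    have hUD : ¬ FirstThree UD (insert γ a) := by
      rintro ⟨p, hp, q, hq, r, hr, hpq, hqr, -, h1, h2⟩
      rcases hmono with h | h
      · exact hLas h2 (h q (hH'H₂ (hbH' hq)) r (hH'H₂ (hbH' hr)) hqr)
      · exact hLas h1 (h p (hH'H₂ (hbH' hp)) q (hH'H₂ (hbH' hq)) hpq)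
    have hDU : ¬ FirstThree DU (insert γ a) := by
      rintro ⟨p, hp, q, hq, r, hr, hpq, hqr, -, h1, h2⟩
      rcases hmono with h | h
      · exact hLas h1 (h p (hH'H₂ (hbH' hp)) q (hH'H₂ (hbH' hq)) hpq)
      · exact hLas h2 (h q (hH'H₂ (hbH' hq)) r (hH'H₂ (hbH' hr)) hqr)
    refine ⟨insert γ a, ((hbH'.trans hH'H₂).trans hH₂H₁).trans hH₁H, ?_, ?_⟩
    · rw [card_insert_above haγ, hac, hen]
    · simp only [hUD, hDU, hD, false_or, not_false_eq_true, true_and]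
  obtain ⟨⟨e, he, hen, hce⟩, e', he', hen', hce'⟩ := hc (ε '' H') (subset_univ _)
    (by rwa [mk_image_eq_of_injOn _ _ hinj])
  obtain ⟨b, hb, hbn, hcb⟩ := hreal e he hen
  obtain ⟨b', hb', hbn', hcb'⟩ := hreal e' he' hen'
  exact hcon ⟨⟨b, hb, hbn, hcb.2 hce⟩, b', hb', hbn', fun h => hce' (hcb'.1 h)⟩

end Lex

/-! ### Bad colourings on all sets smaller than `σ(lam, n)`. -/

/-- By regularity a set of size `lam` has `lam` points in one fibre or meets `lam` fibres. Pairs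
inside a fibre and pairs across fibres are coloured separately. -/
theorem HasBadColoring.of_fibers {Y Z : Type u} {lam : Cardinal.{u}} (hlam : lam.IsRegular)
    (h : HasBadColoring lam 2 (univ : Set Z)) (π : Y → Z)
    (hf : ∀ z, HasBadColoring lam 2 (π ⁻¹' {z})) : HasBadColoring lam 2 (univ : Set Y) := by
  classical
  obtain ⟨c₀, hc₀⟩ := h
  choose c hc using hf
  refine ⟨fun b => (∃ z, (∀ y ∈ b, π y = z) ∧ c z b) ∨
    ((¬ ∃ z, ∀ y ∈ b, π y = z) ∧ c₀ (b.image π)), fun H _ hH => ?_⟩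
  by_cases hbig : ∃ z, lam ≤ #(H ∩ π ⁻¹' {z} : Set Y)
  · obtain ⟨z, hz⟩ := hbig
    obtain ⟨⟨b, hb, hbn, hcb⟩, b', hb', hbn', hcb'⟩ := hc z _ inter_subset_right hz
    refine ⟨⟨b, hb.trans inter_subset_left, hbn, Or.inl ⟨z, fun y hy => (hb hy).2, hcb⟩⟩,
      b', hb'.trans inter_subset_left, hbn', ?_⟩
    rintro (⟨z', hz', h⟩ | ⟨h, -⟩)
    · obtain ⟨y, hy⟩ := Finset.card_pos.1 (by omega : 0 < b'.card)
      obtain rfl : z' = z := (hz' y hy).symm.trans (hb' hy).2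
      exact hcb' h
    · exact h ⟨z, fun y hy => (hb' hy).2⟩
  · push Not at hbig
    have himg : lam ≤ #(π '' H) := by
      by_contra! hlt
      have hsub : H ⊆ ⋃ z : π '' H, H ∩ π ⁻¹' {z.1} := fun y hy =>
        mem_iUnion.2 ⟨⟨π y, mem_image_of_mem _ hy⟩, hy, rfl⟩
      refine (hH.trans (mk_le_mk_of_subset hsub)).not_gt ?_
      rw [card_iUnion_lt_iff_forall_of_isRegular hlam hlt]
      exact fun z => hbig z
    have hreal : ∀ e : Finset Z, ↑e ⊆ π '' H → e.card = 2 → ∃ b : Finset Y, ↑b ⊆ H ∧ b.card = 2 ∧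
        (((∃ z, (∀ y ∈ b, π y = z) ∧ c z b) ∨
          ((¬ ∃ z, ∀ y ∈ b, π y = z) ∧ c₀ (b.image π))) ↔ c₀ e) := by
      intro e he hen
      have : ∀ z ∈ e, ∃ y ∈ H, π y = z := fun z hz => he hz
      obtain ⟨z₁, z₂, hne, rfl⟩ := Finset.card_eq_two.1 hen
      obtain ⟨y₁, hy₁, h1⟩ := this z₁ (by simp)
      obtain ⟨y₂, hy₂, h2⟩ := this z₂ (by simp)
      have hneY : y₁ ≠ y₂ := fun h => hne (by rw [← h1, ← h2, h])
      have hno : ∀ z, ¬ ∀ y ∈ ({y₁, y₂} : Finset Y), π y = z := fun z hz => hne (by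
        rw [← h1, ← h2, hz y₁ (by simp), hz y₂ (by simp)])
      refine ⟨{y₁, y₂}, by simp [insert_subset_iff, hy₁, hy₂], Finset.card_pair hneY, ?_⟩
      have himage : ({y₁, y₂} : Finset Y).image π = {z₁, z₂} := by
        rw [Finset.image_insert, Finset.image_singleton, h1, h2]
      constructor
      · rintro (⟨z, hz, -⟩ | ⟨-, h⟩)
        · exact absurd hz (hno z)
        · rwa [himage] at h
      · exact fun h => Or.inr ⟨fun ⟨z, hz⟩ => hno z hz, by rwa [himage]⟩
    obtain ⟨⟨e, he, hen, hce⟩, e', he', hen', hce'⟩ := hc₀ _ (subset_univ _) himg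
    obtain ⟨b, hb, hbn, hcb⟩ := hreal e he hen
    obtain ⟨b', hb', hbn', hcb'⟩ := hreal e' he' hen'
    exact ⟨⟨b, hb, hbn, hcb.2 hce⟩, b', hb', hbn', fun h => hce' (hcb'.1 h)⟩

/-- `Y` embeds into the disjoint union of the power sets of the initial segments `Iio ξ` of `lam`.
Each fibre carries a Sierpiński colouring, and the index set carries the given one. -/
theorem hasBadColoring_two_powerlt {lam : Cardinal.{u}} (hlam : lam.IsRegular)
    (h : HasBadColoring lam 2 (univ : Set lam.ord.ToType)) {Y : Type u} (hY : #Y ≤ 2 ^< lam) :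
    HasBadColoring lam 2 (univ : Set Y) := by
  have hlt : ∀ ξ : lam.ord.ToType, #(Iio ξ) < lam := fun ξ =>
    (mk_Iio_lt ξ (by simp)).trans_eq (mk_ord_toType lam)
  have hfib : ∀ ξ : lam.ord.ToType,
      HasBadColoring lam 2 (univ : Set (#(Set (Iio ξ))).ord.ToType) := by
    -- The power set is replaced by its initial ordinal, since Sierpiński's colouring needs a
    -- well-order on the points.
    intro ξ
    obtain ⟨x⟩ := Cardinal.eq.1 (mk_ord_toType #(Set (Iio ξ)))
    exact hasBadColoring_two_of_lt hlam (hlt ξ) x.injective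
  have hS : HasBadColoring lam 2 (univ : Set (Σ ξ : lam.ord.ToType, Set (Iio ξ))) := by
    refine h.of_fibers hlam Sigma.fst fun ξ => ?_
    refine (hfib ξ).of_card_le hlam ?_
    rw [mk_ord_toType]
    have hsub : Sigma.fst ⁻¹' {ξ} ⊆ range (Sigma.mk (β := fun ξ => Set (Iio ξ)) ξ) := by
      rintro ⟨ξ', s⟩ rfl
      exact ⟨s, rfl⟩
    exact (mk_le_mk_of_subset hsub).trans mk_range_le
  refine hS.of_card_le hlam ?_
  rw [mk_univ, mk_sigma]
  refine hY.trans (powerlt_le.2 fun θ hθ => ?_)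
  obtain ⟨k, hk⟩ := Ordinal.typein_surj (fun x y : lam.ord.ToType => x < y) (o := θ.ord)
    (by rw [Ordinal.type_toType]; exact ord_lt_ord.2 hθ)
  have hk := congrArg Ordinal.card hk
  rw [card_ord] at hk
  have : #(Iio k) = θ := hk
  rw [← this, ← mk_set]
  exact le_sum (fun ξ : lam.ord.ToType => #(Set (Iio ξ))) k

/-- In dimension one there are fewer than `lam` points at all. Dimension two is the glued Sierpiński
colouring. From then on `σ(lam, n)` is a successor `τ⁺`, so `2 ^< τ⁺ = 2 ^ τ` and stepping up from
`τ` applies. -/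
theorem hasBadColoring_of_lt_sigma {lam : Cardinal.{u}} (hlam : lam.IsRegular)
    (h : HasBadColoring lam 2 (univ : Set lam.ord.ToType)) {n : ℕ} (hn : 1 ≤ n) {Y : Type u}
    (hY : #Y < sigma lam n) : HasBadColoring lam n (univ : Set Y) := by
  obtain ⟨k, rfl⟩ : ∃ k, n = k + 1 := ⟨n - 1, by omega⟩
  induction k generalizing Y with
  | zero => exact hasBadColoring_of_lt (by rwa [mk_univ])
  | succ k ih =>
    have hY' : #Y ≤ 2 ^< sigma lam (k + 1) := Order.lt_succ_iff.1 hY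
    cases k with
    | zero => exact hasBadColoring_two_powerlt hlam h hY'
    | succ k =>
      set τ := 2 ^< sigma lam (k + 1) with hτ
      have hστ : sigma lam (k + 1 + 1) = Order.succ τ := rfl
      rw [hστ, powerlt_succ two_ne_zero] at hY'
      have hτ0 : ℵ₀ ≤ τ := (sigma_isRegular hlam (k + 1)).1.aleph0_le.trans (le_two_powerlt _)
      have hne : Nonempty τ.ord.ToType := nonempty_ord_toType (aleph0_pos.trans_le hτ0).ne'
      obtain ⟨x⟩ := Cardinal.eq.1 (mk_ord_toType #(Set τ.ord.ToType))
      refine (hasBadColoring_succ hlam (by omega : 2 ≤ k + 1 + 1) (ih (by omega) (Y := τ.ord.ToType)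
        ?_) x.injective).of_card_le hlam ?_
      · rw [hστ, mk_ord_toType]; exact Order.lt_succ τ
      · rw [mk_univ, mk_ord_toType, mk_set, mk_ord_toType]
        exact hY'

/-! ### Order types and positions in sets of ordinals -/

theorem otp_inter_Iio {a : Set Ordinal.{u}} {α : Ordinal.{u}} (h : α ∈ a) :
    otp (a ∩ Iio α) = Ordinal.typein (fun x y : a => x < y) ⟨α, h⟩ := by
  rw [← Ordinal.type_subrel]
  refine RelIso.ordinalType_congr ⟨⟨fun x => ⟨⟨x.1, x.2.1⟩, x.2.2⟩,
    fun x => ⟨x.1.1, x.1.2, x.2⟩, fun _ => rfl, fun _ => rfl⟩, Iff.rfl⟩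

theorem card_otp (a : Set Ordinal.{u}) : (otp a).card = #a := Ordinal.card_type _

theorem isNth_iff {a : Set Ordinal.{u}} {i : Ordinal.{u + 1}} {α : Ordinal.{u}} :
    IsNth a i α ↔ ∃ h : α ∈ a, Ordinal.typein (fun x y : a => x < y) ⟨α, h⟩ = i := by
  constructor
  · rintro ⟨h, rfl⟩; exact ⟨h, (otp_inter_Iio h).symm⟩
  · rintro ⟨h, rfl⟩; exact ⟨h, otp_inter_Iio h⟩

theorem IsNth.lt_otp {a : Set Ordinal.{u}} {i : Ordinal.{u + 1}} {α : Ordinal.{u}}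
    (h : IsNth a i α) : i < otp a := by
  obtain ⟨h, rfl⟩ := isNth_iff.1 h
  exact Ordinal.typein_lt_type _ _

theorem exists_isNth {a : Set Ordinal.{u}} {i : Ordinal.{u + 1}} (h : i < otp a) :
    ∃ α, IsNth a i α := by
  obtain ⟨x, hx⟩ := Ordinal.typein_surj _ h
  exact ⟨x.1, isNth_iff.2 ⟨x.2, hx⟩⟩

theorem IsNth.point_unique {a : Set Ordinal.{u}} {i : Ordinal.{u + 1}} {α β : Ordinal.{u}}
    (h : IsNth a i α) (h' : IsNth a i β) : α = β := by
  obtain ⟨h1, h2⟩ := isNth_iff.1 h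
  obtain ⟨h3, h4⟩ := isNth_iff.1 h'
  exact congrArg Subtype.val (Ordinal.typein_injective _ (h2.trans h4.symm))

theorem isNth_of_mem {a : Set Ordinal.{u}} {α : Ordinal.{u}} (h : α ∈ a) :
    IsNth a (otp (a ∩ Iio α)) α := ⟨h, rfl⟩

/-! ### Transfer along strictly monotone maps into the ordinals. -/

section Images

variable {W : Type u} [LinearOrder W] {f : W → Ordinal.{u}}

theorem mk_image_strictMono (hf : StrictMono f) (H : Set W) : #(f '' H) = lift.{u + 1} #H := by
  have := mk_image_eq_lift f H hf.injective
  rwa [lift_id'.{u, u + 1}] at this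

theorem otp_image (hf : StrictMono f) (b : Finset W) : otp (f '' ↑b) = (b.card : Ordinal) := by
  rw [← Ordinal.card_eq_nat, card_otp, mk_image_strictMono hf]
  simp

theorem image_inter_Iio (hf : StrictMono f) (b : Finset W) (x : W) :
    f '' ↑b ∩ Iio (f x) = f '' ↑(b.filter (· < x)) := by
  ext α
  constructor
  · rintro ⟨⟨y, hy, rfl⟩, h⟩
    exact ⟨y, Finset.mem_coe.2 (Finset.mem_filter.2 ⟨hy, hf.lt_iff_lt.1 h⟩), rfl⟩
  · rintro ⟨y, hy, rfl⟩
    obtain ⟨h1, h2⟩ := Finset.mem_filter.1 (Finset.mem_coe.1 hy)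
    exact ⟨⟨y, h1, rfl⟩, hf h2⟩

theorem otp_image_inter_Iio (hf : StrictMono f) (b : Finset W) (x : W) :
    otp (f '' ↑b ∩ Iio (f x)) = (pos b x : Ordinal) := by
  rw [image_inter_Iio hf, otp_image hf, pos]

theorem isNth_image (hf : StrictMono f) {b : Finset W} {i : Ordinal.{u + 1}} {α : Ordinal.{u}} :
    IsNth (f '' ↑b) i α ↔ ∃ x ∈ b, f x = α ∧ (pos b x : Ordinal) = i := by
  constructor
  · rintro ⟨⟨x, hx, rfl⟩, rfl⟩
    exact ⟨x, hx, rfl, (otp_image_inter_Iio hf b x).symm⟩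
  · rintro ⟨x, hx, rfl, rfl⟩
    exact ⟨⟨x, hx, rfl⟩, otp_image_inter_Iio hf b x⟩

theorem aligned_image (hf : StrictMono f) {a b : Finset W} :
    Aligned (f '' ↑a) (f '' ↑b) ↔ FAligned a b := by
  rw [Aligned, FAligned, otp_image hf, otp_image hf, Nat.cast_inj]
  refine and_congr_right fun _ => ⟨fun h x hxa hxb => ?_, ?_⟩
  · have := h (f x) ⟨⟨x, hxa, rfl⟩, ⟨x, hxb, rfl⟩⟩
    rwa [otp_image_inter_Iio hf, otp_image_inter_Iio hf, Nat.cast_inj] at this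
  · rintro h _ ⟨⟨x, hxa, rfl⟩, ⟨y, hyb, hxy⟩⟩
    obtain rfl := hf.injective hxy
    rw [otp_image_inter_Iio hf, otp_image_inter_Iio hf, h y hxa hyb]

theorem commonPos_image (hf : StrictMono f) {a b : Finset W} :
    commonPos (f '' ↑a) (f '' ↑b) = (fun k : ℕ => (k : Ordinal.{u + 1})) '' ↑(fcommonPos a b) := by
  ext i
  constructor
  · rintro ⟨-, α, hα, hαb⟩
    obtain ⟨x, hx, rfl, rfl⟩ := (isNth_image hf).1 hα
    obtain ⟨y, hy, hxy⟩ := hαb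
    obtain rfl := hf.injective hxy
    exact ⟨pos a y, Finset.mem_coe.2 (Finset.mem_image_of_mem _ (Finset.mem_inter.2 ⟨hx, hy⟩)), rfl⟩
  · rintro ⟨k, hk, rfl⟩
    obtain ⟨x, hx, rfl⟩ := Finset.mem_image.1 (Finset.mem_coe.1 hk)
    obtain ⟨hxa, hxb⟩ := Finset.mem_inter.1 hx
    have h : IsNth (f '' ↑a) (pos a x : Ordinal) (f x) := (isNth_image hf).2 ⟨x, hxa, rfl, rfl⟩
    exact ⟨h.lt_otp, f x, h, ⟨x, hxb, rfl⟩⟩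

theorem mem_subsetsOfCard_image (hf : StrictMono f) {H : Set W} {n : ℕ} {s : Set Ordinal.{u}} :
    s ∈ subsetsOfCard (f '' H) n ↔ ∃ b : Finset W, ↑b ⊆ H ∧ b.card = n ∧ f '' ↑b = s := by
  constructor
  · rintro ⟨hs, hc⟩
    obtain ⟨A, hAH, rfl⟩ := subset_image_iff.1 hs
    rw [mk_image_strictMono hf, lift_inj] at hc
    have hfin : A.Finite := by
      rw [← lt_aleph0_iff_set_finite, hc]; exact natCast_lt_aleph0
    refine ⟨hfin.toFinset, by simpa using hAH, ?_, by simp⟩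
    have : (hfin.toFinset.card : Cardinal.{u}) = n := by
      rw [← hc, ← Cardinal.mk_coe_finset]; simp
    exact_mod_cast this
  · rintro ⟨b, hb, rfl, rfl⟩
    refine ⟨image_mono hb, ?_⟩
    rw [mk_image_strictMono hf]; simp

theorem mem_subsetsOfCard_image' (hf : StrictMono f) {A H : Set W} {c : Cardinal.{u}} :
    f '' H ∈ subsetsOfCard (f '' A) c ↔ H ⊆ A ∧ #H = c := by
  rw [subsetsOfCard, mem_ofPred_eq, mk_image_strictMono hf, lift_inj,
    image_subset_image_iff hf.injective]

theorem pos_tail {a : Finset W} {x y : W} (h : x ≤ y) :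
    pos a y = pos a x + pos (a.filter (x ≤ ·)) y := by
  rw [pos, pos, pos, ← Finset.card_union_of_disjoint]
  · congr 1
    ext z
    simp only [Finset.mem_filter, Finset.mem_union]
    constructor
    · rintro ⟨h1, h2⟩
      rcases lt_or_ge z x with h3 | h3
      · exact Or.inl ⟨h1, h3⟩
      · exact Or.inr ⟨⟨h1, h3⟩, h2⟩
    · rintro (⟨h1, h2⟩ | ⟨⟨h1, -⟩, h2⟩)
      · exact ⟨h1, h2.trans_le h⟩
      · exact ⟨h1, h2⟩
  · refine Finset.disjoint_left.2 fun z hz hz' => ?_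
    simp only [Finset.mem_filter] at hz hz'
    exact hz.2.not_ge hz'.1.2

theorem pos_le_pos_iff {a : Finset W} {x y : W} (hy : y ∈ a) : pos a x ≤ pos a y ↔ x ≤ y := by
  constructor
  · intro h
    by_contra! hlt
    exact (pos_lt_pos hy hlt).not_ge h
  · intro h
    refine Finset.card_le_card fun z hz => ?_
    rw [Finset.mem_filter] at hz ⊢
    exact ⟨hz.1, hz.2.trans_le h⟩

theorem subAt_tail (hf : StrictMono f) {a : Finset W} (x : W) :
    subAt (f '' ↑a) (Iio (otp (f '' ↑a)) \ Iio (pos a x : Ordinal)) =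
      f '' ↑(a.filter (x ≤ ·)) := by
  ext α
  constructor
  · rintro ⟨i, ⟨-, hi⟩, hα⟩
    obtain ⟨y, hy, rfl, rfl⟩ := (isNth_image hf).1 hα
    rw [mem_Iio, Nat.cast_lt, not_lt, pos_le_pos_iff hy] at hi
    exact ⟨y, Finset.mem_coe.2 (Finset.mem_filter.2 ⟨hy, hi⟩), rfl⟩
  · rintro ⟨y, hy, rfl⟩
    obtain ⟨hya, hxy⟩ := Finset.mem_filter.1 (Finset.mem_coe.1 hy)
    have h : IsNth (f '' ↑a) (pos a y : Ordinal) (f y) := (isNth_image hf).2 ⟨y, hya, rfl, rfl⟩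
    refine ⟨_, ⟨h.lt_otp, ?_⟩, h⟩
    rw [mem_Iio, Nat.cast_lt, not_lt, pos_le_pos_iff hya]
    exact hxy

/-- Positions in `a` and in `b` are positions in the tails from `x` on, shifted by the same amount.
-/
theorem alignedAbove_image (hf : StrictMono f) {a b : Finset W} {x : W}
    (hpos : pos a x = pos b x) (h : AlignedAbove (pos a x : Ordinal) (f '' ↑a) (f '' ↑b)) :
    ∀ y ∈ a, y ∈ b → x ≤ y → pos a y = pos b y := by
  intro y hya hyb hxy
  rw [AlignedAbove, subAt_tail hf, hpos, subAt_tail hf, aligned_image hf] at h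
  have := h.2 y (Finset.mem_filter.2 ⟨hya, hxy⟩) (Finset.mem_filter.2 ⟨hyb, hxy⟩)
  rw [pos_tail (a := a) hxy, pos_tail (a := b) hxy, this, hpos]

theorem exists_pos_eq {a : Finset W} {k : ℕ} (h : k < a.card) : ∃ x ∈ a, pos a x = k := by
  have : k ∈ a.image (pos a) := by rw [image_pos]; exact Finset.mem_range.2 h
  exact Finset.mem_image.1 this

/-- `Possible` compares `α` only with the two neighbours of `x`; every other element lies beyond one
of these. -/
theorem possible_image (hf : StrictMono f) {a : Finset W} {x α : W} (hx : x ∈ a)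
    (h : Possible (pos a x) (f '' ↑a) (f α)) : FPossible a x α := by
  intro y hy
  constructor
  · intro hyx
    have hlt := pos_lt_pos hy hyx
    obtain ⟨z, hz, hzk⟩ := exists_pos_eq (a := a) (k := pos a x - 1)
      (by have := pos_lt_card hx; omega)
    have h1 := h.1 (by omega) (f z) ((isNth_image hf).2 ⟨z, hz, rfl, by rw [hzk]⟩)
    have hyz : y ≤ z := (pos_le_pos_iff hz).1 (by omega)
    exact hyz.trans_lt (hf.lt_iff_lt.1 h1)
  · intro hxy
    have hlt := pos_lt_pos hx hxy
    have hyc := pos_lt_card hy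
    obtain ⟨z, hz, hzk⟩ := exists_pos_eq (a := a) (k := pos a x + 1) (by omega)
    have h1 := h.2 (by rw [otp_image hf, Nat.cast_lt]; omega) (f z)
      ((isNth_image hf).2 ⟨z, hz, rfl, by rw [hzk]⟩)
    have hzy : z ≤ y := (pos_le_pos_iff hy).1 (by omega)
    exact (hf.lt_iff_lt.1 h1).trans_le hzy

theorem replaceAt_image (hf : StrictMono f) {a : Finset W} {x α : W} (hx : x ∈ a) :
    replaceAt (pos a x) (f '' ↑a) (f α) = f '' ↑(insert α (a.erase x)) := by
  ext β
  simp only [replaceAt, mem_union, mem_sdiff, mem_ofPred_eq, mem_singleton_iff]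
  constructor
  · rintro (⟨⟨y, hy, rfl⟩, hn⟩ | rfl)
    · refine ⟨y, Finset.mem_coe.2 (Finset.mem_insert_of_mem (Finset.mem_erase.2 ⟨?_, hy⟩)), rfl⟩
      rintro rfl
      exact hn ((isNth_image hf).2 ⟨y, hy, rfl, rfl⟩)
    · exact ⟨α, Finset.mem_coe.2 (Finset.mem_insert_self _ _), rfl⟩
  · rintro ⟨y, hy, rfl⟩
    rcases Finset.mem_insert.1 (Finset.mem_coe.1 hy) with rfl | hy
    · exact Or.inr rfl
    · obtain ⟨hne, hya⟩ := Finset.mem_erase.1 hy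
      refine Or.inl ⟨⟨y, hya, rfl⟩, fun hn => hne ?_⟩
      obtain ⟨z, hz, h1, h2⟩ := (isNth_image hf).1 hn
      obtain rfl := hf.injective h1
      exact pos_injOn a hz hx (by exact_mod_cast h2)

end Images

/-! ### Labelling small sets of ordinals -/

/-- The ordinal position corresponding to `i : κ.ord.ToType`. -/
noncomputable def label {κ : Cardinal.{u}} (i : κ.ord.ToType) : Ordinal.{u + 1} :=
  Ordinal.lift.{u + 1} (Ordinal.typein (α := κ.ord.ToType) (· < ·) i)

theorem label_injective {κ : Cardinal.{u}} : Function.Injective (label (κ := κ)) := fun _ _ h =>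
  Ordinal.typein_injective _ (Ordinal.lift_inj.1 h)

open Classical in
/-- The enumeration of a set of ordinals, with labels in `κ.ord.ToType`. -/
noncomputable def enumeration (κ : Cardinal.{u}) (A : Set Ordinal.{u}) (i : κ.ord.ToType) :
    Option Ordinal.{u} :=
  if h : #A < lift.{u + 1} κ ∧ ∃ α, IsNth A (label i) α then some h.2.choose else none

section Enumeration

variable {κ : Cardinal.{u}} {A B : Set Ordinal.{u}}

theorem enumeration_eq_some (hA : #A < lift.{u + 1} κ) {i : κ.ord.ToType} {α : Ordinal.{u}} :
    enumeration κ A i = some α ↔ IsNth A (label i) α := by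
  unfold enumeration
  split_ifs with h
  · rw [Option.some_inj]
    exact ⟨fun e => e ▸ h.2.choose_spec, fun h' => h.2.choose_spec.point_unique h'⟩
  · simp only [false_iff]
    exact fun h' => h ⟨hA, α, h'⟩

theorem hit_enumeration (hA : #A < lift.{u + 1} κ) (hB : #B < lift.{u + 1} κ)
    {i j : κ.ord.ToType} : Hit (enumeration κ A) (enumeration κ B) i j ↔
      ∃ α, IsNth A (label i) α ∧ IsNth B (label j) α := by
  simp only [Hit, enumeration_eq_some hA, enumeration_eq_some hB]

theorem exists_label_eq (hA : #A < lift.{u + 1} κ) {p : Ordinal.{u + 1}} (hp : p < otp A) :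
    ∃ i : κ.ord.ToType, label i = p := by
  have h1 : otp A < Ordinal.lift.{u + 1} κ.ord := by
    rw [lift_ord, lt_ord, card_otp]; exact hA
  obtain ⟨q, hq, rfl⟩ := Ordinal.lt_lift_iff.1 (hp.trans h1)
  obtain ⟨i, rfl⟩ := Ordinal.typein_surj (fun x y : κ.ord.ToType => x < y)
    (by rw [Ordinal.type_toType]; exact hq)
  exact ⟨i, rfl⟩

theorem mem_labels_enumeration (hA : #A < lift.{u + 1} κ) {i : κ.ord.ToType} :
    i ∈ labels (enumeration κ A) ↔ label i < otp A := by
  rw [labels, mem_ofPred_eq, hit_enumeration hA hA]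
  constructor
  · rintro ⟨α, h, -⟩; exact h.lt_otp
  · intro h
    obtain ⟨α, hα⟩ := exists_isNth h
    exact ⟨α, hα, hα⟩

theorem labelInjective_enumeration (A : Set Ordinal.{u}) : LabelInjective (enumeration κ A) := by
  intro i j hij
  by_cases hA : #A < lift.{u + 1} κ
  · obtain ⟨α, h1, h2⟩ := (hit_enumeration hA hA).1 hij
    exact label_injective (h1.2.symm.trans h2.2)
  · obtain ⟨x, hx, -⟩ := hij
    simp [enumeration, hA] at hx

/-- A set of size at least `κ` is enumerated by `none` throughout. This default gives the bound for
every `A`, as the total families of `uniformization` require. -/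
theorem mk_labels_enumeration_lt (hκ : κ ≠ 0) (A : Set Ordinal.{u}) :
    #(labels (enumeration κ A)) < κ := by
  by_cases hA : #A < lift.{u + 1} κ
  · rw [← lift_lt.{u, u + 1}]
    refine lt_of_le_of_lt ?_ hA
    choose x hx using fun i : labels (enumeration κ A) => i.2
    have hinj : Function.Injective fun i : labels (enumeration κ A) => (⟨x i,
        ((enumeration_eq_some hA).1 (hx i).1).1⟩ : A) := by
      intro i j h
      have h : x i = x j := congrArg Subtype.val h
      have h1 := ((enumeration_eq_some hA).1 (hx i).1).2
      have h2 := ((enumeration_eq_some hA).1 (hx j).1).2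
      rw [h] at h1
      exact Subtype.ext (label_injective (h1.symm.trans h2))
    have := lift_mk_le'.2 ⟨⟨_, hinj⟩⟩
    rwa [lift_id'.{u, u + 1}] at this
  · have : labels (enumeration κ A) = ∅ := by
      rw [eq_empty_iff_forall_notMem]
      rintro i ⟨x, hx, -⟩
      simp [enumeration, hA] at hx
    rw [this, mk_eq_zero]
    exact pos_iff_ne_zero.2 hκ

theorem otp_eq_of_labels_eq (hA : #A < lift.{u + 1} κ) (hB : #B < lift.{u + 1} κ)
    (h : labels (enumeration κ A) = labels (enumeration κ B)) : otp A = otp B := by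
  have key : ∀ {A B : Set Ordinal.{u}}, #A < lift.{u + 1} κ → #B < lift.{u + 1} κ →
      labels (enumeration κ A) = labels (enumeration κ B) → otp A ≤ otp B := by
    intro A B hA hB h
    refine le_of_forall_lt fun p hp => ?_
    obtain ⟨i, rfl⟩ := exists_label_eq hA hp
    rwa [← mem_labels_enumeration hB, ← h, mem_labels_enumeration hA]
  exact le_antisymm (key hA hB h) (key hB hA h.symm)

theorem mem_tpInt (hA : #A < lift.{u + 1} κ) (hB : #B < lift.{u + 1} κ)
    {p : Ordinal.{u + 1} × Ordinal.{u + 1}} : p ∈ tpInt A B ↔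
      ∃ i j, p = (label i, label j) ∧ Hit (enumeration κ A) (enumeration κ B) i j := by
  obtain ⟨p, q⟩ := p
  simp only [hit_enumeration hA hB]
  constructor
  · rintro ⟨hp, hq, α, h1, h2⟩
    obtain ⟨i, rfl⟩ := exists_label_eq hA hp
    obtain ⟨j, rfl⟩ := exists_label_eq hB hq
    exact ⟨i, j, rfl, α, h1, h2⟩
  · rintro ⟨i, j, h, α, h1, h2⟩
    obtain ⟨rfl, rfl⟩ := Prod.mk.inj h
    exact ⟨h1.lt_otp, h2.lt_otp, α, h1, h2⟩

end Enumeration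
/-! ### The ordinals below a cardinal -/

section Ordinals

/-- The ordinal represented by an element of `μ.ord.ToType`. -/
noncomputable def toOrd (μ : Cardinal.{u}) (w : μ.ord.ToType) : Ordinal.{u} :=
  Ordinal.typein (α := μ.ord.ToType) (· < ·) w

variable {μ : Cardinal.{u}}

theorem toOrd_strictMono : StrictMono (toOrd μ) := fun _ _ h =>
  (Ordinal.typein_lt_typein _).2 h

theorem toOrd_lt (w : μ.ord.ToType) : toOrd _ w < μ.ord := by
  have := Ordinal.typein_lt_type (fun x y : μ.ord.ToType => x < y) w
  rwa [Ordinal.type_toType] at this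

theorem exists_toOrd_eq {α : Ordinal.{u}} (h : α < μ.ord) : ∃ w : μ.ord.ToType, toOrd _ w = α :=
  Ordinal.typein_surj (fun x y : μ.ord.ToType => x < y) (by rwa [Ordinal.type_toType])

theorem image_toOrd_univ : toOrd μ '' (univ : Set μ.ord.ToType) = Iio μ.ord := by
  ext α
  constructor
  · rintro ⟨w, -, rfl⟩; exact toOrd_lt w
  · intro h
    obtain ⟨w, rfl⟩ := exists_toOrd_eq h
    exact ⟨w, trivial, rfl⟩

theorem mem_subsetsOfCard_iff {n : ℕ} {s : Set Ordinal.{u}} : s ∈ subsetsOfCard (Iio μ.ord) n ↔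
    ∃ b : Finset μ.ord.ToType, b.card = n ∧ toOrd μ '' ↑b = s := by
  rw [← image_toOrd_univ, mem_subsetsOfCard_image toOrd_strictMono]
  simp

theorem image_mem_subsetsOfCard {H : Set μ.ord.ToType} {c : Cardinal.{u}} (hH : #H = c) :
    toOrd μ '' H ∈ subsetsOfCard (Iio μ.ord) c := by
  rw [← image_toOrd_univ, mem_subsetsOfCard_image' toOrd_strictMono]
  exact ⟨subset_univ _, hH⟩

theorem exists_image_eq_of_mem_subsetsOfCard {s : Set Ordinal.{u}} {c : Cardinal.{u}}
    (hs : s ∈ subsetsOfCard (Iio μ.ord) c) : ∃ H : Set μ.ord.ToType, #H = c ∧ toOrd μ '' H = s := by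
  obtain ⟨H, -, rfl⟩ := subset_image_iff.1 (image_toOrd_univ (μ := μ) ▸ hs.1)
  exact ⟨H, (lift_inj.1 ((mk_image_strictMono toOrd_strictMono H).symm.trans hs.2)), rfl⟩

theorem subsetsOfCard_mono {H H' : Set Ordinal.{u}} (h : H ⊆ H') (c : Cardinal.{u}) :
    subsetsOfCard H c ⊆ subsetsOfCard H' c := fun _ hs => ⟨hs.1.trans h, hs.2⟩

theorem mk_eq_of_image_toOrd : #(univ : Set μ.ord.ToType) = μ := by
  rw [mk_univ, mk_ord_toType]

end Ordinals

/-! ### Partition relations -/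

theorem lt_two_ord {α : Ordinal.{u}} : α < (2 : Cardinal.{u}).ord ↔ α = 0 ∨ α = 1 := by
  have h : (2 : Cardinal.{u}).ord = Order.succ 1 := by
    rw [Order.succ_eq_add_one, one_add_one_eq_two]
    exact_mod_cast ord_natCast 2
  rw [h, Order.lt_succ_iff, Order.le_one_iff]

theorem arrow_iff {μ lam : Cardinal.{u}} {n : ℕ} :
    Arrow μ lam n 2 ↔ ¬ HasBadColoring lam n (univ : Set μ.ord.ToType) := by
  classical
  constructor
  · rintro h ⟨c, hc⟩
    obtain ⟨s, hs, hhom⟩ := h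
      (fun s => if ∃ b : Finset μ.ord.ToType, toOrd μ '' ↑b = s ∧ c b then 0 else 1)
      (fun s _ => by
        rw [lt_two_ord]
        dsimp only
        split_ifs
        · exact Or.inl rfl
        · exact Or.inr rfl)
    obtain ⟨H, hH, rfl⟩ := exists_image_eq_of_mem_subsetsOfCard hs
    obtain ⟨⟨b, hb, hbn, hcb⟩, b', hb', hbn', hcb'⟩ := hc H (subset_univ _) hH.ge
    have := hhom _ ((mem_subsetsOfCard_image toOrd_strictMono).2 ⟨b, hb, hbn, rfl⟩)
      _ ((mem_subsetsOfCard_image toOrd_strictMono).2 ⟨b', hb', hbn', rfl⟩)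
    dsimp only at this
    rw [if_pos ⟨b, rfl, hcb⟩, if_neg] at this
    · exact zero_ne_one this
    · rintro ⟨d, hd, hcd⟩
      rw [Finset.coe_injective (toOrd_strictMono.injective.image_injective hd)] at hcd
      exact hcb' hcd
  · intro h c hc
    by_contra! hno
    refine h ⟨fun b => c (toOrd μ '' ↑b) = 0, fun H _ hH => ?_⟩
    obtain ⟨H', hH'H, hH'⟩ := le_mk_iff_exists_subset.1 hH
    have hmem := image_mem_subsetsOfCard hH'
    have hn := hno _ hmem
    rw [Homogeneous] at hn
    push Not at hn
    obtain ⟨s, hs, s', hs', hne⟩ := hn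
    have h1 := lt_two_ord.1 (hc s (subsetsOfCard_mono hmem.1 _ hs))
    have h2 := lt_two_ord.1 (hc s' (subsetsOfCard_mono hmem.1 _ hs'))
    obtain ⟨b, hb, hbn, rfl⟩ := (mem_subsetsOfCard_image toOrd_strictMono).1 hs
    obtain ⟨b', hb', hbn', rfl⟩ := (mem_subsetsOfCard_image toOrd_strictMono).1 hs'
    have hb := hb.trans hH'H
    have hb' := hb'.trans hH'H
    rcases h1 with h1 | h1 <;> rcases h2 with h2 | h2
    · exact absurd (h1.trans h2.symm) hne
    · exact ⟨⟨b, hb, hbn, h1⟩, b', hb', hbn', h2.trans_ne one_ne_zero⟩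
    · exact ⟨⟨b', hb', hbn', h2⟩, b, hb, hbn, h1.trans_ne one_ne_zero⟩
    · exact absurd (h1.trans h2.symm) hne

/-- The failure of weak compactness is exactly the bad colouring of the pairs of `lam` from which
the induction starts. -/
theorem sigma_le_of_arrow {lam μ : Cardinal.{u}} (hlam : lam.IsRegular) (hunc : ℵ₀ < lam)
    (hwc : ¬ IsWeaklyCompact lam) {n : ℕ} (hn : 1 ≤ n) (h : Arrow μ lam n 2) : sigma lam n ≤ μ := by
  by_contra! hlt
  refine arrow_iff.1 h (hasBadColoring_of_lt_sigma hlam ?_ hn (by rwa [mk_ord_toType]))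
  by_contra hbad
  exact hwc ⟨hunc, arrow_iff.2 hbad⟩

theorem arrow_of_arrowOrd {lam μ : Cardinal.{u}} (hlam : ℵ₀ ≤ lam) {n : ℕ} (k : ℕ)
    (h : ArrowOrd μ (lam.ord + (k : Ordinal.{u})) n 2) : Arrow μ lam n 2 := by
  intro c hc
  obtain ⟨H, hH, hotp, hhom⟩ := h c hc
  refine ⟨H, ⟨hH, ?_⟩, hhom⟩
  rw [← card_otp, hotp, ← Ordinal.lift_card, Ordinal.card_add, card_ord, Ordinal.card_nat,
    add_nat_eq k hlam]

theorem otp_union {a b : Set Ordinal.{u}} (h : ∀ x ∈ a, ∀ y ∈ b, x < y) :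
    otp (a ∪ b) = otp a + otp b := by
  classical
  rw [otp, otp, otp, ← Ordinal.type_sum_lex]
  have hne : ∀ x ∈ a, ∀ y ∈ b, x ≠ y := fun x hx y hy => (h x hx y hy).ne
  refine (RelIso.ordinalType_congr (RelIso.ofSurjective (RelEmbedding.ofMonotone
    (Sum.elim (fun x => ⟨x.1, Or.inl x.2⟩) fun y => ⟨y.1, Or.inr y.2⟩) ?_) ?_)).symm
  · rintro _ _ (⟨hlt⟩ | ⟨hlt⟩ | ⟨x, y⟩)
    · exact hlt
    · exact hlt
    · exact h _ x.2 _ y.2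
  · rintro ⟨x, hx | hx⟩
    · exact ⟨Sum.inl ⟨x, hx⟩, rfl⟩
    · exact ⟨Sum.inr ⟨x, hx⟩, rfl⟩

theorem otp_image_eq_ord {μ lam : Cardinal.{u}} {H : Set μ.ord.ToType} (hH : #H = lam)
    (hseg : ∀ x ∈ H, #(H ∩ Iio x : Set μ.ord.ToType) < lam) :
    otp (toOrd μ '' H) = Ordinal.lift.{u + 1} lam.ord := by
  refine le_antisymm (le_of_forall_lt fun p hp => ?_) ?_
  · obtain ⟨α, hα⟩ := exists_isNth hp
    obtain ⟨⟨x, hx, rfl⟩, rfl⟩ := hα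
    rw [lift_ord, lt_ord, card_otp]
    have : toOrd μ '' H ∩ Iio (toOrd _ x) ⊆ toOrd μ '' (H ∩ Iio x) := by
      rintro _ ⟨⟨y, hy, rfl⟩, h⟩
      exact ⟨y, ⟨hy, toOrd_strictMono.lt_iff_lt.1 h⟩, rfl⟩
    refine (mk_le_mk_of_subset this).trans_lt ?_
    rw [mk_image_strictMono toOrd_strictMono, lift_lt]
    exact hseg x hx
  · rw [lift_ord, ord_le, card_otp, mk_image_strictMono toOrd_strictMono, hH]

theorem arrowOrd_of_sigma_le {lam μ : Cardinal.{u}} (hlam : lam.IsRegular) {n : ℕ} (hn : 1 ≤ n)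
    (h : sigma lam n ≤ μ) {ν : Cardinal.{u}} (hν : ν < lam) :
    ArrowOrd μ (lam.ord + ((n - 1 : ℕ) : Ordinal.{u})) n ν := by
  classical
  intro c hc
  have hinf : ℵ₀ ≤ #μ.ord.ToType := by
    rw [mk_ord_toType]
    exact ((sigma_isRegular hlam n).1.aleph0_le).trans h
  have := infinite_iff.2 hinf
  have hcol : ∀ b : Finset μ.ord.ToType, b.card = n → ∃ w : ν.ord.ToType, toOrd _ w = c (toOrd μ '' ↑b) :=
    fun b hb => exists_toOrd_eq (hc _ (mem_subsetsOfCard_iff.2 ⟨b, hb, rfl⟩))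
  -- The colour of any `n`-set lies below `ν`, so `ν` is nonzero.
  have : Nonempty ν.ord.ToType := by
    obtain ⟨b, hb⟩ := Infinite.exists_subset_card_eq μ.ord.ToType n
    exact ⟨(hcol b hb).choose⟩
  choose! g hg using hcol
  obtain ⟨H, -, t, -, hH, hseg, ht, hlt, k, hk⟩ := erdosRado hlam hn ν.ord.ToType
    (by rwa [mk_ord_toType]) univ (by rwa [mk_eq_of_image_toOrd]) g
  refine ⟨toOrd μ '' (H ∪ ↑t), ?_, ?_, ?_⟩
  · rw [← image_toOrd_univ]; exact image_mono (subset_univ _)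
  · rw [image_union, otp_union, otp_image_eq_ord hH hseg, otp_image toOrd_strictMono, ht,
      Ordinal.lift_add, Ordinal.lift_natCast]
    rintro _ ⟨x, hx, rfl⟩ _ ⟨y, hy, rfl⟩
    exact toOrd_strictMono (hlt x hx y hy)
  · have key : ∀ s ∈ subsetsOfCard (toOrd μ '' (H ∪ ↑t)) n, c s = toOrd _ k := by
      intro s hs
      obtain ⟨b, hb, hbn, rfl⟩ := (mem_subsetsOfCard_image toOrd_strictMono).1 hs
      rw [← hg b hbn, hk b hb hbn]
    intro s hs s' hs'
    rw [key s hs, key s' hs']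

/-! ### Uniform `Δ`-systems of sets of ordinals -/

theorem UniformOn.mem_labels_iff {W I : Type u} {X : Type v} [LinearOrder W] {n : ℕ} {H : Set W}
    {u : Finset W → I → Option X} {r : Finset ℕ → Set I} (h : UniformOn n H u r) {a : Finset W}
    (ha : ↑a ⊆ H) (hn : a.card = n) {i : I} : i ∈ labels (u a) ↔ i ∈ r (Finset.range n) := by
  rw [labels, mem_ofPred_eq, h.hit a a ha ha hn hn (FAligned.refl a), fcommonPos_self, hn]
  simp

theorem uniformOn_isUniformDeltaSystem {μ κ : Cardinal.{u}} {n : ℕ} {H : Set μ.ord.ToType}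
    (hH : H.Infinite) {U : Set Ordinal.{u} → Set Ordinal.{u}} {r : Finset ℕ → Set κ.ord.ToType}
    (hU : ∀ b : Finset μ.ord.ToType, b.card = n → #(U (toOrd μ '' ↑b)) < lift.{u + 1} κ)
    (h : UniformOn n H (fun b => enumeration κ (U (toOrd μ '' ↑b))) r) :
    IsUniformDeltaSystem n (toOrd μ '' H) U := by
  classical
  obtain ⟨b₀, hb₀, hbn₀⟩ := hH.exists_subset_card_eq n
  let fin : Set Ordinal.{u + 1} → Finset ℕ := fun m => (Finset.range n).filter fun k => (k : Ordinal) ∈ m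
  have hotp : ∀ b : Finset μ.ord.ToType, ↑b ⊆ H → b.card = n →
      otp (U (toOrd μ '' ↑b)) = otp (U (toOrd μ '' ↑b₀)) := by
    intro b hb hbn
    refine otp_eq_of_labels_eq (hU b hbn) (hU b₀ hbn₀) (Set.ext fun i => ?_)
    exact (h.mem_labels_iff hb hbn).trans (h.mem_labels_iff hb₀ hbn₀).symm
  have hfin : ∀ a b : Finset μ.ord.ToType, a.card = n →
      fin (commonPos (toOrd μ '' ↑a) (toOrd μ '' ↑b)) = fcommonPos a b := by
    intro a b han
    rw [commonPos_image toOrd_strictMono]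
    ext k
    simp only [fin, Finset.mem_filter, Finset.mem_range, mem_image, Finset.mem_coe, Nat.cast_inj,
      exists_eq_right, and_iff_right_iff_imp]
    intro hk
    obtain ⟨x, hx, rfl⟩ := Finset.mem_image.1 hk
    rw [← han]
    exact pos_lt_card (Finset.mem_inter.1 hx).1
  -- `r (Finset.range n)` is the common label set of the family; intersecting with it places the
  -- roots inside `ρ` directly.
  refine ⟨otp (U (toOrd μ '' ↑b₀)), fun m => label '' (r (fin m) ∩ r (Finset.range n)), ?_, ?_, ?_, ?_⟩
  · rintro m - _ ⟨i, ⟨-, hi⟩, rfl⟩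
    exact (mem_labels_enumeration (hU b₀ hbn₀)).1 ((h.mem_labels_iff hb₀ hbn₀).2 hi)
  · intro s hs
    obtain ⟨b, hb, hbn, rfl⟩ := (mem_subsetsOfCard_image toOrd_strictMono).1 hs
    exact hotp b hb hbn
  · intro s hs s' hs' m _ hal hm
    obtain ⟨a, ha, han, rfl⟩ := (mem_subsetsOfCard_image toOrd_strictMono).1 hs
    obtain ⟨b, hb, hbn, rfl⟩ := (mem_subsetsOfCard_image toOrd_strictMono).1 hs'
    have hhit := h.hit a b ha hb han hbn ((aligned_image toOrd_strictMono).1 hal)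
    subst hm
    dsimp only
    rw [hfin a b han]
    simp only [hit_enumeration (hU a han) (hU b hbn)] at hhit
    refine ⟨⟨(hotp a ha han).trans (hotp b hb hbn).symm, ?_⟩, ?_⟩
    · rintro γ ⟨hγa, hγb⟩
      have h1 := isNth_of_mem hγa
      have h2 := isNth_of_mem hγb
      obtain ⟨i, hi⟩ := exists_label_eq (hU a han) h1.lt_otp
      obtain ⟨j, hj⟩ := exists_label_eq (hU b hbn) h2.lt_otp
      rw [← hi, ← hj, ((hhit i j).1 ⟨γ, by rwa [hi], by rwa [hj]⟩).1]
    · ext p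
      constructor
      · rintro ⟨hp, γ, hγ, hγb⟩
        have h2 := isNth_of_mem hγb
        obtain ⟨i, rfl⟩ := exists_label_eq (hU a han) hp
        obtain ⟨j, hj⟩ := exists_label_eq (hU b hbn) h2.lt_otp
        exact ⟨i, ⟨((hhit i j).1 ⟨γ, hγ, by rwa [hj]⟩).2, (h.mem_labels_iff ha han).1
          ((mem_labels_enumeration (hU a han)).2 hp)⟩, rfl⟩
      · rintro ⟨i, ⟨hi, -⟩, rfl⟩
        obtain ⟨γ, h1, h2⟩ := (hhit i i).2 ⟨rfl, hi⟩
        exact ⟨h1.lt_otp, γ, h1, h2.1⟩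
  · intro m₀ _ m₁ _
    have : fin (m₀ ∩ m₁) = fin m₀ ∩ fin m₁ := by
      ext k
      simp only [fin, Finset.mem_filter, Finset.mem_inter, mem_inter_iff]
      tauto
    dsimp only
    rw [← image_inter label_injective, this, h.inter, inter_inter_distrib_right]

theorem FReplacementInvariant.replacementInvariant {μ κ : Cardinal.{u}} {n : ℕ}
    {H : Set μ.ord.ToType} {U : Set Ordinal.{u} → Set Ordinal.{u}}
    (hU : ∀ b : Finset μ.ord.ToType, b.card = n → #(U (toOrd μ '' ↑b)) < lift.{u + 1} κ)
    (h : FReplacementInvariant n H fun b => enumeration κ (U (toOrd μ '' ↑b))) :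
    ReplacementInvariant n (toOrd μ '' H) U := by
  intro s hs s' hs' m hm hal ⟨γ, hγ, hγ'⟩ α hα hp hp'
  obtain ⟨a, ha, han, rfl⟩ := (mem_subsetsOfCard_image toOrd_strictMono).1 hs
  obtain ⟨b, hb, hbn, rfl⟩ := (mem_subsetsOfCard_image toOrd_strictMono).1 hs'
  obtain ⟨x, hxa, rfl, hxm⟩ := (isNth_image toOrd_strictMono).1 hγ
  obtain ⟨y, hxb, hxy, hym⟩ := (isNth_image toOrd_strictMono).1 hγ'
  obtain rfl := toOrd_strictMono.injective hxy
  obtain ⟨w, hw, rfl⟩ := hα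
  rw [Nat.cast_inj] at hxm hym
  subst hxm
  have hpa := possible_image toOrd_strictMono hxa hp
  have hra := replaceAt_image toOrd_strictMono (α := w) hxa
  have hrb := replaceAt_image toOrd_strictMono (α := w) hxb
  rw [hym] at hrb
  have hpb := possible_image toOrd_strictMono hxb (by rwa [hym])
  have hcard : ∀ {a : Finset μ.ord.ToType}, y ∈ a → a.card = n → FPossible a y w →
      (insert w (a.erase y)).card = n := by
    intro a hya han hp
    rw [Finset.card_insert_of_notMem, Finset.card_erase_add_one hya, han]
    intro hw
    obtain ⟨hne, hwa⟩ := Finset.mem_erase.1 hw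
    rcases lt_or_gt_of_ne hne with hlt | hlt
    · exact lt_irrefl _ ((hp w hwa).1 hlt)
    · exact lt_irrefl _ ((hp w hwa).2 hlt)
  ext p
  rw [hra, hrb, mem_tpInt (hU a han) (hU b hbn), mem_tpInt (hU _ (hcard hxa han hpa))
    (hU _ (hcard hxb hbn hpb))]
  have := h a b ha hb han hbn y hxa hxb
    (alignedAbove_image toOrd_strictMono hym.symm hal) w hw hpa hpb
  simp only [this]

theorem exists_uniformDeltaSystem_of_sigma_le {lam μ : Cardinal.{u}} (hlam : lam.IsRegular)
    (hunc : ℵ₀ < lam) {n : ℕ} (hn : 1 ≤ n) (h : sigma lam n ≤ μ) {κ ν : Cardinal.{u}}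
    {g : Set Ordinal.{u} → Ordinal.{u}} {U : Set Ordinal.{u} → Set Ordinal.{u}} (hκ0 : ℵ₀ ≤ κ)
    (hν0 : ℵ₀ ≤ ν) (hν : ν < lam) (hκ : LTInaccessible κ lam) (hg : IsColoring μ n ν g)
    (hU : ∀ b ∈ subsetsOfCard (Iio μ.ord) n, #(U b) < lift.{u + 1} κ) :
    ∃ H ∈ subsetsOfCard (Iio μ.ord) lam, ∃ k < ν.ord, (∀ b ∈ subsetsOfCard H n, g b = k) ∧
      IsUniformDeltaSystem n H U ∧ ReplacementInvariant n H U := by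
  have : Nonempty ν.ord.ToType := by
    rw [← mk_ne_zero_iff, mk_ord_toType]
    exact (aleph0_pos.trans_le hν0).ne'
  have hcol : ∀ b : Finset μ.ord.ToType, b.card = n → ∃ w : ν.ord.ToType, toOrd _ w = g (toOrd μ '' ↑b) :=
    fun b hb => exists_toOrd_eq (hg _ (mem_subsetsOfCard_iff.2 ⟨b, hb, rfl⟩))
  choose! c hc using hcol
  have hU' : ∀ b : Finset μ.ord.ToType, b.card = n → #(U (toOrd μ '' ↑b)) < lift.{u + 1} κ :=
    fun b hb => hU _ (mem_subsetsOfCard_iff.2 ⟨b, hb, rfl⟩)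
  obtain ⟨H, -, hH, ⟨k, hk⟩, ⟨r, hr⟩, hrep⟩ := uniformization hlam hunc hκ
    (I := κ.ord.ToType) (X := Ordinal.{u}) (by rw [mk_ord_toType]; exact hκ.1) hn ν.ord.ToType
    (by rwa [mk_ord_toType]) univ (by rwa [mk_eq_of_image_toOrd])
    (fun b : Finset μ.ord.ToType => enumeration κ (U (toOrd μ '' ↑b)))
    (fun b => mk_labels_enumeration_lt (aleph0_pos.trans_le hκ0).ne' _)
    (fun b => labelInjective_enumeration _) c
  have hinf : H.Infinite := by
    rw [← infinite_coe_iff, infinite_iff, hH]; exact hunc.le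
  refine ⟨toOrd μ '' H, image_mem_subsetsOfCard hH, toOrd _ k, toOrd_lt k, ?_,
    uniformOn_isUniformDeltaSystem hinf hU' hr, hrep.replacementInvariant hU'⟩
  intro s hs
  obtain ⟨b, hb, hbn, rfl⟩ := (mem_subsetsOfCard_image toOrd_strictMono).1 hs
  rw [← hc b hbn, hk b hb hbn]

theorem ltInaccessible_aleph0 {lam : Cardinal.{u}} (hunc : ℵ₀ < lam) : LTInaccessible ℵ₀ lam :=
  ⟨hunc, fun _ hθ => (powerlt_aleph0_le _).trans_lt (max_lt hθ hunc)⟩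

/-! ### `Δ`-systems of finite sets -/

section Finite

variable {W I : Type u} {X : Type v} [LinearOrder W]

theorem pos_image {K : Type*} [LinearOrder K] {b : Finset W} {g : W → K} (hg : StrictMonoOn g b)
    {x : W} (hx : x ∈ b) : pos (b.image g) (g x) = pos b x := by
  rw [pos, pos, Finset.filter_image, Finset.card_image_of_injOn
    (hg.injOn.mono (Finset.coe_subset.2 (Finset.filter_subset _ _)))]
  congr 1
  exact Finset.filter_congr fun y hy => hg.lt_iff_lt hy hx

theorem pos_strictMonoOn (b : Finset W) : StrictMonoOn (pos b) b := fun _ hx _ _ h =>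
  pos_lt_pos hx h

/-- If `d` lies in `b` and `c` at the same set of positions, each of its elements has the same
position in `b` and `c`. -/
theorem pos_eq_pos_of_image_eq {b c d : Finset W} (hb : d ⊆ b) (hc : d ⊆ c)
    (h : d.image (pos b) = d.image (pos c)) {x : W} (hx : x ∈ d) : pos b x = pos c x := by
  refine pos_injOn (d.image (pos b)) (Finset.mem_coe.2 (Finset.mem_image_of_mem _ hx))
    (Finset.mem_coe.2 (h ▸ Finset.mem_image_of_mem _ hx)) ?_
  rw [pos_image ((pos_strictMonoOn b).mono (Finset.coe_subset.2 hb)) hx, h,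
    pos_image ((pos_strictMonoOn c).mono (Finset.coe_subset.2 hc)) hx]

/-- Inside a subset of `A` without last element, choose greedily points that are not the immediate
successor of an earlier choice. The omitted successors fill the gaps. -/
theorem exists_gap_subset [WellFoundedLT W] {lam : Cardinal.{u}} (hlam : lam.IsRegular) {A : Set W}
    (hA : lam ≤ #A) : ∃ H ⊆ A, #H = lam ∧
      ∀ x ∈ H, ∃ z ∈ A, z ∉ H ∧ x < z ∧ ∀ y ∈ H, x < y → z < y := by
  obtain ⟨A₁, hA₁, hcard, hunb⟩ := exists_subset_unbounded hlam hA
  have hnext : ∀ x ∈ A₁, ∃ z ∈ A₁, x < z ∧ ∀ y ∈ A₁, x < y → z ≤ y := by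
    intro x hx
    obtain ⟨z, ⟨hz, hxz⟩, hmin⟩ := exists_minimalFor_of_wellFoundedLT (fun y => y ∈ A₁ ∧ x < y) id
      (hunb x hx)
    exact ⟨z, hz, hxz, fun y hy hxy => (le_total z y).elim id (hmin ⟨hy, hxy⟩)⟩
  choose! s hs hlt hle using hnext
  obtain ⟨H, hHA, hH, hok⟩ := exists_greedy_subset (c := lam) (A := A₁)
    (fun p γ => ∀ x ∈ p, s x ≠ γ) (fun B _ hB => by
      obtain ⟨γ, hγ, hn⟩ := not_bddAbove_card hcard.ge (B := B ∪ s '' B)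
        ((mk_union_le _ _).trans_lt (add_lt_of_lt hlam.aleph0_le hB (mk_image_le.trans_lt hB)))
      exact ⟨γ, hγ, fun h => hn (Or.inl h), fun p hp x hx h => hn (Or.inr ⟨x, hp hx, h⟩)⟩)
  obtain ⟨H', hH'H, hH'⟩ := le_mk_iff_exists_subset.1 hH
  have hne : ∀ x ∈ H', ∀ y ∈ H', x < y → s x ≠ y := fun x hx y hy hxy =>
    hok y (hH'H hy) {x} (by simpa using hH'H hx) (by simpa using hxy) x (Finset.mem_singleton_self x)
  have hA₁' : H' ⊆ A₁ := hH'H.trans hHA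
  refine ⟨H', hA₁'.trans hA₁, hH', fun x hx => ⟨s x, hA₁ (hs x (hA₁' hx)), fun h => ?_,
    hlt x (hA₁' hx), fun y hy hxy => ?_⟩⟩
  · exact hne x hx _ h (hlt x (hA₁' hx)) rfl
  · exact lt_of_le_of_ne (hle x (hA₁' hx) y (hA₁' hy) hxy) (hne x hx y hy hxy)

/-- The values on a root depend only on the root. -/
theorem UniformOn.eq_of_root {n : ℕ} {H H' : Set W} {u : Finset W → I → Option X}
    {r : Finset ℕ → Set I} (h : UniformOn n H u r) (hH : H' ⊆ H)
    (hgap : ∀ x ∈ H', ∃ z ∈ H, z ∉ H' ∧ x < z ∧ ∀ y ∈ H', x < y → z < y)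
    {b c b' c' : Finset W} (hb : ↑b ⊆ H') (hb' : ↑b' ⊆ H') (hc : ↑c ⊆ H') (hbn : b.card = n)
    (hbn' : b'.card = n) (hcn : c.card = n) (hal : FAligned b b') (hd : b ∩ b' = c ∩ c')
    (hm : fcommonPos b b' = fcommonPos c c') {i : I} {x : X} (hx : u b i = some x)
    (hx' : u b' i = some x) : u c i = some x := by
  classical
  choose! s hsH hsH' hs hslt using hgap
  -- Points of `b` outside the root move up into the next gap. This preserves order, hence
  -- positions, and the image of `b` meets `H'` exactly in the root.
  let g : W → W := fun x => if x ∈ b ∩ b' then x else s x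
  have hgH : ∀ x ∈ H', x ≤ g x ∧ ∀ y ∈ H', x < y → g x < y := by
    intro x hx
    dsimp only [g]
    split_ifs
    · exact ⟨le_rfl, fun _ _ => id⟩
    · exact ⟨(hs x hx).le, hslt x hx⟩
  have hg : StrictMonoOn g b := fun y hy z hz hyz =>
    ((hgH y (hb hy)).2 z (hb hz) hyz).trans_le (hgH z (hb hz)).1
  have hgd : ∀ y ∈ b ∩ b', g y = y := fun y hy => if_pos hy
  have hge : ∀ y ∈ b, g y ∈ H' → y ∈ b ∩ b' := by
    intro y hy hgy
    by_contra hn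
    simp only [g, if_neg hn] at hgy
    exact hsH' y (hb hy) hgy
  have heH : ↑(b.image g) ⊆ H := by
    rw [Finset.coe_image]
    rintro _ ⟨y, hy, rfl⟩
    dsimp only [g]
    split_ifs
    · exact hH (hb hy)
    · exact hsH y (hb hy)
  have hen : (b.image g).card = n := by rw [Finset.card_image_of_injOn hg.injOn, hbn]
  have hpos : ∀ y ∈ b ∩ b', pos (b.image g) y = pos b y := fun y hy => by
    conv_lhs => rw [← hgd y hy]
    exact pos_image hg (Finset.mem_inter.1 hy).1
  have hdc : b ∩ b' ⊆ c := hd ▸ Finset.inter_subset_left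
  -- Any `n`-set of `H'` with the root at the same positions is aligned with the image of `b` and
  -- meets it only in the root. Applied to `b` and to `c`, this identifies their `i`-th values.
  have key : ∀ a : Finset W, ↑a ⊆ H' → a.card = n → b ∩ b' ⊆ a →
      (b ∩ b').image (pos b) = (b ∩ b').image (pos a) → (Hit (u a) (u (b.image g)) i i) := by
    intro a ha han hda him
    have hint : a ∩ b.image g = b ∩ b' := by
      ext y
      constructor
      · intro hy
        obtain ⟨hya, hye⟩ := Finset.mem_inter.1 hy
        obtain ⟨z, hz, rfl⟩ := Finset.mem_image.1 hye
        have hzd := hge z hz (ha hya)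
        rwa [hgd z hzd]
      · intro hy
        refine Finset.mem_inter.2 ⟨hda hy, ?_⟩
        rw [← hgd y hy]
        exact Finset.mem_image_of_mem _ (Finset.mem_inter.1 hy).1
    have hal' : FAligned a (b.image g) := by
      refine ⟨han.trans hen.symm, fun y hya hye => ?_⟩
      have hy : y ∈ b ∩ b' := hint ▸ Finset.mem_inter.2 ⟨hya, hye⟩
      rw [hpos y hy, pos_eq_pos_of_image_eq Finset.inter_subset_left hda him hy]
    refine (h.hit a _ (ha.trans hH) heH han hen hal' i i).2 ⟨rfl, ?_⟩
    rw [fcommonPos, hint, ← him]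
    exact ((h.hit b b' (hb.trans hH) (hb'.trans hH) hbn hbn' hal i i).1 ⟨x, hx, hx'⟩).2
  have h1 := key b hb hbn Finset.inter_subset_left rfl
  have h2 := key c hc hcn hdc (by rwa [fcommonPos, fcommonPos, ← hd] at hm)
  rw [h2.eq, ← h1.eq, hx]

theorem exists_enumeration_of_finite {S : Set X} (hS : S.Finite) :
    ∃ f : ULift.{u} ℕ → Option X, #(labels f) < ℵ₀ ∧ LabelInjective f ∧
      ∀ x, x ∈ S ↔ ∃ i, f i = some x := by
  obtain ⟨l, hl, hnd⟩ : ∃ l : List X, (∀ x, x ∈ S ↔ x ∈ l) ∧ l.Nodup :=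
    ⟨hS.toFinset.toList, by simp, Finset.nodup_toList _⟩
  refine ⟨fun i => l[i.down]?, ?_, ?_, fun x => ?_⟩
  · rw [lt_aleph0_iff_set_finite]
    refine (((finite_Iio l.length).preimage ULift.down_injective.injOn)).subset ?_
    rintro i ⟨x, hx, -⟩
    exact (List.getElem?_eq_some_iff.1 hx).1
  · rintro i j ⟨x, hx, hx'⟩
    obtain ⟨hi, h1⟩ := List.getElem?_eq_some_iff.1 hx
    obtain ⟨hj, h2⟩ := List.getElem?_eq_some_iff.1 hx'
    exact ULift.down_injective (hnd.getElem_inj_iff.1 (h1.trans h2.symm))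
  · rw [hl, List.mem_iff_getElem?]
    exact ⟨fun ⟨i, hi⟩ => ⟨⟨i⟩, hi⟩, fun ⟨i, hi⟩ => ⟨i.down, hi⟩⟩

end Finite

/-- Uniformization with `κ = ℵ₀` fixes which labels are shared. The root attached to `m` and `d`
collects the points shared by any pair with these data, and `UniformOn.eq_of_root` shows that every
such pair shares them. -/
theorem exists_deltaSystem_of_sigma_le {lam μ : Cardinal.{u}} (hlam : lam.IsRegular)
    (hunc : ℵ₀ < lam) {n : ℕ} (hn : 1 ≤ n) (h : sigma lam n ≤ μ) {X : Type v}
    {U : Set Ordinal.{u} → Set X} (hU : ∀ b ∈ subsetsOfCard (Iio μ.ord) n, (U b).Finite) :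
    ∃ H ∈ subsetsOfCard (Iio μ.ord) lam, IsDeltaSystem n H U := by
  classical
  have henum : ∀ b : Finset μ.ord.ToType, ∃ f : ULift.{u} ℕ → Option X, #(labels f) < ℵ₀ ∧
      LabelInjective f ∧ (b.card = n → ∀ x, x ∈ U (toOrd μ '' ↑b) ↔ ∃ i, f i = some x) := by
    intro b
    by_cases hb : b.card = n
    · obtain ⟨f, h1, h2, h3⟩ := exists_enumeration_of_finite
        (hU _ (mem_subsetsOfCard_iff.2 ⟨b, hb, rfl⟩))
      exact ⟨f, h1, h2, fun _ => h3⟩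
    · obtain ⟨f, h1, h2, -⟩ := exists_enumeration_of_finite (finite_empty (α := X))
      exact ⟨f, h1, h2, fun hb' => absurd hb' hb⟩
  choose u hu1 hu2 hu using henum
  obtain ⟨H, -, hH, -, ⟨r, hr⟩, -⟩ := uniformization hlam hunc (ltInaccessible_aleph0 hunc)
    (I := ULift.{u} ℕ) (by simpa using hunc) hn PUnit
    (by simpa using one_lt_aleph0.trans hunc) univ (by rwa [mk_eq_of_image_toOrd]) u hu1 hu2
    fun _ => PUnit.unit
  obtain ⟨H', hH'H, hH', hgap⟩ := exists_gap_subset hlam hH.ge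
  refine ⟨toOrd μ '' H', image_mem_subsetsOfCard hH', fun m d => {x | ∃ b b' : Finset μ.ord.ToType,
    ↑b ⊆ H' ∧ ↑b' ⊆ H' ∧ b.card = n ∧ b'.card = n ∧ FAligned b b' ∧
    commonPos (toOrd μ '' ↑b) (toOrd μ '' ↑b') = m ∧ toOrd μ '' ↑b ∩ toOrd μ '' ↑b' = d ∧
    x ∈ U (toOrd μ '' ↑b) ∩ U (toOrd μ '' ↑b')}, ?_⟩
  intro s hs s' hs' m _ hal hm
  obtain ⟨c, hc, hcn, rfl⟩ := (mem_subsetsOfCard_image toOrd_strictMono).1 hs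
  obtain ⟨c', hc', hcn', rfl⟩ := (mem_subsetsOfCard_image toOrd_strictMono).1 hs'
  rw [aligned_image toOrd_strictMono] at hal
  ext x
  refine ⟨fun hx => ⟨c, c', hc, hc', hcn, hcn', hal, hm, rfl, hx⟩, ?_⟩
  rintro ⟨b, b', hb, hb', hbn, hbn', hal', rfl, hd, hx, hx'⟩
  rw [← image_inter toOrd_strictMono.injective, ← image_inter toOrd_strictMono.injective,
    toOrd_strictMono.injective.image_injective.eq_iff, ← Finset.coe_inter, ← Finset.coe_inter,
    Finset.coe_inj] at hd
  rw [commonPos_image toOrd_strictMono, commonPos_image toOrd_strictMono,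
    (Nat.cast_injective (R := Ordinal.{u + 1})).image_injective.eq_iff, Finset.coe_inj] at hm
  obtain ⟨i, hi⟩ := (hu b hbn x).1 hx
  obtain ⟨j, hj⟩ := (hu b' hbn' x).1 hx'
  obtain ⟨rfl, hir⟩ := (hr.hit b b' (hb.trans hH'H) (hb'.trans hH'H) hbn hbn' hal' i j).1
    ⟨x, hi, hj⟩
  have hci := hr.eq_of_root hH'H hgap hb hb' hc hbn hbn' hcn hal' hd hm.symm hi hj
  have hcc := (hr.hit c c' (hc.trans hH'H) (hc'.trans hH'H) hcn hcn' hal i i).2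
    ⟨rfl, by rwa [hm]⟩
  exact ⟨(hu c hcn x).2 ⟨i, hci⟩, (hu c' hcn' x).2 ⟨i, hcc.eq ▸ hci⟩⟩

/-! ### From `Δ`-systems back to the partition relation. -/

/-- Take the singleton of the colour of `b`. Two sets `b`, `b'` have a common disjoint set `d`, and
both meet the singleton of `d` in the root `R ∅ ∅`. So `b` has the colour of `d` exactly when `b'`
does, and with two colours this makes the colours of `b` and `b'` equal. -/
theorem arrow_of_deltaSystem {lam μ : Cardinal.{u}} (hlam : ℵ₀ ≤ lam) {n : ℕ}
    (h : ∀ (X : Type v) (U : Set Ordinal.{u} → Set X),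
      (∀ b ∈ subsetsOfCard (Iio μ.ord) n, (U b).Finite) →
      ∃ H ∈ subsetsOfCard (Iio μ.ord) lam, IsDeltaSystem n H U) : Arrow μ lam n 2 := by
  classical
  intro c hc
  obtain ⟨s, hs, R, hR⟩ := h (ULift.{v} Bool) (fun s => {ULift.up (decide (c s = 0))})
    fun _ _ => finite_singleton _
  refine ⟨s, hs, ?_⟩
  obtain ⟨H, hH, rfl⟩ := exists_image_eq_of_mem_subsetsOfCard hs
  have hinf : H.Infinite := by rwa [← infinite_coe_iff, infinite_iff, hH]
  intro s hs1 s' hs2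
  have hv := lt_two_ord.1 (hc s (subsetsOfCard_mono hs.1 _ hs1))
  have hv' := lt_two_ord.1 (hc s' (subsetsOfCard_mono hs.1 _ hs2))
  obtain ⟨b, hb, hbn, rfl⟩ := (mem_subsetsOfCard_image toOrd_strictMono).1 hs1
  obtain ⟨b', hb', hbn', rfl⟩ := (mem_subsetsOfCard_image toOrd_strictMono).1 hs2
  obtain ⟨d, hd, hdn⟩ := (hinf.sdiff (b ∪ b').finite_toSet).exists_subset_card_eq n
  have key : ∀ a : Finset μ.ord.ToType, ↑a ⊆ H → a.card = n → Disjoint a d →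
      ({ULift.up (decide (c (toOrd μ '' ↑a) = 0))} ∩
        {ULift.up (decide (c (toOrd μ '' ↑d) = 0))} : Set (ULift.{v} Bool)) = R ∅ ∅ := by
    intro a ha han hdis
    have hint := Finset.disjoint_iff_inter_eq_empty.1 hdis
    have hal : FAligned a d := ⟨han.trans hdn.symm, fun x hx hx' =>
      absurd hx' (Finset.disjoint_left.1 hdis hx)⟩
    rw [hR _ ((mem_subsetsOfCard_image toOrd_strictMono).2 ⟨a, ha, han, rfl⟩) _
      ((mem_subsetsOfCard_image toOrd_strictMono).2 ⟨d, fun x hx => (hd hx).1, hdn, rfl⟩) ∅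
      (empty_subset _) ((aligned_image toOrd_strictMono).2 hal), ← image_inter
      toOrd_strictMono.injective, ← Finset.coe_inter, hint]
    · simp
    · rw [commonPos_image toOrd_strictMono, fcommonPos, hint]
      simp
  have hdis : ∀ x ∈ d, x ∉ b ∪ b' := fun x hx => (hd hx).2
  have h1 := (key b hb hbn (Finset.disjoint_right.2 fun x hx hxb =>
    hdis x hx (Finset.mem_union_left _ hxb))).trans
    (key b' hb' hbn' (Finset.disjoint_right.2 fun x hx hxb =>
      hdis x hx (Finset.mem_union_right _ hxb))).symm
  have h2 := Set.ext_iff.1 h1 (ULift.up true)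
  have h3 := Set.ext_iff.1 h1 (ULift.up false)
  by_cases hdz : c (toOrd μ '' ↑d) = 0 <;> rcases hv with hv | hv <;> rcases hv' with hv' | hv' <;>
    simp_all

theorem arrow_of_uniformDeltaSystem {lam μ : Cardinal.{u}} (hunc : ℵ₀ < lam) {n : ℕ}
    (h : ∀ (κ ν : Cardinal.{u}) (g : Set Ordinal.{u} → Ordinal.{u})
      (U : Set Ordinal.{u} → Set Ordinal.{u}), ℵ₀ ≤ κ → ℵ₀ ≤ ν → ν < lam → LTInaccessible κ lam →
      IsColoring μ n ν g → (∀ b ∈ subsetsOfCard (Iio μ.ord) n, #(U b) < lift.{u + 1} κ) →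
      ∃ H ∈ subsetsOfCard (Iio μ.ord) lam, ∃ k < ν.ord, (∀ b ∈ subsetsOfCard H n, g b = k) ∧
        IsUniformDeltaSystem n H U ∧ ReplacementInvariant n H U) : Arrow μ lam n 2 := by
  intro c hc
  -- Empty sets and `κ = ν = ℵ₀`: only the colouring clause is used.
  obtain ⟨H, hH, k, -, hk, -⟩ := h ℵ₀ ℵ₀ c (fun _ => ∅) le_rfl le_rfl hunc
    (ltInaccessible_aleph0 hunc)
    (fun b hb => (hc b hb).trans (ord_lt_ord.2 (by exact_mod_cast natCast_lt_aleph0 (n := 2))))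
    fun _ _ => by simp [aleph0_pos]
  exact ⟨H, hH, fun b hb b' hb' => (hk b hb).trans (hk b' hb').symm⟩

end HDelta

/-! ### The equivalence. -/

theorem corollary3p10 (n : ℕ) (hn : 1 ≤ n) (lam μ : Cardinal.{u})
    (hlam : lam.IsRegular) (hμ : μ.IsRegular)
    (hlam_unc : Cardinal.aleph0 < lam) (hlam_wc : ¬ HDelta.IsWeaklyCompact lam) :
    List.TFAE [
      HDelta.sigma lam n ≤ μ,
      HDelta.Arrow μ lam n 2,
      ∀ ν : Cardinal.{u}, ν < lam →
        HDelta.ArrowOrd μ (lam.ord + ((n - 1 : ℕ) : Ordinal.{u})) n ν,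
      ∀ (X : Type v) (U : Set Ordinal.{u} → Set X),
        (∀ b ∈ HDelta.subsetsOfCard (Set.Iio μ.ord) n, (U b).Finite) →
        ∃ H ∈ HDelta.subsetsOfCard (Set.Iio μ.ord) lam, HDelta.IsDeltaSystem n H U,
      ∀ (κ ν : Cardinal.{u}) (g : Set Ordinal.{u} → Ordinal.{u})
        (U : Set Ordinal.{u} → Set Ordinal.{u}),
        Cardinal.aleph0 ≤ κ → Cardinal.aleph0 ≤ ν → ν < lam →
        HDelta.LTInaccessible κ lam →
        HDelta.IsColoring μ n ν g →
        (∀ b ∈ HDelta.subsetsOfCard (Set.Iio μ.ord) n,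
          Cardinal.mk (U b) < Cardinal.lift.{u + 1} κ) →
        ∃ H ∈ HDelta.subsetsOfCard (Set.Iio μ.ord) lam, ∃ k < ν.ord,
          (∀ b ∈ HDelta.subsetsOfCard H n, g b = k) ∧
          HDelta.IsUniformDeltaSystem n H U ∧
          HDelta.ReplacementInvariant n H U] := by
  tfae_have 1 → 3 := fun h ν hν => HDelta.arrowOrd_of_sigma_le hlam hn h hν
  tfae_have 3 → 2 := fun h => HDelta.arrow_of_arrowOrd hlam.aleph0_le _
    (h 2 (lt_trans (mod_cast Cardinal.natCast_lt_aleph0 (n := 2)) hlam_unc))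
  tfae_have 2 → 1 := HDelta.sigma_le_of_arrow hlam hlam_unc hlam_wc hn
  tfae_have 1 → 4 := fun h _ _ hU => HDelta.exists_deltaSystem_of_sigma_le hlam hlam_unc hn h hU
  tfae_have 4 → 2 := HDelta.arrow_of_deltaSystem hlam.aleph0_le
  tfae_have 1 → 5 := fun h _ _ _ _ hκ0 hν0 hν hκ hg hU =>
    HDelta.exists_uniformDeltaSystem_of_sigma_le hlam hlam_unc hn h hκ0 hν0 hν hκ hg hU
  tfae_have 5 → 2 := HDelta.arrow_of_uniformDeltaSystem hlam_unc
  tfae_finish
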